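/- Let $U$ be a linearly ordered set with $tw$ elements and, for $A,B\subseteq U$, put $I_{A,B}=(-1)^{|\{(a,b)\in A\times B\,:\,a>b\}|}$. Let $f_i,g_i:2^U\times 2^U\times 2^U\to\mathbb Z$ $(i\ge 0)$ be functions with values of at most $b$ bits such that $f_i(A,B,C)\neq 0$ or $g_i(A,B,C)\ne 0$ only if $i\le n$ and $B\cup C\subseteq A$. The Steiner tree join convolution of $f$ and $g$ is $$h_i(A,B,C)=\sum_{\substack{i_y+i_z=i+|A|\\ B_y\uplus B_z=B\\ C_y\uplus C_z=C}} f_{i_y}(A,B_y,C_y)\,g_{i_z}(A,B_z,C_z)\,I_{B_y,B_z}\,I_{C_y,C_z},$$ where $X\uplus Y=Z$ means $X\cup Y=Z$ and $X\cap Y=\emptyset$. Running times are total bit costs on a random access machine over the integers (logarithmic cost: an elementary operation costs a fixed polynomial in the bit lengths of its operands, and a memory access costs the bit length of the address and of the contents). Call a real number $w$ an achievable exponent if a single program multiplies any two $N\times N$ integer matrices with $b$-bit entries, $N\ge 1$, in time $N^{w}\cdot\mathrm{poly}(\log N,b)$, and let the matrix multiplication exponent $\omega$ be the infimum of the achievable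 exponents. Then, whenever the exponent $w$ is achievable, the convolution can be computed in time $O^*((2^{w}+1)^{tw})$: there is a single program that, given $tw$, $n$, $f$ and $g$, computes all values $h_i(A,B,C)$ in time at most $p(tw,n,b)\cdot(2^{w}+1)^{tw}$ for some polynomial $p$. In particular the time is $O^*((2^{\omega}+1)^{tw})$ if $\omega$ itself is achievable, and without this assumption it is $O^*((2^{\omega+\varepsilon}+1)^{tw})$ for every $\varepsilon>0$. -/

import Mathlib

/-! ## The machine model

A random access machine over the integers with logarithmic (bit) cost, presented as a structured
language.  The memory consists of finitely many (per program) named arrays of integers; arrays are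
indexed by integers, and every cell that holds no input is initially `0`.  A program is one fixed
finite text, which has to work for inputs of all sizes. -/

namespace RAM

/-- Elementary integer operations; comparisons return `1` (true) or `0` (false). -/
inductive Op
  | add | sub | mul | div | mod | lt | eq

/-- Integer division and remainder are Mathlib's (`x / 0 = 0`, `x % 0 = x`). -/
def Op.apply : Op → ℤ → ℤ → ℤ
  | .add, x, y => x + y
  | .sub, x, y => x - y
  | .mul, x, y => x * y
  | .div, x, y => x / y
  | .mod, x, y => x % y
  | .lt, x, y => if x < y then 1 else 0
  | .eq, x, y => if x = y then 1 else 0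

/-- Expressions: integer constants, array cells `a[e]`, elementary operations. -/
inductive Expr
  | const (c : ℤ)
  | read (a : ℕ) (idx : Expr)
  | op (o : Op) (e₁ e₂ : Expr)

/-- Programs: assignments `a[idx] := e`, sequencing, branching on `e ≠ 0`, and loops that run
while `e ≠ 0`. -/
inductive Prog
  | assign (a : ℕ) (idx e : Expr)
  | seq (p q : Prog)
  | branch (e : Expr) (p q : Prog)
  | loop (e : Expr) (p : Prog)

/-- Memory contents: `s a z` is the integer in cell `z` of the array `a`. -/
abbrev State := ℕ → ℤ → ℤ

/-- Number of binary digits of the absolute value. -/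
def bits (x : ℤ) : ℕ := x.natAbs.size

def Expr.eval (s : State) : Expr → ℤ
  | .const c => c
  | .read a idx => s a (idx.eval s)
  | .op o e₁ e₂ => o.apply (e₁.eval s) (e₂.eval s)

/-- Cost of evaluating an expression.  Every elementary operation is charged quadratically in the
bit lengths of its operands (the schoolbook bound for multiplication and division); a memory access
is charged the bit lengths of the address and of the contents. -/
def Expr.cost (s : State) : Expr → ℕ
  | .const c => 1 + bits c
  | .read a idx => idx.cost s + 1 + bits (idx.eval s) + bits (s a (idx.eval s))
  | .op _ e₁ e₂ => e₁.cost s + e₂.cost s + (1 + bits (e₁.eval s) + bits (e₂.eval s)) ^ 2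

/-- Overwrite cell `z` of the array `a` by `x`. -/
def State.write (s : State) (a : ℕ) (z x : ℤ) : State :=
  fun a' z' => if a' = a ∧ z' = z then x else s a' z'

/-- `Exec p s s' t`: started in the memory `s`, the program `p` halts in the memory `s'` after time
`t` (total bit cost). -/
inductive Exec : Prog → State → State → ℕ → Prop
  | assign (a : ℕ) (idx e : Expr) (s : State) :
      Exec (.assign a idx e) s (s.write a (idx.eval s) (e.eval s))
        (idx.cost s + e.cost s + 1 + bits (idx.eval s) + bits (e.eval s))
  | seq {p q : Prog} {s₁ s₂ s₃ : State} {t₁ t₂ : ℕ} :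
      Exec p s₁ s₂ t₁ → Exec q s₂ s₃ t₂ → Exec (.seq p q) s₁ s₃ (t₁ + t₂)
  | branch_true {e : Expr} {p q : Prog} {s s' : State} {t : ℕ} :
      e.eval s ≠ 0 → Exec p s s' t → Exec (.branch e p q) s s' (e.cost s + 1 + t)
  | branch_false {e : Expr} {p q : Prog} {s s' : State} {t : ℕ} :
      e.eval s = 0 → Exec q s s' t → Exec (.branch e p q) s s' (e.cost s + 1 + t)
  | loop_true {e : Expr} {p : Prog} {s₁ s₂ s₃ : State} {t₁ t₂ : ℕ} :
      e.eval s₁ ≠ 0 → Exec p s₁ s₂ t₁ → Exec (.loop e p) s₂ s₃ t₂ →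
      Exec (.loop e p) s₁ s₃ (e.cost s₁ + 1 + t₁ + t₂)
  | loop_false {e : Expr} {p : Prog} {s : State} :
      e.eval s = 0 → Exec (.loop e p) s s (e.cost s + 1)

end RAM

/-! ## The exponent of matrix multiplication -/

namespace MatMul

/-- The row-major layout of a matrix: entry `(i, j)` is in cell `N * i + j`, other cells are `0`. -/
def layout {N : ℕ} (M : Matrix (Fin N) (Fin N) ℤ) (z : ℤ) : ℤ :=
  if h : 0 ≤ z ∧ z.toNat < N * N then
    M (finProdFinEquiv.symm ⟨z.toNat, h.2⟩).1 (finProdFinEquiv.symm ⟨z.toNat, h.2⟩).2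
  else 0

/-- Input of matrix multiplication: `N` in cell `0` of array `0`, the two matrices in arrays `1`
and `2`; everything else is `0`. -/
def input {N : ℕ} (M M' : Matrix (Fin N) (Fin N) ℤ) : RAM.State
  | 0 => fun z => if z = 0 then (N : ℤ) else 0
  | 1 => layout M
  | 2 => layout M'
  | _ => fun _ => 0

/-- Integer `N × N` matrices with `b`-bit entries can be multiplied by one program (product in
array `3`) in time `N ^ w`, up to a factor polynomial in `b` and in the bit length of `N`. -/
def InTime (w : ℝ) : Prop :=
  ∃ (P : RAM.Prog) (K d : ℕ), ∀ (N b : ℕ) (M M' : Matrix (Fin N) (Fin N) ℤ), 0 < N →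
    (∀ i j, RAM.bits (M i j) ≤ b) → (∀ i j, RAM.bits (M' i j) ≤ b) →
    ∃ (s : RAM.State) (t : ℕ), RAM.Exec P (input M M') s t ∧
      (∀ i j : Fin N, s 3 ((N : ℤ) * i + j) = (M * M') i j) ∧
      (t : ℝ) ≤ (K : ℝ) * ((N.size + b : ℕ) : ℝ) ^ d * (N : ℝ) ^ w

/-- The matrix multiplication exponent `ω`. -/
noncomputable def omega : ℝ := sInf {w : ℝ | InTime w}

end MatMul

/-! ## The convolution at a join node -/

namespace SteinerJoin

section
variable {U : Type*} [Fintype U] [LinearOrder U]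

/-- `I_{A,B} = (-1) ^ |{(a, b) ∈ A × B : a > b}|`. -/
def sign (A B : Finset U) : ℤ :=
  (-1) ^ ((A ×ˢ B).filter fun p => p.1 > p.2).card

/-- The pairs `(X, Y)` with `X ⊎ Y = B`. -/
def splits (B : Finset U) : Finset (Finset U × Finset U) :=
  Finset.univ.filter fun p => p.1 ∪ p.2 = B ∧ p.1 ∩ p.2 = ∅

/-- `h_i(A,B,C)`, the sum over `i_y + i_z = i + |A|`, `B_y ⊎ B_z = B`, `C_y ⊎ C_z = C` of
`f_{i_y}(A,B_y,C_y) g_{i_z}(A,B_z,C_z) I_{B_y,B_z} I_{C_y,C_z}`. -/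
def conv (f g : ℕ → Finset U → Finset U → Finset U → ℤ) (i : ℕ) (A B C : Finset U) : ℤ :=
  ∑ k ∈ Finset.HasAntidiagonal.antidiagonal (i + A.card), ∑ p ∈ splits B, ∑ q ∈ splits C,
    f k.1 A p.1 q.1 * g k.2 A p.2 q.2 * sign p.1 p.2 * sign q.1 q.2

/-- The admissible tables: a nonzero value occurs only for `i ≤ n` and `B ∪ C ⊆ A`, and every value
has at most `b` bits. -/
def Admissible (n b : ℕ) (f : ℕ → Finset U → Finset U → Finset U → ℤ) : Prop :=
  ∀ i A B C, (f i A B C ≠ 0 → i ≤ n ∧ B ∪ C ⊆ A) ∧ RAM.bits (f i A B C) ≤ b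

end

/-- The subset of `{0, …, tw - 1}` given by the `tw` lowest binary digits of `m`. -/
def decode (tw m : ℕ) : Finset (Fin tw) :=
  Finset.univ.filter fun v => m.testBit v = true

/-- The layout of a table as an array: identifying a subset `S` with the number `∑ v ∈ S, 2 ^ v`,
the value `f_i(A,B,C)` is in cell `8 ^ tw * i + 4 ^ tw * A + 2 ^ tw * B + C`. -/
def layout {tw : ℕ} (f : ℕ → Finset (Fin tw) → Finset (Fin tw) → Finset (Fin tw) → ℤ)
    (z : ℤ) : ℤ :=
  if z < 0 then 0
  else f (z.toNat / 8 ^ tw) (decode tw (z.toNat / 4 ^ tw)) (decode tw (z.toNat / 2 ^ tw))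
    (decode tw z.toNat)

/-- Input of the convolution: `tw` and `n` in cells `0` and `1` of array `0`, the tables `f` and `g`
in arrays `1` and `2`; everything else is `0`. -/
def input {tw : ℕ} (n : ℕ)
    (f g : ℕ → Finset (Fin tw) → Finset (Fin tw) → Finset (Fin tw) → ℤ) : RAM.State
  | 0 => fun z => if z = 0 then (tw : ℤ) else if z = 1 then (n : ℤ) else 0
  | 1 => layout f
  | 2 => layout g
  | _ => fun _ => 0

/-- One program computes the convolution (the whole table, in array `3`) in time `O*(c ^ tw)`, that
is, `c ^ tw` up to a factor polynomial in `tw`, `n` and the bit length `b` of the input values. -/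
def InTime (c : ℝ) : Prop :=
  ∃ (P : RAM.Prog) (K d : ℕ), ∀ (tw n b : ℕ)
    (f g : ℕ → Finset (Fin tw) → Finset (Fin tw) → Finset (Fin tw) → ℤ),
    Admissible n b f → Admissible n b g →
    ∃ (s : RAM.State) (t : ℕ), RAM.Exec P (input n f g) s t ∧
      s 3 = layout (conv f g) ∧
      (t : ℝ) ≤ (K : ℝ) * ((tw + n + b + 1 : ℕ) : ℝ) ^ d * c ^ tw

end SteinerJoin

/-! ### Bit lengths, cost of expressions, and loops with invariants. -/

namespace RAM

/-! Fix a set `A` with `a` elements. Apart from the bookkeeping of degrees, the sum over `B_y ⊎ B_z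
= B`, `C_y ⊎ C_z = C` with the two signs is multiplication in an exterior algebra on `2a`
generators. This algebra is the associated graded of the Clifford algebra of a split quadratic form,
and the latter is the algebra of all `2^a × 2^a` matrices, acting on Fock space: the pair `(B, C)`
stands for the normally ordered monomial "create `B`, annihilate `C`". So the tables at `A` are
turned into two matrices by `fock 1`, the matrices are multiplied, and the product is turned back
into coefficients by `fock (-1)`.

The matrix product contains, besides the exterior product, terms in which annihilators are
contracted with creators. Every contraction lowers the number of annihilators. If the two factors
are therefore cut into parts with `|C| = r₁` and `|C| = r₂`, then the coefficients with `|C| = r₁ +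
r₂` see no contraction. This is `fock_mul_fock`, proved by expanding all sums and cancelling the
unwanted terms by a sign-reversing involution (`termSign_toggle`); a count (`mem_of_rank`) shows
that the surviving terms are exactly the splittings. The sign obtained is not quite the wanted one;
the difference depends only on `r₁`, `r₂` and `|B_z|` and is put into the second factor beforehand
(`part`, `contrib_eq`). Summation over degrees and ranks gives the convolution (`sum_contrib`).

The transforms are computed in place, one element of `A` at a time, like a fast zeta transform
(`fockBelow_decode_succ`), with `O(a · 4^a)` operations. Every achievable exponent `w` is at least
`2` (`MatMul.InTime.two_le`), so this is dominated by the matrix multiplication bound `2^(wa)` up to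
polynomial factors. There are polynomially many degrees and ranks, and the sum of `2^(w|A|)` over
all `A` is `(2^w + 1)^tw` by the binomial theorem (`sum_pow_below`).

On the machine, one given multiplication program `P` has to be run many times, each time on a memory
that is empty except for its input. Its arrays are moved out of the way and every address it writes
to is recorded, so that its memory can be erased afterwards in time comparable to its running time
(`exec_logged`, `runs_callMatMul`). All numbers of the surrounding program have at most `L` bits,
`L` linear in `tw + n + b + 1`, so that every elementary statement costs at most `unit L`, a
polynomial. The version with `ε` follows since the cubic school method shows that some exponent is
achievable, so that achievable exponents come arbitrarily close to their infimum. -/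

theorem bits_le_iff {x : ℤ} {L : ℕ} : bits x ≤ L ↔ |x| < 2 ^ L := by
  unfold bits
  rw [Nat.size_le, ← Int.natCast_natAbs]
  exact_mod_cast Iff.rfl

theorem bits_le_natAbs (x : ℤ) : bits x ≤ x.natAbs := Nat.size_le.2 Nat.lt_two_pow_self

theorem bits_mono {x y : ℤ} (h : |x| ≤ |y|) : bits x ≤ bits y := by
  rw [bits_le_iff]
  exact h.trans_lt (bits_le_iff.1 le_rfl)

theorem abs_lt_two_pow_bits (x : ℤ) : |x| < 2 ^ bits x := bits_le_iff.1 le_rfl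

@[simp] theorem bits_zero : bits 0 = 0 := by simp [bits]

theorem bits_apply_le (o : Op) (x y : ℤ) : bits (o.apply x y) ≤ bits x + bits y + 1 := by
  have hx := abs_lt_two_pow_bits x
  have hy := abs_lt_two_pow_bits y
  have px : (1 : ℤ) ≤ 2 ^ bits x := one_le_pow₀ (by norm_num)
  have py : (1 : ℤ) ≤ 2 ^ bits y := one_le_pow₀ (by norm_num)
  have small : ∀ z : ℤ, |z| ≤ 1 → bits z ≤ bits x + bits y + 1 := by
    intro z hz
    rw [bits_le_iff, pow_succ, pow_add]
    nlinarith
  rw [bits_le_iff, pow_succ, pow_add]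
  cases o with
  | add =>
    have := abs_add_le x y
    simp only [Op.apply]; nlinarith
  | sub =>
    have := abs_sub x y
    simp only [Op.apply]; nlinarith
  | mul =>
    simp only [Op.apply, abs_mul]
    nlinarith [abs_nonneg x, abs_nonneg y,
      mul_lt_mul'' hx hy (abs_nonneg x) (abs_nonneg y)]
  | div =>
    have h : |x / y| ≤ |x| := by
      rw [← Int.natCast_natAbs, ← Int.natCast_natAbs]
      exact_mod_cast Int.natAbs_ediv_le_natAbs x y
    simp only [Op.apply]; nlinarith
  | mod =>
    have h : |x % y| ≤ |x| + |y| := by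
      rcases eq_or_ne y 0 with rfl | h0
      · simp
      · rw [abs_of_nonneg (Int.emod_nonneg _ h0)]
        have := Int.emod_lt_abs x h0
        have := abs_nonneg x
        omega
    simp only [Op.apply]; nlinarith
  | lt =>
    rw [← pow_add, ← pow_succ, ← bits_le_iff]
    apply small; simp only [Op.apply]; split_ifs <;> simp
  | eq =>
    rw [← pow_add, ← pow_succ, ← bits_le_iff]
    apply small; simp only [Op.apply]; split_ifs <;> simp

/-- Size of an expression. -/
def Expr.len : Expr → ℕ
  | .const c => 1 + c.natAbs
  | .read _ i => 1 + i.len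
  | .op _ e₁ e₂ => 1 + e₁.len + e₂.len

/-- Every cell read during the evaluation has at most `L` bits. -/
def Expr.Bdd (L : ℕ) (s : State) : Expr → Prop
  | .const _ => True
  | .read a i => i.Bdd L s ∧ bits (s a (i.eval s)) ≤ L
  | .op _ e₁ e₂ => e₁.Bdd L s ∧ e₂.Bdd L s

theorem Expr.bits_eval_le {L : ℕ} {s : State} {e : Expr} (h : e.Bdd L s) :
    bits (e.eval s) ≤ e.len * (L + 1) := by
  induction e with
  | const c =>
    have := bits_le_natAbs c
    simp only [Expr.eval, Expr.len]; nlinarith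
  | read a i ih =>
    have := h.2
    simp only [Expr.eval, Expr.len]; nlinarith [Nat.zero_le (i.len * (L + 1))]
  | op o e₁ e₂ ih₁ ih₂ =>
    have h1 := ih₁ h.1
    have h2 := ih₂ h.2
    have := bits_apply_le o (e₁.eval s) (e₂.eval s)
    simp only [Expr.eval, Expr.len]; nlinarith

/-- The bit length of a subexpression grows at most linearly with its size (`bits_eval_le`), an
operation is charged the square of this, and there are at most `len` operations; hence the cube. -/
theorem Expr.cost_le {L : ℕ} {s : State} {e : Expr} (h : e.Bdd L s) :
    e.cost s ≤ e.len ^ 3 * (L + 1) ^ 2 := by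
  induction e with
  | const c =>
    have := bits_le_natAbs c
    simp only [Expr.cost, Expr.len]
    calc 1 + bits c ≤ (1 + c.natAbs) := by omega
      _ ≤ (1 + c.natAbs) ^ 3 := Nat.le_self_pow (by norm_num) _
      _ ≤ _ := Nat.le_mul_of_pos_right _ (by positivity)
  | read a i ih =>
    have h1 := ih h.1
    have h2 := Expr.bits_eval_le h.1
    have h3 := h.2
    simp only [Expr.cost, Expr.len]
    have e1 : (1 + i.len) ^ 3 * (L + 1) ^ 2
        = i.len ^ 3 * (L + 1) ^ 2 + (1 + 3 * i.len + 3 * i.len ^ 2) * (L + 1) ^ 2 := by ring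
    have e2 : (1 + i.len) * (L + 1) ≤ (1 + 3 * i.len + 3 * i.len ^ 2) * (L + 1) ^ 2 :=
      Nat.mul_le_mul (by nlinarith) (by nlinarith)
    nlinarith
  | op o e₁ e₂ ih₁ ih₂ =>
    have h1 := ih₁ h.1
    have h2 := ih₂ h.2
    have h3 := Expr.bits_eval_le h.1
    have h4 := Expr.bits_eval_le h.2
    simp only [Expr.cost, Expr.len]
    have e1 : (1 + bits (e₁.eval s) + bits (e₂.eval s)) ^ 2
        ≤ ((1 + e₁.len + e₂.len) * (L + 1)) ^ 2 := Nat.pow_le_pow_left (by nlinarith) 2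
    have e2 : e₁.len ^ 3 + e₂.len ^ 3 + (1 + e₁.len + e₂.len) ^ 2 ≤ (1 + e₁.len + e₂.len) ^ 3 := by
      generalize e₁.len = x
      generalize e₂.len = y
      have : (1 + x + y) ^ 3 = (1 + x + y) ^ 2 + (x + y) * (1 + x + y) ^ 2 := by ring
      have h5 : x ^ 3 + y ^ 3 ≤ (x + y) * (1 + x + y) ^ 2 := by
        have : (x + y) * (1 + x + y) ^ 2 = x ^ 3 + y ^ 3 + (x + y + 2 * (x + y) ^ 2
          + 3 * x * y * (x + y)) := by ring
        omega
      omega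
    calc _ ≤ (e₁.len ^ 3 + e₂.len ^ 3 + (1 + e₁.len + e₂.len) ^ 2) * (L + 1) ^ 2 := by
            rw [mul_pow] at e1; nlinarith
      _ ≤ _ := Nat.mul_le_mul_right _ e2

/-- The program halts, started in `s`, in `s'` within time `t`. -/
def Runs (p : Prog) (s s' : State) (t : ℕ) : Prop := ∃ t' ≤ t, Exec p s s' t'

/-- A bound on the cost of an elementary statement working on numbers of at most `L` bits. -/
def unit (L : ℕ) : ℕ := 10 ^ 9 * (L + 1) ^ 2

theorem Runs.mono {p : Prog} {s s' : State} {t t' : ℕ} (h : Runs p s s' t) (ht : t ≤ t') :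
    Runs p s s' t' := by
  obtain ⟨u, hu, hx⟩ := h
  exact ⟨u, hu.trans ht, hx⟩

theorem Runs.seq {p q : Prog} {s s' s'' : State} {t t' : ℕ} (h : Runs p s s' t)
    (h' : Runs q s' s'' t') : Runs (.seq p q) s s'' (t + t') := by
  obtain ⟨u, hu, hx⟩ := h
  obtain ⟨u', hu', hx'⟩ := h'
  exact ⟨u + u', by omega, .seq hx hx'⟩

theorem Expr.cost_add_le_unit {L : ℕ} {s : State} {e e' : Expr} (h : e.Bdd L s) (h' : e'.Bdd L s)
    (hl : 1 + e.len + e'.len ≤ 1000) :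
    e.cost s + e'.cost s + 1 + bits (e.eval s) + bits (e'.eval s) ≤ unit L := by
  have h1 := Expr.cost_le h
  have h2 := Expr.cost_le h'
  have h3 := Expr.bits_eval_le h
  have h4 := Expr.bits_eval_le h'
  have e2 : e.len ^ 3 + e'.len ^ 3 + (1 + e.len + e'.len) ^ 2 ≤ (1 + e.len + e'.len) ^ 3 := by
    generalize e.len = x
    generalize e'.len = y
    have : (1 + x + y) ^ 3 = (1 + x + y) ^ 2 + (x ^ 3 + y ^ 3 + (x + y + 2 * (x + y) ^ 2
          + 3 * x * y * (x + y))) := by ring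
    omega
  have e3 : (1 + e.len + e'.len) * (L + 1) ≤ (1 + e.len + e'.len) ^ 2 * (L + 1) ^ 2 :=
    Nat.mul_le_mul (by nlinarith) (by nlinarith)
  calc _ ≤ (e.len ^ 3 + e'.len ^ 3 + (1 + e.len + e'.len) ^ 2) * (L + 1) ^ 2 := by nlinarith
    _ ≤ (1 + e.len + e'.len) ^ 3 * (L + 1) ^ 2 := Nat.mul_le_mul_right _ e2
    -- The constant `10 ^ 9` in `unit` is the cube of the size limit `1000` for statements.
    _ ≤ 1000 ^ 3 * (L + 1) ^ 2 := Nat.mul_le_mul_right _ (Nat.pow_le_pow_left hl 3)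
    _ = unit L := by norm_num [unit]

theorem runs_assign {L : ℕ} {s : State} {a : ℕ} {i e : Expr} (hi : i.Bdd L s) (he : e.Bdd L s)
    (hl : 1 + i.len + e.len ≤ 1000) :
    Runs (.assign a i e) s (s.write a (i.eval s) (e.eval s)) (unit L) :=
  ⟨_, Expr.cost_add_le_unit hi he hl, .assign a i e s⟩

theorem State.write_eq (s : State) (a : ℕ) (z x : ℤ) :
    s.write a z x = Function.update s a (Function.update (s a) z x) := by
  funext a' z'
  simp only [State.write, Function.update_apply]
  by_cases h : a' = a
  · subst h; by_cases h2 : z' = z <;> simp [h2]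
  · simp [h]

instance : Add Expr := ⟨.op .add⟩
instance : Sub Expr := ⟨.op .sub⟩
instance : Mul Expr := ⟨.op .mul⟩
instance : Div Expr := ⟨.op .div⟩
instance : Mod Expr := ⟨.op .mod⟩
instance (n : ℕ) : OfNat Expr n := ⟨.const n⟩

/-- The scalar variable in cell `0` of the array `a`. -/
abbrev var (a : ℕ) : Expr := .read a 0

section
variable (s : State) (e e' : Expr)

@[simp] theorem eval_add : (e + e').eval s = e.eval s + e'.eval s := rfl
@[simp] theorem eval_sub : (e - e').eval s = e.eval s - e'.eval s := rfl
@[simp] theorem eval_mul : (e * e').eval s = e.eval s * e'.eval s := rfl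
@[simp] theorem eval_div : (e / e').eval s = e.eval s / e'.eval s := rfl
@[simp] theorem eval_mod : (e % e').eval s = e.eval s % e'.eval s := rfl
@[simp] theorem eval_lt : (Expr.op .lt e e').eval s = if e.eval s < e'.eval s then 1 else 0 := rfl
@[simp] theorem eval_eq : (Expr.op .eq e e').eval s = if e.eval s = e'.eval s then 1 else 0 := rfl
@[simp] theorem eval_zero : (0 : Expr).eval s = 0 := rfl
@[simp] theorem eval_one : (1 : Expr).eval s = 1 := rfl
@[simp] theorem eval_two : (2 : Expr).eval s = 2 := rfl
@[simp] theorem eval_read (a : ℕ) : (Expr.read a e).eval s = s a (e.eval s) := rfl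
end

/-- `for v := 0, …, m - 1 do p`. -/
def forLoop (v : ℕ) (m : Expr) (p : Prog) : Prog :=
  .seq (.assign v 0 0) (.loop (.op .lt (var v) m) (.seq p (.assign v 0 (var v + 1))))

/-- The invariant `I x` refers to the moment just before the test of round `x`, when the counter
already holds `x`; this is why the initial and the inductive condition are stated for memories in
which the counter has just been written. Each round pays one test and one increment beyond the body;
the last two units are the initialization and the failing test. -/
theorem runs_forLoop {L v : ℕ} {m : Expr} {p : Prog} {M : ℕ} (I : ℕ → State → Prop) (κ : ℕ → ℕ)
    {s : State} (hl : m.len ≤ 900) (hM : bits M ≤ L)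
    (hm : ∀ x ≤ M, ∀ s, I x s → m.eval s = M ∧ m.Bdd L s ∧ s v 0 = x)
    (h0 : I 0 (s.write v 0 0))
    (hp : ∀ x < M, ∀ s, I x s → ∃ s', Runs p s s' (κ x) ∧ s' v 0 = x ∧ I (x + 1) (s'.write v 0 (x + 1))) :
    ∃ s', Runs (forLoop v m p) s s' (∑ x ∈ Finset.range M, (κ x + 2 * unit L) + 2 * unit L) ∧ I M s' := by
  have hxL : ∀ x ≤ M, bits (x : ℤ) ≤ L := fun x hx => (bits_mono (by simpa using hx)).trans hM
  have test : ∀ x ≤ M, ∀ s, I x s → (Expr.op .lt (var v) m).cost s + 1 ≤ unit L := by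
    intro x hx s hs
    obtain ⟨h1, h2, h3⟩ := hm x hx s hs
    have := Expr.cost_add_le_unit (L := L) (s := s) (e := (Expr.op .lt (var v) m)) (e' := 0)
      ⟨⟨trivial, by simpa [h3] using hxL x hx⟩, h2⟩ trivial (by
        change 1 + (1 + (1 + 1) + m.len) + 1 ≤ 1000
        omega)
    omega
  -- Induction on the number `k` of rounds that remain.
  have main : ∀ k x, x + k = M → ∀ s, I x s → ∃ s',
      Runs (.loop (.op .lt (var v) m) (.seq p (.assign v 0 (var v + 1)))) s s'
        (∑ y ∈ Finset.Ico x M, (κ y + 2 * unit L) + unit L) ∧ I M s' := by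
    intro k
    induction k with
    | zero =>
      intro x hx s hs
      have hx : x = M := hx
      subst hx
      obtain ⟨h1, h2, h3⟩ := hm x le_rfl s hs
      refine ⟨s, ⟨_, ?_, .loop_false (by simp [h1, h3])⟩, hs⟩
      have := test x le_rfl s hs
      omega
    | succ k ih =>
      intro x hx s hs
      have hxM : x < M := by omega
      obtain ⟨h1, h2, h3⟩ := hm x hxM.le s hs
      obtain ⟨s', hr, hv, hI⟩ := hp x hxM s hs
      obtain ⟨s'', hr', hI'⟩ := ih (x + 1) (by omega) _ hI
      have ha : Runs (.assign v 0 (var v + 1)) s' (s'.write v 0 (x + 1)) (unit L) := by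
        have := runs_assign (L := L) (s := s') (a := v) (i := 0) (e := var v + 1) trivial
          ⟨⟨trivial, by simpa [hv] using hxL x hxM.le⟩, trivial⟩
          (by change 1 + 1 + (1 + (1 + 1) + (1 + 1)) ≤ 1000; omega)
        simpa [hv] using this
      obtain ⟨t1, ht1, hx1⟩ := hr.seq ha
      obtain ⟨t2, ht2, hx2⟩ := hr'
      refine ⟨s'', ⟨_, ?_, .loop_true (by simp [h1, h3, hxM]) hx1 hx2⟩, hI'⟩
      have := test x hxM.le s hs
      rw [Finset.sum_eq_sum_Ico_succ_bot hxM]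
      omega
  obtain ⟨s', hr, hI⟩ := main M 0 (by omega) _ h0
  refine ⟨s', ?_, hI⟩
  have ha : Runs (.assign v 0 0) s (s.write v 0 0) (unit L) :=
    runs_assign (L := L) (s := s) (a := v) (i := 0) (e := 0) trivial trivial
      (by change 1 + 1 + 1 ≤ 1000; omega)
  refine (ha.seq hr).mono ?_
  rw [Finset.range_eq_Ico]
  omega

/-- The expression reads only arrays with numbers below `30`. -/
def Expr.low : Expr → Bool
  | .const _ => true
  | .read a i => decide (a < 30) && i.low
  | .op _ e₁ e₂ => e₁.low && e₂.low

/-- The cells of the arrays with numbers below `30` have at most `L` bits. -/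
def Small (L : ℕ) (s : State) : Prop := ∀ a < 30, ∀ z, bits (s a z) ≤ L

/-- Reduces the cost side conditions of concrete statements to the decidable check `low`, so that
they are settled by computation. -/
theorem Small.bdd {L : ℕ} {s : State} (h : Small L s) : ∀ {e : Expr}, e.low = true → e.Bdd L s
  | .const _, _ => trivial
  | .read a i, he => by
    simp only [Expr.low, Bool.and_eq_true, decide_eq_true_eq] at he
    exact ⟨h.bdd he.2, h a he.1 _⟩
  | .op _ e₁ e₂, he => by
    simp only [Expr.low, Bool.and_eq_true] at he
    exact ⟨h.bdd he.1, h.bdd he.2⟩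

theorem Small.update {L : ℕ} {s : State} (h : Small L s) {a : ℕ} {Y : ℤ → ℤ}
    (hY : ∀ z, bits (Y z) ≤ L) : Small L (Function.update s a Y) := by
  intro a' ha' z
  rw [Function.update_apply]
  split_ifs
  · exact hY z
  · exact h a' ha' z

theorem Small.write {L : ℕ} {s : State} (h : Small L s) {a : ℕ} {z x : ℤ}
    (hx : bits x ≤ L) : Small L (s.write a z x) := by
  intro a' ha' z'
  unfold State.write
  split_ifs
  · exact hx
  · exact h a' ha' z'

@[simp] theorem State.write_self (s : State) (a : ℕ) (z x : ℤ) : s.write a z x a z = x := by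
  simp [State.write]

theorem State.write_ne (s : State) {a a' : ℕ} (h : a' ≠ a) (z x : ℤ) : s.write a z x a' = s a' := by
  funext z'
  simp [State.write, h]

/-- A loop whose body is a single assignment: after `x` rounds the array `a` holds `Y x`. -/
theorem runs_fill {L v a : ℕ} {m i e : Expr} {M : ℕ} (Y : ℕ → ℤ → ℤ) {s : State} (hva : v ≠ a)
    (hl : m.len ≤ 900) (hl' : 1 + i.len + e.len ≤ 1000) (hM : bits M ≤ L) (h0 : Y 0 = s a)
    (hm : ∀ x ≤ M, m.eval (Function.update (s.write v 0 x) a (Y x)) = M ∧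
      m.Bdd L (Function.update (s.write v 0 x) a (Y x)))
    (hp : ∀ x < M, i.Bdd L (Function.update (s.write v 0 x) a (Y x)) ∧
      e.Bdd L (Function.update (s.write v 0 x) a (Y x)) ∧
      Y (x + 1) = Function.update (Y x) (i.eval (Function.update (s.write v 0 x) a (Y x)))
        (e.eval (Function.update (s.write v 0 x) a (Y x)))) :
    Runs (forLoop v m (.assign a i e)) s (Function.update (s.write v 0 M) a (Y M))
      ((3 * M + 2) * unit L) := by
  obtain ⟨s', hr, hs'⟩ := runs_forLoop (L := L) (v := v) (m := m) (p := .assign a i e) (M := M)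
    (fun x s' => s' = Function.update (s.write v 0 x) a (Y x)) (fun _ => unit L) (s := s) hl hM
    (by
      rintro x hx _ rfl
      exact ⟨(hm x hx).1, (hm x hx).2, by rw [Function.update_of_ne hva]; simp⟩)
    (by
      rw [h0]
      funext a' z
      by_cases h : a' = a
      · subst h; simp [State.write, hva.symm]
      · simp [Function.update_of_ne h])
    (by
      rintro x hx _ rfl
      obtain ⟨h1, h2, h3⟩ := hp x hx
      refine ⟨_, runs_assign h1 h2 hl', ?_, ?_⟩
      · rw [State.write_ne _ hva, Function.update_of_ne hva]; simp
      · rw [h3]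
        funext a' z
        by_cases h : a' = a
        · subst h
          simp [State.write, Function.update_apply, hva.symm]
        · by_cases h' : a' = v
          · subst h'
            by_cases hz : z = 0 <;> simp [State.write, hva, hz]
          · simp [State.write, h, h'])
  subst hs'
  refine hr.mono ?_
  rw [Finset.sum_const, Finset.card_range, smul_eq_mul]
  exact le_of_eq (by ring)

theorem runs_fill_low {L v a : ℕ} {m i e : Expr} {M : ℕ} (Y : ℕ → ℤ → ℤ) {s : State} (hva : v ≠ a)
    (hl : m.len ≤ 900 ∧ 1 + i.len + e.len ≤ 1000 ∧ m.low = true ∧ i.low = true ∧ e.low = true)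
    (hM : bits M ≤ L) (hs : Small L s) (h0 : Y 0 = s a)
    (hY : ∀ x ≤ M, ∀ z, bits (Y x z) ≤ L)
    (hm : ∀ x ≤ M, m.eval (Function.update (s.write v 0 x) a (Y x)) = M)
    (hp : ∀ x < M,
      Y (x + 1) = Function.update (Y x) (i.eval (Function.update (s.write v 0 x) a (Y x)))
        (e.eval (Function.update (s.write v 0 x) a (Y x)))) :
    Runs (forLoop v m (.assign a i e)) s (Function.update (s.write v 0 M) a (Y M))
      ((3 * M + 2) * unit L) ∧ Small L (Function.update (s.write v 0 M) a (Y M)) := by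
  have hS : ∀ x ≤ M, Small L (Function.update (s.write v 0 x) a (Y x)) := fun x hx =>
    (hs.write ((bits_mono (by simpa using hx)).trans hM)).update (hY x hx)
  exact ⟨runs_fill Y hva hl.1 hl.2.1 hM h0 (fun x hx => ⟨hm x hx, (hS x hx).bdd hl.2.2.1⟩)
    (fun x hx => ⟨(hS x hx.le).bdd hl.2.2.2.1, (hS x hx.le).bdd hl.2.2.2.2, hp x hx⟩), hS M le_rfl⟩

end RAM

/-! ### Simulating a program in a separate memory that can be erased. -/

namespace RAM

/-- The expression with all array numbers raised by `32`. -/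
def Expr.shift : Expr → Expr
  | .const c => .const c
  | .read a i => .read (a + 32) i.shift
  | .op o e₁ e₂ => .op o e₁.shift e₂.shift

/-- The program with all array numbers raised by `32`, which moreover records the address of every
assignment in array `30`; cell `0` of array `31` counts the records. -/
def Prog.logged : Prog → Prog
  | .assign a i e => .seq (.assign 30 (var 31) i.shift)
      (.seq (.assign 31 0 (var 31 + 1)) (.assign (a + 32) i.shift e.shift))
  | .seq p q => .seq p.logged q.logged
  | .branch e p q => .branch e.shift p.logged q.logged
  | .loop e p => .loop e.shift p.logged

/-- A bound on the array numbers in assignments. -/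
def Prog.top : Prog → ℕ
  | .assign a _ _ => a + 1
  | .seq p q => max p.top q.top
  | .branch _ p q => max p.top q.top
  | .loop _ p => p.top

theorem Exec.eq_of_top_le {p : Prog} {s s' : State} {t : ℕ} (h : Exec p s s' t) {a : ℕ}
    (ha : p.top ≤ a) : s' a = s a := by
  induction h with
  | assign b i e s => exact State.write_ne _ (by simp only [Prog.top] at ha; omega) _ _
  | seq _ _ ih₁ ih₂ =>
    simp only [Prog.top, max_le_iff] at ha
    rw [ih₂ ha.2, ih₁ ha.1]
  | branch_true _ _ ih => simp only [Prog.top, max_le_iff] at ha; exact ih ha.1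
  | branch_false _ _ ih => simp only [Prog.top, max_le_iff] at ha; exact ih ha.2
  | loop_true _ _ _ ih₁ ih₂ => rw [ih₂ ha, ih₁ ha]
  | loop_false _ => rfl

theorem Expr.eval_shift {s S : State} (h : ∀ a, S (a + 32) = s a) (e : Expr) :
    e.shift.eval S = e.eval s := by
  induction e with
  | const c => rfl
  | read a i ih => simp only [Expr.shift, Expr.eval, ih, h]
  | op o e₁ e₂ ih₁ ih₂ => simp only [Expr.shift, Expr.eval, ih₁, ih₂]

theorem Expr.cost_shift {s S : State} (h : ∀ a, S (a + 32) = s a) (e : Expr) :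
    e.shift.cost S = e.cost s := by
  induction e with
  | const c => rfl
  | read a i ih => simp only [Expr.shift, Expr.cost, ih, h, Expr.eval_shift h]
  | op o e₁ e₂ ih₁ ih₂ => simp only [Expr.shift, Expr.cost, ih₁, ih₂, Expr.eval_shift h]

/-- The effect of a logged run, from memory `S` with `c` records to `S'` with `c'` records, that
simulates a run of cost `t` from `s` to `s'`. -/
structure LogRel (s S : State) (c : ℕ) (s' S' : State) (c' t : ℕ) : Prop where
  le : c ≤ c'
  count : S' 31 = Function.update (S 31) 0 (c' : ℤ)
  sim : ∀ a, S' (a + 32) = s' a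
  low : ∀ a < 30, S' a = S a
  keep : ∀ z : ℤ, z < c ∨ c' ≤ z → S' 30 z = S 30 z
  sum : ∑ k ∈ Finset.Ico c c', (bits (S' 30 k) + 1) ≤ t
  record : ∀ a z, s' a z ≠ s a z → ∃ k : ℕ, c ≤ k ∧ k < c' ∧ S' 30 k = z

/-- Each record accounts for at least one unit of the simulated time. -/
theorem LogRel.count_le {s S s' S' : State} {c c' t : ℕ} (h : LogRel s S c s' S' c' t) :
    c' ≤ c + t := by
  have h1 : ∑ k ∈ Finset.Ico c c', 1 ≤ ∑ k ∈ Finset.Ico c c', (bits (S' 30 k) + 1) :=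
    Finset.sum_le_sum fun _ _ => by omega
  have h2 := h.sum
  have h3 := h.le
  simp at h1
  omega

theorem LogRel.mono {s S s' S' : State} {c c' t t' : ℕ} (h : LogRel s S c s' S' c' t)
    (ht : t ≤ t') : LogRel s S c s' S' c' t' :=
  { h with sum := h.sum.trans ht }

theorem LogRel.trans {s S s' S' s'' S'' : State} {c c' c'' t t' : ℕ}
    (h : LogRel s S c s' S' c' t) (h' : LogRel s' S' c' s'' S'' c'' t') :
    LogRel s S c s'' S'' c'' (t + t') where
  le := h.le.trans h'.le
  count := by rw [h'.count, h.count, Function.update_idem]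
  sim := h'.sim
  low a ha := by rw [h'.low a ha, h.low a ha]
  keep z hz := by
    have h1 := h.le
    have h2 := h'.le
    rw [h'.keep z (by omega), h.keep z (by omega)]
  sum := by
    rw [← Finset.sum_Ico_consecutive _ h.le h'.le]
    refine add_le_add (le_trans (le_of_eq ?_) h.sum) h'.sum
    refine Finset.sum_congr rfl fun k hk => ?_
    rw [h'.keep k (Or.inl (by exact_mod_cast (Finset.mem_Ico.1 hk).2))]
  record a z hz := by
    have h1 := h.le
    have h2 := h'.le
    by_cases hs : s'' a z = s' a z
    · obtain ⟨k, hk, hk', hz⟩ := h.record a z (by rwa [← hs])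
      exact ⟨k, hk, by omega, by rw [h'.keep k (Or.inl (by exact_mod_cast hk')), hz]⟩
    · obtain ⟨k, hk, hk', hz⟩ := h'.record a z hs
      exact ⟨k, by omega, hk', hz⟩

/-- Recording replaces an assignment by three. The two additional ones handle the counter, which by
`c + t < 2 ^ B` never exceeds `B` bits, and the address, whose evaluation is paid for by the
original assignment. As every step costs at least `1`, the overhead is a factor quadratic in `B`.
The field `sum` of `LogRel` holds because an assignment is charged for the bit length of its
address. -/
theorem exec_logged {p : Prog} {s s' : State} {t : ℕ} (h : Exec p s s' t) :
    ∀ (S : State) (c B : ℕ), (∀ a, S (a + 32) = s a) → S 31 0 = c → c + t < 2 ^ B →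
      ∃ S' c', Runs p.logged S S' (t * (10 * (B + 2) ^ 2)) ∧ LogRel s S c s' S' c' t := by
  induction h with
  | assign a i e s =>
    intro S c B hS hc hB
    have hb : bits (c : ℤ) ≤ B := bits_le_iff.2 (by
      rw [abs_of_nonneg (by positivity)]; exact_mod_cast (by omega))
    have hb' : bits ((c : ℤ) + 1) ≤ B := bits_le_iff.2 (by
      rw [abs_of_nonneg (by positivity)]; exact_mod_cast (by omega))
    set S₁ := S.write 30 c (i.eval s) with hS₁
    set S₂ := S₁.write 31 0 (c + 1) with hS₂
    have h₁ : ∀ a, S₁ (a + 32) = s a := fun a => by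
      rw [hS₁, State.write_ne _ (by omega), hS]
    have h₂ : ∀ a, S₂ (a + 32) = s a := fun a => by
      rw [hS₂, State.write_ne _ (by omega), h₁]
    have hc₁ : S₁ 31 0 = c := by rw [hS₁, State.write_ne _ (by omega), hc]
    have x₁ := Exec.assign 30 (var 31) i.shift S
    rw [Expr.eval_shift hS, show (var 31).eval S = c from hc] at x₁
    have x₂ := Exec.assign 31 0 (var 31 + 1) S₁
    rw [show (var 31 + 1).eval S₁ = c + 1 by simp [hc₁], show (0 : Expr).eval S₁ = 0 from rfl] at x₂
    have x₃ := Exec.assign (a + 32) i.shift e.shift S₂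
    rw [Expr.eval_shift h₂, Expr.eval_shift h₂] at x₃
    refine ⟨S₂.write (a + 32) (i.eval s) (e.eval s), c + 1, ⟨_, ?_, x₁.seq (x₂.seq x₃)⟩, ?_⟩
    · have e1 : Expr.cost S (var 31) = 2 + bits (c : ℤ) := by
        change 1 + bits 0 + 1 + bits 0 + bits (S 31 0) = _
        rw [hc]; simp
      have e2 : Expr.cost S₁ (var 31 + 1) = 2 + bits (c : ℤ) + 2 + (1 + bits (c : ℤ) + 1) ^ 2 := by
        change (1 + bits 0 + 1 + bits 0 + bits (S₁ 31 0)) + (1 + bits 1)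
          + (1 + bits (S₁ 31 0) + bits 1) ^ 2 = _
        rw [hc₁, show bits 1 = 1 from by simp [bits]]; simp
      have e5 : Expr.cost S₁ 0 = 1 := by change 1 + bits 0 = 1; simp
      rw [Expr.cost_shift hS, Expr.cost_shift h₂, Expr.cost_shift h₂, e1, e2, e5, bits_zero]
      generalize bits (c : ℤ) = x at *
      generalize bits ((c : ℤ) + 1) = y at *
      generalize i.cost s = u at *
      generalize e.cost s = v at *
      generalize bits (i.eval s) = u' at *
      generalize bits (e.eval s) = v' at *
      have h5 : (1 + x + 1) ^ 2 ≤ (B + 2) ^ 2 := Nat.pow_le_pow_left (by omega) 2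
      have h6 : (u + v + 1 + u' + v') * 4 ≤ (u + v + 1 + u' + v') * (B + 2) ^ 2 :=
        Nat.mul_le_mul_left _ (by nlinarith)
      have h7 : 1 * (B + 2) ^ 2 ≤ (u + v + 1 + u' + v') * (B + 2) ^ 2 :=
        Nat.mul_le_mul_right _ (by omega)
      nlinarith
    · refine ⟨by omega, ?_, ?_, ?_, ?_, ?_, ?_⟩
      · rw [State.write_ne _ (by omega), hS₂, State.write_eq, Function.update_self, hS₁,
          State.write_ne _ (by omega)]
        push_cast; rfl
      · intro a'
        by_cases h : a' = a
        · subst h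
          rw [State.write_eq, State.write_eq, Function.update_self, Function.update_self, h₂]
        · rw [State.write_ne _ (by omega), State.write_ne _ h, h₂]
      · intro a' ha'
        rw [State.write_ne _ (by omega), hS₂, State.write_ne _ (by omega), hS₁,
          State.write_ne _ (by omega)]
      · intro z hz
        push_cast at hz
        rw [State.write_ne _ (by omega), hS₂, State.write_ne _ (by omega), hS₁, State.write_eq,
          Function.update_self, Function.update_of_ne (by omega)]
      · rw [State.write_ne _ (by omega), hS₂, State.write_ne _ (by omega), hS₁]
        simp
        omega
      · intro a' z hz
        refine ⟨c, le_rfl, by omega, ?_⟩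
        rw [State.write_ne _ (by omega), hS₂, State.write_ne _ (by omega), hS₁, State.write_self]
        by_contra hne
        refine hz ?_
        simp only [State.write]
        rw [if_neg fun h => hne h.2.symm]
  | seq _ _ ih₁ ih₂ =>
    intro S c B hS hc hB
    obtain ⟨S', c', r, h⟩ := ih₁ S c B hS hc (by omega)
    have := h.count_le
    obtain ⟨S'', c'', r', h'⟩ := ih₂ S' c' B h.sim (by rw [h.count]; simp) (by omega)
    exact ⟨S'', c'', (r.seq r').mono (by rw [add_mul]), h.trans h'⟩
  | @branch_true e p q s s' t he _ ih =>
    intro S c B hS hc hB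
    obtain ⟨S', c', ⟨t', ht', hx⟩, h⟩ := ih S c B hS hc (by omega)
    refine ⟨S', c', ⟨_, ?_, .branch_true (by rwa [Expr.eval_shift hS]) hx⟩, h.mono (by omega)⟩
    rw [Expr.cost_shift hS, add_mul]
    exact add_le_add (Nat.le_mul_of_pos_right _ (by positivity)) ht'
  | @branch_false e p q s s' t he _ ih =>
    intro S c B hS hc hB
    obtain ⟨S', c', ⟨t', ht', hx⟩, h⟩ := ih S c B hS hc (by omega)
    refine ⟨S', c', ⟨_, ?_, .branch_false (by rwa [Expr.eval_shift hS]) hx⟩, h.mono (by omega)⟩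
    rw [Expr.cost_shift hS, add_mul]
    exact add_le_add (Nat.le_mul_of_pos_right _ (by positivity)) ht'
  | @loop_true e p s₁ s₂ s₃ t₁ t₂ he _ _ ih₁ ih₂ =>
    intro S c B hS hc hB
    obtain ⟨S', c', ⟨t', ht', hx⟩, h⟩ := ih₁ S c B hS hc (by omega)
    have := h.count_le
    obtain ⟨S'', c'', ⟨t'', ht'', hx'⟩, h'⟩ := ih₂ S' c' B h.sim (by rw [h.count]; simp) (by omega)
    refine ⟨S'', c'', ⟨_, ?_, .loop_true (by rwa [Expr.eval_shift hS]) hx hx'⟩,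
      (h.trans h').mono (by omega)⟩
    rw [Expr.cost_shift hS, add_mul, add_mul]
    exact add_le_add (add_le_add (Nat.le_mul_of_pos_right _ (by positivity)) ht') ht''
  | @loop_false e p s he =>
    intro S c B hS hc hB
    refine ⟨S, c, ⟨_, ?_, .loop_false (by rwa [Expr.eval_shift hS])⟩, ?_⟩
    · rw [Expr.cost_shift hS]
      exact Nat.le_mul_of_pos_right _ (by positivity)
    · exact ⟨le_rfl, by rw [← hc]; simp, hS, fun _ _ => rfl, fun _ _ => rfl, by simp,
        fun a z h => (h rfl).elim⟩

/-- Erase, in the arrays `32, …, 31 + m`, the cell recorded in cell `x` of array `30`, and this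
record; `x` is the variable `4`. -/
def wipe : ℕ → Prog
  | 0 => .assign 30 (var 4) 0
  | m + 1 => .seq (.assign (m + 32) (.read 30 (var 4)) 0) (wipe m)

/-- The recorded address `l` is not assumed to have at most `L` bits, since the simulated program
may use long addresses. Its length appears in the cost separately and is later charged to the
running time of that program. -/
theorem runs_wipe {L k : ℕ} {l : ℤ} (hk : bits (k : ℤ) ≤ L) (m : ℕ) :
    ∀ s : State, s 4 0 = k → s 30 k = l → ∃ s', Runs (wipe m) s s' ((m + 1) * (unit L + 2 * bits l)) ∧
      (∀ a < m, s' (a + 32) = Function.update (s (a + 32)) l 0) ∧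
      (∀ a ≥ m, s' (a + 32) = s (a + 32)) ∧ s' 30 = Function.update (s 30) k 0 ∧
      s' 31 = s 31 ∧ ∀ a < 30, s' a = s a := by
  have hU : 5 + 2 * L ≤ unit L := by unfold unit; nlinarith
  induction m with
  | zero =>
    intro s h4 h30
    refine ⟨_, ⟨_, ?_, .assign 30 (var 4) 0 s⟩, by simp, ?_, ?_, ?_, ?_⟩
    · change (1 + bits 0 + 1 + bits 0 + bits (s 4 0)) + (1 + bits 0) + 1 + bits (s 4 0) + bits 0 ≤ _
      rw [h4, bits_zero]
      omega
    · intro a _; exact State.write_ne _ (by omega) _ _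
    · rw [State.write_eq, Function.update_self]; simp [h4]
    · exact State.write_ne _ (by omega) _ _
    · intro a _; exact State.write_ne _ (by omega) _ _
  | succ m ih =>
    intro s h4 h30
    have e : (Expr.read 30 (var 4)).eval s = l := by simp [h4, h30]
    have r : Runs (.assign (m + 32) (.read 30 (var 4)) 0) s (s.write (m + 32) l 0)
        (unit L + 2 * bits l) := by
      have h : Exec _ _ _ _ := .assign (m + 32) (.read 30 (var 4)) 0 s
      rw [e] at h
      refine ⟨_, ?_, h⟩
      change ((1 + bits 0 + 1 + bits 0 + bits (s 4 0)) + 1 + bits (s 4 0) + bits (s 30 (s 4 0)))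
        + (1 + bits 0) + 1 + bits l + bits 0 ≤ _
      rw [h4, h30, bits_zero]
      omega
    obtain ⟨s', r', h1, h2, h3, h5, h6⟩ := ih (s.write (m + 32) l 0)
      (by rw [State.write_ne _ (by omega), h4]) (by rw [State.write_ne _ (by omega), h30])
    refine ⟨s', (r.seq r').mono (le_of_eq (by ring)), ?_, ?_, ?_, ?_, ?_⟩
    · intro a ha
      rcases Nat.lt_succ_iff_lt_or_eq.1 ha with h | rfl
      · rw [h1 a h, State.write_ne _ (by omega)]
      · rw [h2 a le_rfl, State.write_eq, Function.update_self]
    · intro a ha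
      rw [h2 a (by omega), State.write_ne _ (by omega)]
    · rw [h3, State.write_ne _ (by omega)]
    · rw [h5, State.write_ne _ (by omega)]
    · intro a ha
      rw [h6 a ha, State.write_ne _ (by omega)]

end RAM

/-! ### Tabulation loops and the call of the matrix multiplication program. -/

namespace RAM

/-- The array `f` with the cells `0, …, x - 1` overwritten by the values of `G`. -/
def fillArr (f : ℤ → ℤ) (G : ℕ → ℤ) (x : ℕ) (z : ℤ) : ℤ :=
  if 0 ≤ z ∧ z < x then G z.toNat else f z

theorem fillArr_natCast (f : ℤ → ℤ) (G : ℕ → ℤ) (x y : ℕ) :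
    fillArr f G x y = if y < x then G y else f y := by
  simp [fillArr]

theorem fillArr_zero (f : ℤ → ℤ) (G : ℕ → ℤ) : fillArr f G 0 = f := by
  funext z
  simp only [fillArr]
  rw [if_neg (by push_cast; omega)]

theorem fillArr_succ (f : ℤ → ℤ) (G : ℕ → ℤ) (x : ℕ) :
    fillArr f G (x + 1) = Function.update (fillArr f G x) x (G x) := by
  funext z
  simp only [fillArr, Function.update_apply]
  push_cast
  by_cases h : z = x
  · subst h
    rw [if_pos (by omega), if_pos rfl]; simp
  · rw [if_neg h]
    by_cases h' : 0 ≤ z ∧ z < x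
    · rw [if_pos h', if_pos (by omega)]
    · rw [if_neg h', if_neg (by omega)]

/-- A loop computing the cells `0, …, M - 1` of the array `a` one after the other. -/
theorem runs_table {L v a : ℕ} {m e : Expr} {M : ℕ} (G : ℕ → ℤ) {s : State} (hva : v ≠ a)
    (hl : m.len ≤ 900 ∧ 3 + e.len ≤ 1000) (hM : bits M ≤ L) (hs : Small L s)
    (hG : a < 30 → ∀ x < M, bits (G x) ≤ L)
    (hm : ∀ σ : State, Small L σ → (∀ b, b ≠ a → b ≠ v → σ b = s b) → m.Bdd L σ ∧ m.eval σ = M)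
    (hp : ∀ x < M, ∀ σ : State, Small L σ → σ v 0 = x → σ a = fillArr (s a) G x →
      (∀ b, b ≠ a → b ≠ v → σ b = s b) → e.Bdd L σ ∧ e.eval σ = G x) :
    ∃ s', Runs (forLoop v m (.assign a (var v) e)) s s' ((3 * M + 2) * unit L) ∧ Small L s' ∧
      s' a = fillArr (s a) G M ∧ ∀ b, b ≠ a → b ≠ v → s' b = s b := by
  set S : ℕ → State := fun x => Function.update (s.write v 0 x) a (fillArr (s a) G x) with hS
  have hSv : ∀ x, S x v 0 = x := fun x => by
    simp only [hS]; rw [Function.update_of_ne hva, State.write_self]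
  have hSa : ∀ x, S x a = fillArr (s a) G x := fun x => by simp only [hS, Function.update_self]
  have hSb : ∀ x b, b ≠ a → b ≠ v → S x b = s b := fun x b hb hb' => by
    simp only [hS]; rw [Function.update_of_ne hb, State.write_ne _ hb']
  have hx : ∀ x ≤ M, bits (x : ℤ) ≤ L := fun x hx => (bits_mono (by simpa using hx)).trans hM
  have hSm : ∀ x ≤ M, Small L (S x) := by
    intro x hxM b hb z
    by_cases hba : b = a
    · subst hba
      rw [hSa]
      unfold fillArr
      split_ifs with h
      · exact hG hb _ (by omega)
      · exact hs b hb z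
    · by_cases hbv : b = v
      · subst hbv
        simp only [hS]
        rw [Function.update_of_ne hba]
        exact hs.write (hx x hxM) b hb z
      · rw [hSb x b hba hbv]; exact hs b hb z
  refine ⟨S M, ?_, hSm M le_rfl, hSa M, hSb M⟩
  refine runs_fill (fillArr (s a) G) hva hl.1 (by change 1 + (1 + (1 + 0)) + e.len ≤ 1000; omega) hM
    (fillArr_zero _ _) (fun x hx => (hm (S x) (hSm x hx) (hSb x)).symm) ?_
  intro x hxM
  obtain ⟨h1, h2⟩ := hp x hxM (S x) (hSm x hxM.le) (hSv x) (hSa x) (hSb x)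
  refine ⟨⟨trivial, ?_⟩, h1, ?_⟩
  · rw [eval_zero]; change bits (S x v 0) ≤ L; rw [hSv]; exact hx x hxM.le
  · rw [show (var v).eval (Function.update (s.write v 0 x) a (fillArr (s a) G x)) = x from hSv x,
      show e.eval (Function.update (s.write v 0 x) a (fillArr (s a) G x)) = G x from h2,
      fillArr_succ]

theorem ten_mul_le_unit (L : ℕ) : 10 * (L + 2) ^ 2 ≤ unit L := by
  have h : (L + 2) ^ 2 ≤ (2 * (L + 1)) ^ 2 := Nat.pow_le_pow_left (by omega) 2
  unfold unit
  rw [mul_pow] at h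
  omega

theorem le_unit (L : ℕ) : L ≤ unit L :=
  le_trans (by nlinarith) (ten_mul_le_unit L)

theorem one_le_unit (L : ℕ) : 1 ≤ unit L :=
  le_trans (Nat.succ_le_of_lt (by positivity)) (ten_mul_le_unit L)

/-- Multiply the matrices in arrays `16` and `17`, whose size is the variable `7`, by the program
`P`, store the product in array `18`, and clear the memory of `P`. -/
def callMatMul (P : Prog) : Prog :=
  .seq (.assign 32 0 (var 7)) <|
  .seq (forLoop 4 (var 7 * var 7) (.assign 33 (var 4) (.read 16 (var 4)))) <|
  .seq (forLoop 4 (var 7 * var 7) (.assign 34 (var 4) (.read 17 (var 4)))) <|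
  .seq (forLoop 4 (var 7 * var 7) (.assign 30 (var 4) (var 4))) <|
  .seq (.assign 31 0 (var 7 * var 7)) <|
  .seq P.logged <|
  .seq (forLoop 4 (var 7 * var 7) (.assign 18 (var 4) (.read 35 (var 4)))) <|
  .seq (forLoop 4 (var 31) (wipe (P.top + 4))) (.assign 31 0 0)

theorem layout_apply {N : ℕ} (M : Matrix (Fin N) (Fin N) ℤ) (i j : Fin N) :
    MatMul.layout M ((N : ℤ) * i + j) = M i j := by
  have h : 0 ≤ (N : ℤ) * i + j ∧ ((N : ℤ) * i + j).toNat < N * N := by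
    have : ((N : ℤ) * i + j).toNat = N * i + j := by
      rw [show (N : ℤ) * i + j = ((N * i + j : ℕ) : ℤ) by push_cast; rfl]; rfl
    refine ⟨by positivity, ?_⟩
    rw [this]
    calc N * i + j < N * i + N := by have := j.2; omega
      _ = N * (i + 1) := by ring
      _ ≤ N * N := Nat.mul_le_mul_left _ i.2
  rw [MatMul.layout, dif_pos h]
  have : (⟨((N : ℤ) * i + j).toNat, h.2⟩ : Fin (N * N)) = finProdFinEquiv (i, j) := by
    apply Fin.ext
    simp only [finProdFinEquiv_apply_val]
    rw [show (N : ℤ) * i + j = ((N * i + j : ℕ) : ℤ) by push_cast; rfl, Int.toNat_natCast, add_comm]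
  rw [this]
  simp

theorem layout_outside {N : ℕ} (M : Matrix (Fin N) (Fin N) ℤ) {z : ℤ}
    (hz : ¬(0 ≤ z ∧ z < (N * N : ℕ))) : MatMul.layout M z = 0 := by
  rw [MatMul.layout, dif_neg (by omega)]

theorem exists_index {N x : ℕ} (hx : x < N * N) : ∃ i j : Fin N, (x : ℤ) = (N : ℤ) * i + j := by
  have hN : 0 < N := Nat.pos_of_ne_zero (by rintro rfl; simp at hx)
  refine ⟨⟨x / N, Nat.div_lt_of_lt_mul hx⟩, ⟨x % N, Nat.mod_lt _ hN⟩, ?_⟩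
  exact_mod_cast (Nat.div_add_mod x N).symm

theorem fillArr_layout {N : ℕ} (M : Matrix (Fin N) (Fin N) ℤ) :
    fillArr (fun _ => 0) (fun x => MatMul.layout M x) (N * N) = MatMul.layout M := by
  funext z
  unfold fillArr
  split_ifs with h
  · change MatMul.layout M (z.toNat : ℕ) = _
    rw [Int.toNat_of_nonneg h.1]
  · rw [layout_outside M h]

/-- The erasing loop clears the memory above array `30` if all nonzero cells are recorded. -/
theorem runs_erase {L m c : ℕ} {s : State} (hs : Small L s) (hc : s 31 0 = c) (hcL : bits (c : ℤ) ≤ L)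
    (hrec : ∀ a z, s (a + 32) z ≠ 0 → a < m ∧ ∃ k < c, s 30 (k : ℕ) = z)
    (h30 : ∀ z : ℤ, z < 0 ∨ c ≤ z → s 30 z = 0) :
    ∃ s', Runs (forLoop 4 (var 31) (wipe m)) s s'
        (∑ k ∈ Finset.range c, ((m + 1) * (unit L + 2 * bits (s 30 k)) + 2 * unit L) + 2 * unit L) ∧
      Small L s' ∧ (∀ a, s' (a + 32) = fun _ => 0) ∧ (s' 30 = fun _ => 0) ∧ s' 31 = s 31 ∧
      ∀ a < 30, a ≠ 4 → s' a = s a := by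
  have hx : ∀ x ≤ c, bits (x : ℤ) ≤ L := fun x hx => (bits_mono (by simpa using hx)).trans hcL
  obtain ⟨s', hr, h1, h2, h3, h4, h5, h6⟩ := runs_forLoop (L := L) (v := 4) (m := var 31)
    (p := wipe m) (M := c)
    (fun k σ => Small L σ ∧ σ 4 0 = k ∧ (∀ a z, σ (a + 32) z ≠ 0 → a < m ∧ ∃ j, k ≤ j ∧ j < c ∧ s 30 (j : ℕ) = z) ∧
      (∀ z : ℤ, z < k → σ 30 z = 0) ∧ (∀ z : ℤ, k ≤ z → σ 30 z = s 30 z) ∧ σ 31 = s 31 ∧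
      ∀ a < 30, a ≠ 4 → σ a = s a)
    (fun k => (m + 1) * (unit L + 2 * bits (s 30 k))) (s := s)
    (by change 1 + (1 + 0) ≤ 900; omega) hcL
    (by
      rintro x hxc σ ⟨h1, h2, h3, h4, h5, h6, h7⟩
      refine ⟨by simp [h6, hc], ⟨trivial, ?_⟩, h2⟩
      rw [eval_zero, h6, hc]; exact hcL)
    (by
      refine ⟨hs.write (by simp), by simp, ?_, ?_, ?_, ?_, ?_⟩
      · intro a z h
        rw [State.write_ne _ (by omega)] at h
        obtain ⟨h1, k, h2, h3⟩ := hrec a z h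
        exact ⟨h1, k, by omega, h2, h3⟩
      · intro z hz
        rw [State.write_ne _ (by omega)]; exact h30 z (by omega)
      · intro z hz; rw [State.write_ne _ (by omega)]
      · rw [State.write_ne _ (by omega)]
      · intro a ha ha'; rw [State.write_ne _ ha'])
    (by
      rintro x hxc σ ⟨h1, h2, h3, h4, h5, h6, h7⟩
      obtain ⟨σ', r, k1, k2, k3, k4, k5⟩ := runs_wipe (L := L) (k := x) (l := s 30 x) (hx x hxc.le)
        m σ h2 (h5 x le_rfl)
      refine ⟨σ', r, by rw [k5 4 (by omega), h2], ?_, ?_, ?_, ?_, ?_, ?_, ?_⟩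
      · refine Small.write (fun a ha z => ?_) (by exact_mod_cast hx (x + 1) hxc)
        rw [k5 a ha]; exact h1 a ha z
      · simp
      · intro a z h
        rw [State.write_ne _ (by omega)] at h
        by_cases ha : a < m
        · rw [k1 a ha, Function.update_apply] at h
          split_ifs at h with hz
          · exact (h rfl).elim
          obtain ⟨q1, j, q2, q3, q4⟩ := h3 a z h
          refine ⟨ha, j, ?_, q3, q4⟩
          rcases q2.eq_or_lt with rfl | q
          · exact (hz q4.symm).elim
          · exact q
        · rw [k2 a (by omega)] at h
          exact (ha (h3 a z h).1).elim
      · intro z hz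
        push_cast at hz
        rw [State.write_ne _ (by omega), k3, Function.update_apply]
        split_ifs with h
        · rfl
        · exact h4 z (by omega)
      · intro z hz
        push_cast at hz
        rw [State.write_ne _ (by omega), k3, Function.update_of_ne (by omega)]
        exact h5 z (by omega)
      · rw [State.write_ne _ (by omega), k4, h6]
      · intro a ha ha'
        rw [State.write_ne _ ha', k5 a ha, h7 a ha ha'])
  refine ⟨s', hr, h1, ?_, ?_, h6.1, h6.2⟩
  · intro a
    funext z
    by_contra h
    obtain ⟨_, j, hj, hj', _⟩ := h3 a z h
    omega
  · funext z
    rcases lt_or_ge z c with h | h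
    · exact h4 z h
    · rw [h5 z h]; exact h30 z (Or.inr h)

/-- Apart from the loop counter and the array of the product, the memory is exactly restored; in
particular everything from array `30` on is zero again, which is the hypothesis `hz` for the next
call. The hypothesis `hL` bounds the number of records, `N * N` initial ones and at most `t` from
the run. -/
theorem runs_callMatMul {P : Prog} {L N t : ℕ} {M M' : Matrix (Fin N) (Fin N) ℤ} {s σ : State}
    (hs : Small L s) (hN : s 7 0 = N) (hN0 : 0 < N) (hz : ∀ a ≥ 30, s a = fun _ => 0)
    (h16 : ∀ x < N * N, s 16 (x : ℕ) = MatMul.layout M x)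
    (h17 : ∀ x < N * N, s 17 (x : ℕ) = MatMul.layout M' x)
    (hP : Exec P (MatMul.input M M') σ t)
    (hσ : ∀ i j : Fin N, σ 3 ((N : ℤ) * i + j) = (M * M') i j)
    (hb : ∀ i j, bits ((M * M') i j) ≤ L) (hL : N * N + t < 2 ^ L) :
    ∃ s', Runs (callMatMul P) s s' (100 * (P.top + 5) * (N * N + t) * unit L) ∧ Small L s' ∧
      s' 18 = fillArr (s 18) (fun x => MatMul.layout (M * M') x) (N * N) ∧
      ∀ a, a ≠ 4 → a ≠ 18 → s' a = s a := by
  have hNN : bits ((N * N : ℕ) : ℤ) ≤ L := bits_le_iff.2 (by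
      rw [abs_of_nonneg (by positivity)]; exact_mod_cast (by omega))
  have h1N : 1 ≤ N * N := Nat.one_le_iff_ne_zero.2 (by positivity)
  have r0 : Runs (.assign 32 0 (var 7)) s (s.write 32 0 N) (unit L) := by
    have := runs_assign (L := L) (s := s) (a := 32) (i := 0) (e := var 7) trivial
      (hs.bdd rfl) (by decide)
    simpa [hN] using this
  set s₀ := s.write 32 0 N with hs₀
  have q0 : Small L s₀ := by
    intro a ha z
    rw [hs₀, State.write_ne _ (by omega)]; exact hs a ha z
  have e0 : ∀ b, b ≠ 32 → s₀ b = s b := fun b hb => State.write_ne _ hb _ _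
  have len0 : (var 7 * var 7).len ≤ 900 ∧ 3 + (Expr.read 16 (var 4)).len ≤ 1000 := by decide
  obtain ⟨s₁, r1, q1, f1, e1⟩ := runs_table (L := L) (v := 4) (a := 33) (m := var 7 * var 7)
    (e := .read 16 (var 4)) (M := N * N) (fun x => MatMul.layout M x) (s := s₀) (by decide)
    len0 hNN q0 (by omega)
    (fun τ hτ h => ⟨hτ.bdd rfl, by simp [h 7 (by decide) (by decide), e0, hN]⟩)
    (fun x hx τ hτ h1 h2 h3 => ⟨hτ.bdd rfl, by
      simp only [eval_read, eval_zero, h1]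
      rw [h3 16 (by decide) (by decide), e0 16 (by decide), h16 x hx]⟩)
  obtain ⟨s₂, r2, q2, f2, e2⟩ := runs_table (L := L) (v := 4) (a := 34) (m := var 7 * var 7)
    (e := .read 17 (var 4)) (M := N * N) (fun x => MatMul.layout M' x) (s := s₁) (by decide)
    len0 hNN q1 (by omega)
    (fun τ hτ h => ⟨hτ.bdd rfl, by simp [h 7 (by decide) (by decide), e1, e0, hN]⟩)
    (fun x hx τ hτ h1 h2 h3 => ⟨hτ.bdd rfl, by
      simp only [eval_read, eval_zero, h1]
      rw [h3 17 (by decide) (by decide), e1 17 (by decide) (by decide), e0 17 (by decide), h17 x hx]⟩)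
  -- The addresses `0, …, N * N - 1` are recorded in advance: they cover all input cells, which the
  -- run itself need not write to.
  obtain ⟨s₃, r3, q3, f3, e3⟩ := runs_table (L := L) (v := 4) (a := 30) (m := var 7 * var 7)
    (e := var 4) (M := N * N) (fun x => (x : ℤ)) (s := s₂) (by decide)
    ⟨by decide, by decide⟩ hNN q2 (by omega)
    (fun τ hτ h => ⟨hτ.bdd rfl, by simp [h 7 (by decide) (by decide), e2, e1, e0, hN]⟩)
    (fun x hx τ hτ h1 h2 h3 => ⟨hτ.bdd rfl, by simp [h1]⟩)
  have r4 : Runs (.assign 31 0 (var 7 * var 7)) s₃ (s₃.write 31 0 ((N * N : ℕ) : ℤ)) (unit L) := by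
    have := runs_assign (L := L) (s := s₃) (a := 31) (i := 0) (e := var 7 * var 7) trivial
      (q3.bdd rfl) (by decide)
    simpa [hN, e3, e2, e1, e0] using this
  set s₄ := s₃.write 31 0 ((N * N : ℕ) : ℤ) with hs₄
  have e4 : ∀ b, b ≠ 31 → s₄ b = s₃ b := fun b hb => State.write_ne _ hb _ _
  have in4 : ∀ a, s₄ (a + 32) = MatMul.input M M' a := by
    intro a
    rw [e4 _ (by omega), e3 _ (by omega) (by omega)]
    match a with
    | 0 =>
      rw [e2 _ (by omega) (by omega), e1 _ (by omega) (by omega), hs₀, State.write_eq,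
        Function.update_self, hz _ (by omega)]
      funext z
      simp [MatMul.input, Function.update_apply]
    | 1 =>
      rw [e2 _ (by omega) (by omega), f1, e0 _ (by omega), hz _ (by omega), fillArr_layout]; rfl
    | 2 =>
      rw [f2, e1 _ (by omega) (by omega), e0 _ (by omega), hz _ (by omega), fillArr_layout]; rfl
    | a + 3 =>
      rw [e2 _ (by omega) (by omega), e1 _ (by omega) (by omega), e0 _ (by omega), hz _ (by omega)]
      rfl
  have h430 : s₄ 30 = fillArr (fun _ => 0) (fun x => (x : ℤ)) (N * N) := by
    rw [e4 _ (by decide), f3, e2 _ (by decide) (by decide), e1 _ (by decide) (by decide),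
      e0 _ (by decide), hz _ (by omega)]
  obtain ⟨s₅, c, r5, lr⟩ := exec_logged hP s₄ (N * N) L in4 (by rw [hs₄, State.write_self]) hL
  have hc := lr.count_le
  have hcL : bits (c : ℤ) ≤ L := bits_le_iff.2 (by
      rw [abs_of_nonneg (by positivity)]; exact_mod_cast (by omega))
  have e5 : ∀ b < 30, b ≠ 4 → s₅ b = s b := fun b hb hb' => by
    rw [lr.low b hb, e4 _ (by omega), e3 _ (by omega) hb', e2 _ (by omega) hb',
      e1 _ (by omega) hb', e0 _ (by omega)]
  have q5 : Small L s₅ := fun a ha z => by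
    rw [lr.low a ha, e4 _ (by omega)]; exact q3 a ha z
  have h35 : ∀ x < N * N, s₅ 35 (x : ℕ) = MatMul.layout (M * M') x := by
    intro x hx
    obtain ⟨i, j, hij⟩ := exists_index hx
    rw [lr.sim 3, hij, hσ, layout_apply]
  have hbl : ∀ x < N * N, bits (MatMul.layout (M * M') x) ≤ L := by
    intro x hx
    obtain ⟨i, j, hij⟩ := exists_index hx
    rw [hij, layout_apply]; exact hb i j
  obtain ⟨s₆, r6, q6, f6, e6⟩ := runs_table (L := L) (v := 4) (a := 18) (m := var 7 * var 7)
    (e := .read 35 (var 4)) (M := N * N) (fun x => MatMul.layout (M * M') x) (s := s₅) (by decide)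
    ⟨by decide, by decide⟩ hNN q5 (fun _ => hbl)
    (fun τ hτ h => ⟨hτ.bdd rfl, by simp [h 7 (by decide) (by decide), e5, hN]⟩)
    (fun x hx τ hτ h1 h2 h3 => by
      have : τ 35 (x : ℕ) = MatMul.layout (M * M') x := by
        rw [h3 35 (by decide) (by decide), h35 x hx]
      refine ⟨⟨⟨trivial, ?_⟩, ?_⟩, ?_⟩
      · rw [eval_zero]; exact hτ 4 (by omega) 0
      · simp only [eval_read, eval_zero, h1, this]; exact hbl x hx
      · simp only [eval_read, eval_zero, h1, this])
  have h631 : s₆ 31 = s₅ 31 := e6 _ (by decide) (by decide)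
  have h630 : s₆ 30 = s₅ 30 := e6 _ (by decide) (by decide)
  -- Erasing `P.top + 4` arrays covers the arrays written by `P` as well as the three input arrays.
  obtain ⟨s₇, r7, q7, h7, h730, h731, e7⟩ := runs_erase (L := L) (m := P.top + 4) (c := c) q6
    (by rw [h631, lr.count]; simp) hcL
    (by
      intro a z h
      rw [e6 _ (by omega) (by omega), lr.sim] at h
      -- A nonzero cell after the run either still holds its input value, and then its address is
      -- among the first `N * N` records, or it was changed by the run, and then the run recorded
      -- it.
      by_cases hin : σ a z = MatMul.input M M' a z
      · have hne := h
        rw [hin] at hne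
        have hza : a < 3 ∧ 0 ≤ z ∧ z < (N * N : ℕ) := by
          match a with
          | 0 =>
            simp only [MatMul.input] at hne
            have : z = 0 := by by_contra h; simp [h] at hne
            subst this
            exact ⟨by omega, by omega, by exact_mod_cast h1N⟩
          | 1 => exact ⟨by omega, by by_contra h; exact hne (layout_outside M h)⟩
          | 2 => exact ⟨by omega, by by_contra h; exact hne (layout_outside M' h)⟩
          | a + 3 => exact (hne rfl).elim
        refine ⟨by omega, z.toNat, by have := lr.le; omega, ?_⟩
        rw [h630, lr.keep _ (Or.inl (by omega)), h430, fillArr_natCast, if_pos (by omega)]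
        omega
      · obtain ⟨k, _, hk, hkz⟩ := lr.record a z hin
        refine ⟨?_, k, hk, by rw [h630, hkz]⟩
        by_contra hlt
        exact hin (congrFun (hP.eq_of_top_le (by omega)) z))
    (by
      intro z hz'
      have := lr.le
      rw [h630, lr.keep z (by omega), h430]
      unfold fillArr
      rw [if_neg (by omega)])
  have r8 : Runs (.assign 31 0 0) s₇ (s₇.write 31 0 0) (unit L) :=
    runs_assign (L := L) (s := s₇) (a := 31) (i := 0) (e := 0) trivial trivial (by decide)
  refine ⟨s₇.write 31 0 0, (r0.seq (r1.seq (r2.seq (r3.seq (r4.seq (r5.seq (r6.seq (r7.seq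
    r8)))))))).mono ?_, q7.write (by simp), ?_, ?_⟩
  · have hu := ten_mul_le_unit L
    have hu1 := one_le_unit L
    have huL := le_unit L
    -- The initial records have at most `L` bits each; the total length of the later ones is at most
    -- `t`, however long a single address is.
    have hsum : ∑ k ∈ Finset.range c, bits (s₆ 30 k) ≤ N * N * L + t := by
      rw [h630, Finset.range_eq_Ico, ← Finset.sum_Ico_consecutive _ (Nat.zero_le _) lr.le]
      refine add_le_add ?_ ((Finset.sum_le_sum fun _ _ => Nat.le_succ _).trans lr.sum)
      calc _ ≤ ∑ k ∈ Finset.Ico 0 (N * N), L := by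
            refine Finset.sum_le_sum fun k hk => ?_
            have hk' := (Finset.mem_Ico.1 hk).2
            rw [lr.keep _ (Or.inl (by exact_mod_cast hk')), h430, fillArr_natCast, if_pos hk']
            exact (bits_mono (by simpa using (by exact_mod_cast hk'.le))).trans hNN
        _ = N * N * L := by simp
    have hsum' : ∑ k ∈ Finset.range c, ((P.top + 4 + 1) * (unit L + 2 * bits (s₆ 30 k)) + 2 * unit L)
        ≤ (P.top + 5) * (5 * (N * N + t) * unit L) := by
      calc _ = (P.top + 5) * (c * unit L + 2 * ∑ k ∈ Finset.range c, bits (s₆ 30 k))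
            + 2 * (c * unit L) := by
            rw [Finset.sum_add_distrib, ← Finset.mul_sum, Finset.sum_add_distrib, ← Finset.mul_sum]
            simp; ring
        _ ≤ (P.top + 5) * (c * unit L + 2 * ∑ k ∈ Finset.range c, bits (s₆ 30 k))
            + (P.top + 5) * (2 * (c * unit L)) := by
            refine Nat.add_le_add_left (Nat.le_mul_of_pos_left _ (by omega)) _
        _ = (P.top + 5) * (3 * (c * unit L) + 2 * ∑ k ∈ Finset.range c, bits (s₆ 30 k)) := by ring
        _ ≤ _ := by
            refine Nat.mul_le_mul_left _ ?_
            have h1 : c * unit L ≤ (N * N + t) * unit L := Nat.mul_le_mul_right _ hc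
            have h2 : N * N * L + t ≤ (N * N + t) * unit L := by
              rw [add_mul]
              exact add_le_add (Nat.mul_le_mul_left _ huL) (Nat.le_mul_of_pos_right _ hu1)
            nlinarith
    have h5 : t * (10 * (L + 2) ^ 2) ≤ t * unit L := Nat.mul_le_mul_left _ hu
    have h6 : unit L ≤ N * N * unit L := Nat.le_mul_of_pos_left _ h1N
    have h7 : (P.top + 5) * (5 * (N * N + t) * unit L) + 90 * ((N * N + t) * unit L) ≤
        100 * (P.top + 5) * (N * N + t) * unit L := by
      have : 5 * ((N * N + t) * unit L) ≤ (P.top + 5) * ((N * N + t) * unit L) :=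
        Nat.mul_le_mul_right _ (by omega)
      nlinarith
    refine le_trans ?_ h7
    have h8 : (N * N + t) * unit L = N * N * unit L + t * unit L := add_mul _ _ _
    have h9 : (3 * (N * N) + 2) * unit L = 3 * (N * N * unit L) + 2 * unit L := by ring
    rw [h9]
    omega
  · rw [State.write_ne _ (by decide), e7 _ (by decide) (by decide), f6, e5 _ (by decide) (by decide)]
  · intro a h4 h18
    by_cases ha31 : a = 31
    · subst ha31
      rw [State.write_eq, Function.update_self, h731, h631, lr.count, hs₄, State.write_eq,
        Function.update_self, e3 _ (by decide) (by decide), e2 _ (by decide) (by decide),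
        e1 _ (by decide) (by decide), e0 _ (by decide), hz _ (by omega)]
      funext z
      simp only [Function.update_apply]
      split_ifs <;> rfl
    · rw [State.write_ne _ ha31]
      rcases lt_trichotomy a 30 with h | rfl | h
      · rw [e7 a h h4, e6 a h18 h4, e5 a h h4]
      · rw [h730, hz _ le_rfl]
      · obtain ⟨b, rfl⟩ : ∃ b, a = b + 32 := ⟨a - 32, by omega⟩
        rw [h7, hz _ (by omega)]

end RAM

/-! ### Calculus of the inversion signs. -/

namespace SteinerJoin

section Sign
variable {U : Type*} [LinearOrder U]

/-- As a product over pairs, the sign is multiplicative under disjoint unions in either argument,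
and this is how all later sign identities are obtained. -/
theorem sign_eq_prod (A B : Finset U) :
    sign A B = ∏ a ∈ A, ∏ b ∈ B, if b < a then (-1 : ℤ) else 1 := by
  rw [← Finset.prod_product', sign, Finset.prod_ite]
  simp

theorem sign_union_left {A A' : Finset U} (h : Disjoint A A') (B : Finset U) :
    sign (A ∪ A') B = sign A B * sign A' B := by
  simp only [sign_eq_prod, Finset.prod_union h]

theorem sign_union_right (A : Finset U) {B B' : Finset U} (h : Disjoint B B') :
    sign A (B ∪ B') = sign A B * sign A B' := by
  simp only [sign_eq_prod, Finset.prod_union h, Finset.prod_mul_distrib]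

theorem sign_mul_self (A B : Finset U) : sign A B * sign A B = 1 := by
  rw [sign, ← mul_pow]; simp

/-- A pair `(a, b)` with `a ≠ b` is an inversion for exactly one of the two signs; the diagonal
pairs, which are inversions for neither, contribute `(-1) ^ |A ∩ B|`. -/
theorem sign_mul_sign_comm (A B : Finset U) :
    sign A B * sign B A * (-1) ^ (A ∩ B).card = (-1) ^ (A.card * B.card) := by
  have h1 : ((-1 : ℤ)) ^ (A ∩ B).card = ∏ a ∈ A, ∏ b ∈ B, if a = b then (-1 : ℤ) else 1 := by
    rw [← Finset.prod_product', Finset.prod_ite]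
    simp only [Finset.prod_const, one_pow, mul_one]
    congr 1
    refine Finset.card_bij (fun a _ => (a, a)) ?_ ?_ ?_
    · intro a ha
      simpa using ha
    · intro a _ b _ h
      exact (Prod.mk.inj h).1
    · rintro ⟨a, b⟩ h
      simp only [Finset.mem_filter, Finset.mem_product] at h
      exact ⟨a, by simp [h.1.1, h.2 ▸ h.1.2], by simp [h.2]⟩
  have h2 : sign B A = ∏ a ∈ A, ∏ b ∈ B, if a < b then (-1 : ℤ) else 1 := by
    rw [sign_eq_prod, Finset.prod_comm]
  rw [h1, h2, sign_eq_prod]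
  simp only [← Finset.prod_mul_distrib]
  rw [mul_comm A.card, pow_mul, ← Finset.prod_const, ← Finset.prod_const]
  refine Finset.prod_congr rfl fun a _ => Finset.prod_congr rfl fun b _ => ?_
  rcases lt_trichotomy a b with h | rfl | h
  · simp [h, h.not_gt, h.ne]
  · simp
  · simp [h, h.not_gt, h.ne']

theorem abs_sign (A B : Finset U) : |sign A B| = 1 := by
  rw [sign, abs_pow]; simp

end Sign

/-! ### The exterior product as the leading part of a product of Fock space matrices. -/

section Clifford
variable {U : Type*} [LinearOrder U]

/-- The transform that turns the coefficients `F B C` of the monomials "create `B`, annihilate `C`"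
into matrix entries on the Fock space; `c = 1` for the transform, `c = -1` for its inverse. -/
def fock (c : ℤ) (F : Finset U → Finset U → ℤ) (T S : Finset U) : ℤ :=
  ∑ D ∈ (T ∩ S).powerset, c ^ D.card * (sign T D * sign S D) * F (T \ D) (S \ D)

/-- The sign of the term with index `(X, R, D, E)` in the expansion of a product of two transforms. -/
def termSign (B C X R D E : Finset U) : ℤ :=
  (-1) ^ X.card * (sign B X * sign C X) * (sign (B \ X) D * sign R D) *
    (sign R E * sign (C \ X) E)

/-- The inversions inside `D` occur in both signs and cancel. -/
theorem sign_sdiff_mul {T S D : Finset U} (hT : D ⊆ T) (hS : D ⊆ S) :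
    sign T D * sign S D = sign (T \ D) D * sign (S \ D) D := by
  have h1 : sign T D = sign (T \ D) D * sign D D := by
    rw [← sign_union_left Finset.sdiff_disjoint, Finset.sdiff_union_of_subset hT]
  have h2 : sign S D = sign (S \ D) D * sign D D := by
    rw [← sign_union_left Finset.sdiff_disjoint, Finset.sdiff_union_of_subset hS]
  rw [h1, h2]
  linear_combination (sign (T \ D) D * sign (S \ D) D) * sign_mul_self D D

/-- In this form the first arguments of the last four signs are the arguments of `F` and `G`, which
do not change under the involution. -/
theorem termSign_eq {B C X R D E : Finset U} (hD : D ⊆ (B \ X) ∩ R)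
    (hE : E ⊆ R ∩ (C \ X)) : termSign B C X R D E =
    (-1) ^ X.card * (sign B X * sign C X) * (sign ((B \ X) \ D) D * sign (R \ D) D) *
      (sign (R \ E) E * sign ((C \ X) \ E) E) := by
  rw [Finset.subset_inter_iff] at hD hE
  rw [termSign, sign_sdiff_mul hD.1 hD.2, sign_sdiff_mul hE.1 hE.2]

/-- Moving `e` from `X` into `R`, `D` and `E` leaves `(B \ X) \ D`, `R \ D`, `R \ E` and `(C \ X) \
E` unchanged, hence also the values of `F` and `G`. The factor `(-1) ^ |X|` changes sign, and the
remaining signs have the same product before and after. Such pairs of terms therefore cancel. -/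
theorem termSign_toggle {B C X R D E : Finset U} {e : U} (hX : X ⊆ B ∩ C) (hD : D ⊆ (B \ X) ∩ R)
    (hE : E ⊆ R ∩ (C \ X)) (heX : e ∈ X) (heR : e ∉ R) :
    termSign B C (X.erase e) (insert e R) (insert e D) (insert e E) = -termSign B C X R D E := by
  have heD : e ∉ D := fun h => heR (Finset.mem_inter.1 (hD h)).2
  have heE : e ∉ E := fun h => heR (Finset.mem_inter.1 (hE h)).1
  have heB : e ∈ B := (Finset.mem_inter.1 (hX heX)).1
  have heC : e ∈ C := (Finset.mem_inter.1 (hX heX)).2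
  have hD' : insert e D ⊆ (B \ X.erase e) ∩ insert e R := by
    intro u hu
    rcases Finset.mem_insert.1 hu with rfl | hu
    · simp [heB]
    · have := hD hu
      simp only [Finset.mem_inter, Finset.mem_sdiff, Finset.mem_erase, Finset.mem_insert] at this ⊢
      tauto
  have hE' : insert e E ⊆ insert e R ∩ (C \ X.erase e) := by
    intro u hu
    rcases Finset.mem_insert.1 hu with rfl | hu
    · simp [heC]
    · have := hE hu
      simp only [Finset.mem_inter, Finset.mem_sdiff, Finset.mem_erase, Finset.mem_insert] at this ⊢
      tauto
  rw [termSign_eq hD' hE', termSign_eq hD hE]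
  have s1 : (B \ X.erase e) \ insert e D = ((B \ X) \ D) := by
    ext u; simp only [Finset.mem_sdiff, Finset.mem_erase, Finset.mem_insert]
    by_cases h : u = e <;> simp [h, heX]
  have s2 : (C \ X.erase e) \ insert e E = ((C \ X) \ E) := by
    ext u; simp only [Finset.mem_sdiff, Finset.mem_erase, Finset.mem_insert]
    by_cases h : u = e <;> simp [h, heX]
  have s3 : insert e R \ insert e D = R \ D := by
    ext u; simp only [Finset.mem_sdiff, Finset.mem_insert]
    by_cases h : u = e <;> simp [h, heR]
  have s4 : insert e R \ insert e E = R \ E := by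
    ext u; simp only [Finset.mem_sdiff, Finset.mem_insert]
    by_cases h : u = e <;> simp [h, heR]
  rw [s1, s2, s3, s4]
  have ins : ∀ Y Z : Finset U, e ∉ Z → sign Y (insert e Z) = sign Y {e} * sign Y Z := by
    intro Y Z h
    rw [Finset.insert_eq, sign_union_right _ (Finset.disjoint_singleton_left.2 h)]
  have hc : X.card = (X.erase e).card + 1 := (Finset.card_erase_add_one heX).symm
  have hXe : ∀ Y : Finset U, sign Y X = sign Y {e} * sign Y (X.erase e) := by
    intro Y
    rw [← ins Y _ (Finset.notMem_erase e X), Finset.insert_erase heX]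
  rw [ins _ D heD, ins _ D heD, ins _ E heE, ins _ E heE, hXe B, hXe C, hc, pow_succ]
  have hB : sign B {e} = sign ((B \ X) \ D) {e} * sign D {e} * sign X {e} := by
    rw [← sign_union_left Finset.sdiff_disjoint, Finset.sdiff_union_of_subset
      (fun u hu => (Finset.mem_inter.1 (hD hu)).1), ← sign_union_left Finset.sdiff_disjoint,
      Finset.sdiff_union_of_subset (fun u hu => (Finset.mem_inter.1 (hX hu)).1)]
  have hC : sign C {e} = sign ((C \ X) \ E) {e} * sign E {e} * sign X {e} := by
    rw [← sign_union_left Finset.sdiff_disjoint, Finset.sdiff_union_of_subset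
      (fun u hu => (Finset.mem_inter.1 (hE hu)).2), ← sign_union_left Finset.sdiff_disjoint,
      Finset.sdiff_union_of_subset (fun u hu => (Finset.mem_inter.1 (hX hu)).2)]
  have hR1 : sign R {e} = sign (R \ D) {e} * sign D {e} := by
    rw [← sign_union_left Finset.sdiff_disjoint, Finset.sdiff_union_of_subset
      (fun u hu => (Finset.mem_inter.1 (hD hu)).2)]
  have hR2 : sign R {e} = sign (R \ E) {e} * sign E {e} := by
    rw [← sign_union_left Finset.sdiff_disjoint, Finset.sdiff_union_of_subset
      (fun u hu => (Finset.mem_inter.1 (hE hu)).1)]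
  -- The factors gained from `D` and `E` agree with those lost from `X`: `B` is the disjoint union
  -- of `(B \ X) \ D`, `D` and `X`, similarly `C` with `E`, and `R` decomposes both along `D` and
  -- along `E`. The contributions of `X` occur twice.
  have key : sign ((B \ X) \ D) {e} * sign (R \ D) {e} * sign (R \ E) {e} * sign ((C \ X) \ E) {e}
      = sign B {e} * sign C {e} := by
    have hr : (sign (R \ D) {e} * sign D {e}) * (sign (R \ E) {e} * sign E {e}) = 1 := by
      rw [← hR1, ← hR2, sign_mul_self]
    rw [hB, hC]
    have q1 := sign_mul_self D {e}
    have q2 := sign_mul_self E {e}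
    have q3 := sign_mul_self X {e}
    generalize sign D {e} = d at *
    generalize sign E {e} = e' at *
    generalize sign X {e} = x at *
    generalize sign (R \ D) {e} = rd at *
    generalize sign (R \ E) {e} = re at *
    have h2 : rd * re = d * e' := by
      linear_combination d * e' * hr - rd * re * e' * e' * q1 - rd * re * q2
    linear_combination (sign ((B \ X) \ D) {e} * sign ((C \ X) \ E) {e}) * h2
      - (sign ((B \ X) \ D) {e} * sign ((C \ X) \ E) {e}) * d * e' * q3
  have key2 : (sign B {e} * sign C {e}) * (sign B {e} * sign C {e}) = 1 := by
    linear_combination (sign C {e} * sign C {e}) * sign_mul_self B {e} + sign_mul_self C {e}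
  linear_combination ((-1) ^ (X.erase e).card * (sign B (X.erase e) * sign C (X.erase e)) *
    (sign ((B \ X) \ D) D * sign (R \ D) D) * (sign (R \ E) E * sign ((C \ X) \ E) E)) * key

/-- The sign of a term without contractions. -/
theorem termSign_good {By Bz Cy Cz : Finset U} (hB : Disjoint By Bz) (hC : Disjoint Cy Cz) :
    termSign (By ∪ Bz) (Cy ∪ Cz) (Bz ∩ Cy) (Bz ∪ Cy) (Bz \ Cy) (Cy \ Bz) =
      sign By Bz * sign Cz Cy * (-1) ^ (Bz.card * Cy.card) := by
  have hB' : ∀ u, u ∈ By → u ∉ Bz := fun _ h => Finset.disjoint_left.1 hB h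
  have hC' : ∀ u, u ∈ Cy → u ∉ Cz := fun _ h => Finset.disjoint_left.1 hC h
  rw [termSign_eq]
  rotate_left
  · intro u; simp only [Finset.mem_inter, Finset.mem_sdiff, Finset.mem_union]; tauto
  · intro u; simp only [Finset.mem_inter, Finset.mem_sdiff, Finset.mem_union]; tauto
  have s1 : ((By ∪ Bz) \ (Bz ∩ Cy)) \ (Bz \ Cy) = By := by
    ext u; have := hB' u; simp only [Finset.mem_inter, Finset.mem_sdiff, Finset.mem_union]; tauto
  have s2 : ((Cy ∪ Cz) \ (Bz ∩ Cy)) \ (Cy \ Bz) = Cz := by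
    ext u; have := hC' u; simp only [Finset.mem_inter, Finset.mem_sdiff, Finset.mem_union]; tauto
  have s3 : (Bz ∪ Cy) \ (Bz \ Cy) = Cy := by
    ext u; simp only [Finset.mem_sdiff, Finset.mem_union]; tauto
  have s4 : (Bz ∪ Cy) \ (Cy \ Bz) = Bz := by
    ext u; simp only [Finset.mem_sdiff, Finset.mem_union]; tauto
  rw [s1, s2, s3, s4, sign_union_left hB, sign_union_left hC, ← sign_mul_sign_comm]
  have t1 : ∀ Y, sign Y Bz = sign Y (Bz ∩ Cy) * sign Y (Bz \ Cy) := fun Y => by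
    rw [← sign_union_right _ (Finset.disjoint_left.2 fun u hu hu' => by simp at hu hu'; tauto)]
    congr 1
    ext u; simp only [Finset.mem_inter, Finset.mem_sdiff, Finset.mem_union]; tauto
  have t2 : ∀ Y, sign Y Cy = sign Y (Bz ∩ Cy) * sign Y (Cy \ Bz) := fun Y => by
    rw [← sign_union_right _ (Finset.disjoint_left.2 fun u hu hu' => by simp at hu hu'; tauto)]
    congr 1
    ext u; simp only [Finset.mem_inter, Finset.mem_sdiff, Finset.mem_union]; tauto
  rw [t1 By, t2 Cz, t2 Bz, t1 Cy]
  ring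

/-- With `X ⊆ R` and `D`, `E` disjoint, the sets `X`, `D`, `E` are pairwise disjoint subsets of `R`.
Counting in `C` gives `r₁ = |X| + |E|`, and counting in `R` gives `|R| = |D| + r₁`, so that they
fill `R`. This is the place where the maximality of the rank excludes contractions. -/
theorem mem_of_rank {r₁ r₂ : ℕ} {B C X R D E : Finset U} (hC : C.card = r₁ + r₂)
    (h : X ⊆ B ∩ C ∧ D ⊆ (B \ X) ∩ R ∧ E ⊆ R ∩ (C \ X)) (h₁ : (R \ D).card = r₁)
    (h₂ : ((C \ X) \ E).card = r₂) (hW : (X \ R) ∪ (D ∩ E) = ∅) (u : U) :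
    u ∈ R ↔ u ∈ X ∨ u ∈ D ∨ u ∈ E := by
  obtain ⟨hX, hD, hE⟩ := h
  rw [Finset.union_eq_empty, Finset.sdiff_eq_empty_iff_subset] at hW
  rw [Finset.subset_inter_iff] at hX hD hE
  have d1 : Disjoint X D := Finset.disjoint_right.2 fun u hu => (Finset.mem_sdiff.1 (hD.1 hu)).2
  have d2 : Disjoint X E := Finset.disjoint_right.2 fun u hu => (Finset.mem_sdiff.1 (hE.2 hu)).2
  have d3 : Disjoint D E := Finset.disjoint_iff_inter_eq_empty.2 hW.2
  have c1 := Finset.card_sdiff_add_card_eq_card hD.2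
  have c2 := Finset.card_sdiff_add_card_eq_card hE.2
  have c3 := Finset.card_sdiff_add_card_eq_card hX.2
  have c4 : (X ∪ (D ∪ E)).card = X.card + (D.card + E.card) := by
    rw [Finset.card_union_of_disjoint (Finset.disjoint_union_right.2 ⟨d1, d2⟩),
      Finset.card_union_of_disjoint d3]
  have : X ∪ (D ∪ E) = R := Finset.eq_of_subset_of_card_le
    (Finset.union_subset hW.1 (Finset.union_subset hD.2 hE.1)) (by omega)
  rw [← this]
  simp

variable [Fintype U]

theorem mem_splits {B : Finset U} {p : Finset U × Finset U} :
    p ∈ splits B ↔ p.1 ∪ p.2 = B ∧ Disjoint p.1 p.2 := by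
  simp [splits, Finset.disjoint_iff_inter_eq_empty]

set_option maxHeartbeats 1000000 in
/-- Products of Fock space matrices compute, in top degree, the exterior product. -/
theorem fock_mul_fock {r₁ r₂ : ℕ} {F G : Finset U → Finset U → ℤ}
    (hF : ∀ B C, F B C ≠ 0 → C.card = r₁) (hG : ∀ B C, G B C ≠ 0 → C.card = r₂)
    {B C : Finset U} (hC : C.card = r₁ + r₂) :
    fock (-1) (fun T S => ∑ R, fock 1 F T R * fock 1 G R S) B C =
      ∑ p ∈ splits B, ∑ q ∈ splits C, F p.1 q.1 * G p.2 q.2 *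
        (sign p.1 p.2 * sign q.2 q.1 * (-1) ^ (p.2.card * q.1.card)) := by
  classical
  -- the index set of the expanded sum
  let 𝒯 : Finset (Finset U × Finset U × Finset U × Finset U) := Finset.univ.filter fun t =>
    t.1 ⊆ B ∩ C ∧ t.2.2.1 ⊆ (B \ t.1) ∩ t.2.1 ∧ t.2.2.2 ⊆ t.2.1 ∩ (C \ t.1)
  let τ : Finset U × Finset U × Finset U × Finset U → ℤ := fun t =>
    termSign B C t.1 t.2.1 t.2.2.1 t.2.2.2 *
      (F ((B \ t.1) \ t.2.2.1) (t.2.1 \ t.2.2.1) * G (t.2.1 \ t.2.2.2) ((C \ t.1) \ t.2.2.2))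
  have expand : fock (-1) (fun T S => ∑ R, fock 1 F T R * fock 1 G R S) B C = ∑ t ∈ 𝒯, τ t := by
    have pw : ∀ (s : Finset U) (f : Finset U → ℤ),
        ∑ D ∈ s.powerset, f D = ∑ D, if D ⊆ s then f D else 0 := by
      intro s f
      rw [← Finset.sum_filter]
      congr 1
      ext D; simp
    simp only [𝒯, Finset.sum_filter, Fintype.sum_prod_type, fock, pw]
    refine Finset.sum_congr rfl fun X _ => ?_
    by_cases hX : X ⊆ B ∩ C
    swap
    · simp [hX]
    simp only [hX, if_true, true_and, Finset.mul_sum, Finset.sum_mul]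
    refine Finset.sum_congr rfl fun R _ => ?_
    rw [Finset.sum_comm]
    refine Finset.sum_congr rfl fun D _ => Finset.sum_congr rfl fun E _ => ?_
    by_cases hD : D ⊆ (B \ X) ∩ R <;> by_cases hE : E ⊆ R ∩ (C \ X) <;> simp [hD, hE, τ, termSign]
    ring
  let rk : Finset U × Finset U × Finset U × Finset U → Prop := fun t =>
    (t.2.1 \ t.2.2.1).card = r₁ ∧ ((C \ t.1) \ t.2.2.2).card = r₂
  -- The supports of `F` and `G` make all terms with other ranks vanish.
  have rank : ∑ t ∈ 𝒯, τ t = ∑ t ∈ 𝒯.filter rk, τ t := by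
    refine (Finset.sum_filter_of_ne fun t _ h => ?_).symm
    exact ⟨hF _ _ (left_ne_zero_of_mul (right_ne_zero_of_mul h)),
      hG _ _ (right_ne_zero_of_mul (right_ne_zero_of_mul h))⟩
  -- An element of `W t` either lies in `X` but not in `R`, or in `D` and `E` and hence in `R`.
  -- These two situations are exchanged by `tog`; a term with `W t = ∅` has no element that can be
  -- toggled.
  let W : Finset U × Finset U × Finset U × Finset U → Finset U := fun t =>
    (t.1 \ t.2.1) ∪ (t.2.2.1 ∩ t.2.2.2)
  let tog : U → Finset U × Finset U × Finset U × Finset U →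
      Finset U × Finset U × Finset U × Finset U := fun e t =>
    if e ∈ t.1 then (t.1.erase e, insert e t.2.1, insert e t.2.2.1, insert e t.2.2.2)
    else (insert e t.1, t.2.1.erase e, t.2.2.1.erase e, t.2.2.2.erase e)
  -- toggling an element of `W` keeps everything but the sign
  have togW : ∀ t ∈ 𝒯.filter rk, ∀ e ∈ W t, tog e t ∈ 𝒯.filter rk ∧ W (tog e t) = W t ∧
      tog e (tog e t) = t ∧ tog e t ≠ t ∧ τ t + τ (tog e t) = 0 := by
    rintro ⟨X, R, D, E⟩ ht e he
    simp only [𝒯, Finset.mem_filter, Finset.mem_univ, true_and, rk] at ht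
    obtain ⟨⟨hX, hD, hE⟩, h1, h2⟩ := ht
    have gX : ∀ u, u ∈ X → u ∈ B ∧ u ∈ C := fun u hu => Finset.mem_inter.1 (hX hu)
    have gD : ∀ u, u ∈ D → (u ∈ B ∧ u ∉ X) ∧ u ∈ R := fun u hu => by simpa using hD hu
    have gE : ∀ u, u ∈ E → u ∈ R ∧ (u ∈ C ∧ u ∉ X) := fun u hu => by simpa using hE hu
    simp only [W, Finset.mem_union, Finset.mem_sdiff, Finset.mem_inter] at he
    by_cases heX : e ∈ X
    · have heR : e ∉ R := by
        have := gD e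
        tauto
      have heD : e ∉ D := fun h => heR (gD e h).2
      have heE : e ∉ E := fun h => heR (gE e h).1
      have s1 : (B \ X.erase e) \ insert e D = ((B \ X) \ D) := by
        ext u; simp only [Finset.mem_sdiff, Finset.mem_erase, Finset.mem_insert]
        by_cases h : u = e <;> simp [h, heX]
      have s2 : (C \ X.erase e) \ insert e E = ((C \ X) \ E) := by
        ext u; simp only [Finset.mem_sdiff, Finset.mem_erase, Finset.mem_insert]
        by_cases h : u = e <;> simp [h, heX]
      have s3 : insert e R \ insert e D = R \ D := by
        ext u; simp only [Finset.mem_sdiff, Finset.mem_insert]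
        by_cases h : u = e <;> simp [h, heR]
      have s4 : insert e R \ insert e E = R \ E := by
        ext u; simp only [Finset.mem_sdiff, Finset.mem_insert]
        by_cases h : u = e <;> simp [h, heR]
      have ht : tog e (X, R, D, E) = (X.erase e, insert e R, insert e D, insert e E) := if_pos heX
      rw [ht]
      refine ⟨?_, ?_, ?_, ?_, ?_⟩
      · simp only [𝒯, Finset.mem_filter, Finset.mem_univ, true_and, rk, s2, s3]
        refine ⟨⟨?_, ?_, ?_⟩, h1, h2⟩
        · exact (Finset.erase_subset _ _).trans hX
        · intro u
          have := gD u
          have := gX e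
          simp only [Finset.mem_inter, Finset.mem_sdiff, Finset.mem_erase, Finset.mem_insert]
          by_cases h : u = e
          · subst h; tauto
          · tauto
        · intro u
          have := gE u
          have := gX e
          simp only [Finset.mem_inter, Finset.mem_sdiff, Finset.mem_erase, Finset.mem_insert]
          by_cases h : u = e
          · subst h; tauto
          · tauto
      · ext u
        simp only [W, Finset.mem_union, Finset.mem_sdiff, Finset.mem_inter, Finset.mem_erase,
          Finset.mem_insert]
        by_cases h : u = e
        · subst h; tauto
        · tauto
      · simp only [tog, Finset.mem_erase, ne_eq, not_true, false_and, if_false,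
          Finset.insert_erase heX, Finset.erase_insert heR, Finset.erase_insert heD,
          Finset.erase_insert heE]
      · intro h
        have := congrArg Prod.fst h
        exact (Finset.erase_eq_self.1 this) heX
      · simp only [τ, s1, s2, s3, s4, termSign_toggle hX hD hE heX heR]
        ring
    · have heD : e ∈ D := by tauto
      have heE : e ∈ E := by tauto
      have heR : e ∈ R := (gD e heD).2
      have heB : e ∈ B := (gD e heD).1.1
      have heC : e ∈ C := (gE e heE).2.1
      have ht : tog e (X, R, D, E) = (insert e X, R.erase e, D.erase e, E.erase e) := if_neg heX
      have hX' : insert e X ⊆ B ∩ C := by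
        intro u
        have := gX u
        simp only [Finset.mem_inter, Finset.mem_insert]
        rintro (rfl | h)
        · exact ⟨heB, heC⟩
        · exact this h
      have hD' : D.erase e ⊆ (B \ insert e X) ∩ R.erase e := by
        intro u
        have := gD u
        simp only [Finset.mem_inter, Finset.mem_sdiff, Finset.mem_erase, Finset.mem_insert]
        tauto
      have hE' : E.erase e ⊆ R.erase e ∩ (C \ insert e X) := by
        intro u
        have := gE u
        simp only [Finset.mem_inter, Finset.mem_sdiff, Finset.mem_erase, Finset.mem_insert]
        tauto
      have s1 : (B \ insert e X) \ D.erase e = ((B \ X) \ D) := by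
        ext u; simp only [Finset.mem_sdiff, Finset.mem_erase, Finset.mem_insert]
        by_cases h : u = e <;> simp [h, heD]
      have s2 : (C \ insert e X) \ E.erase e = ((C \ X) \ E) := by
        ext u; simp only [Finset.mem_sdiff, Finset.mem_erase, Finset.mem_insert]
        by_cases h : u = e <;> simp [h, heE]
      have s3 : R.erase e \ D.erase e = R \ D := by
        ext u; simp only [Finset.mem_sdiff, Finset.mem_erase]
        by_cases h : u = e <;> simp [h, heD]
      have s4 : R.erase e \ E.erase e = R \ E := by
        ext u; simp only [Finset.mem_sdiff, Finset.mem_erase]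
        by_cases h : u = e <;> simp [h, heE]
      rw [ht]
      refine ⟨?_, ?_, ?_, ?_, ?_⟩
      · simp only [𝒯, Finset.mem_filter, Finset.mem_univ, true_and, rk, s2, s3]
        exact ⟨⟨hX', hD', hE'⟩, h1, h2⟩
      · ext u
        simp only [W, Finset.mem_union, Finset.mem_sdiff, Finset.mem_inter, Finset.mem_erase,
          Finset.mem_insert]
        by_cases h : u = e
        · subst h; tauto
        · tauto
      · simp only [tog, Finset.mem_insert, true_or, if_true, Finset.erase_insert heX,
          Finset.insert_erase heR, Finset.insert_erase heD, Finset.insert_erase heE]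
      · intro h
        have := congrArg Prod.fst h
        exact heX (Finset.insert_eq_self.1 this)
      · have key := termSign_toggle hX' hD' hE' (Finset.mem_insert_self e X)
          (Finset.notMem_erase e R)
        rw [Finset.erase_insert heX, Finset.insert_erase heR, Finset.insert_erase heD,
          Finset.insert_erase heE] at key
        simp only [τ, s1, s2, s3, s4, key]
        ring
  -- Toggling the least element of `W t` is an involution because `W` itself is not altered by
  -- toggling.
  have cancel : ∑ t ∈ (𝒯.filter rk).filter (fun t => ¬ W t = ∅), τ t = 0 := by
    refine Finset.sum_involution
      (fun t ht => tog ((W t).min' (Finset.nonempty_iff_ne_empty.2 (Finset.mem_filter.1 ht).2)) t)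
      ?_ ?_ ?_ ?_
    · intro t ht
      exact (togW t (Finset.mem_filter.1 ht).1 _ (Finset.min'_mem _ _)).2.2.2.2
    · intro t ht _
      exact (togW t (Finset.mem_filter.1 ht).1 _ (Finset.min'_mem _ _)).2.2.2.1
    · intro t ht
      have h := togW t (Finset.mem_filter.1 ht).1 _ (Finset.min'_mem _
        (Finset.nonempty_iff_ne_empty.2 (Finset.mem_filter.1 ht).2))
      exact Finset.mem_filter.2 ⟨h.1, by rw [h.2.1]; exact (Finset.mem_filter.1 ht).2⟩
    · intro t ht
      have h := togW t (Finset.mem_filter.1 ht).1 _ (Finset.min'_mem _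
        (Finset.nonempty_iff_ne_empty.2 (Finset.mem_filter.1 ht).2))
      simp only [h.2.1]
      exact h.2.2.1
  rw [expand, rank, ← Finset.sum_filter_add_sum_filter_not _ (fun t => W t = ∅), cancel, add_zero,
    ← Finset.sum_product']
  have hr : ∀ p : (Finset U × Finset U) × Finset U × Finset U,
      F p.1.1 p.2.1 * G p.1.2 p.2.2 * (sign p.1.1 p.1.2 * sign p.2.2 p.2.1 *
        (-1) ^ (p.1.2.card * p.2.1.card)) ≠ 0 → p.2.1.card = r₁ := fun p h =>
    hF _ _ (left_ne_zero_of_mul (left_ne_zero_of_mul h))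
  -- On the side of the splittings the first rank is imposed as well; the second then follows from
  -- `|C| = r₁ + r₂`.
  rw [← Finset.sum_filter_of_ne (p := fun p => p.2.1.card = r₁) fun p _ h => hr p h]
  have unpack : ∀ {X R D E : Finset U}, (X, R, D, E) ∈ (𝒯.filter rk).filter (fun t => W t = ∅) →
      ((X ⊆ B ∩ C ∧ D ⊆ (B \ X) ∩ R ∧ E ⊆ R ∩ (C \ X)) ∧
        (R \ D).card = r₁ ∧ ((C \ X) \ E).card = r₂) ∧ (X \ R) ∪ (D ∩ E) = ∅ := by
    intro X R D E ht
    simpa only [𝒯, rk, W, Finset.mem_filter, Finset.mem_univ, true_and] using ht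
  have fwd : ∀ X R D E, (X, R, D, E) ∈ (𝒯.filter rk).filter (fun t => W t = ∅) →
      ((((B \ X) \ D), (R \ E)), ((R \ D), ((C \ X) \ E))) ∈
        (splits B ×ˢ splits C).filter (fun p => p.2.1.card = r₁) := by
    intro X R D E ht
    obtain ⟨⟨h1, ⟨h2, h3⟩⟩, hW⟩ := unpack ht
    have gR := mem_of_rank hC h1 h2 h3 hW
    clear unpack ht cancel togW rank expand tog W rk τ 𝒯
    have gX : ∀ u, u ∈ X → u ∈ B ∧ u ∈ C := fun u hu => Finset.mem_inter.1 (h1.1 hu)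
    have gD : ∀ u, u ∈ D → (u ∈ B ∧ u ∉ X) ∧ u ∈ R := fun u hu => by simpa using h1.2.1 hu
    have gE : ∀ u, u ∈ E → u ∈ R ∧ (u ∈ C ∧ u ∉ X) := fun u hu => by simpa using h1.2.2 hu
    have gW : ∀ u, u ∈ D → u ∉ E := fun u hu hu' => by
      have : u ∈ (X \ R) ∪ (D ∩ E) := by simp [hu, hu']
      simp [hW] at this
    simp only [Finset.mem_filter, Finset.mem_product, mem_splits, Finset.disjoint_left]
    refine ⟨⟨⟨?_, ?_⟩, ?_, ?_⟩, h2⟩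
    · grind
    · grind
    · grind
    · grind
  have back : ∀ X R D E, (X, R, D, E) ∈ (𝒯.filter rk).filter (fun t => W t = ∅) →
      (((R \ E) ∩ (R \ D)), ((R \ E) ∪ (R \ D)), ((R \ E) \ (R \ D)), ((R \ D) \ (R \ E))) =
        (X, R, D, E) := by
    intro X R D E ht
    obtain ⟨⟨h1, ⟨h2, h3⟩⟩, hW⟩ := unpack ht
    have gR := mem_of_rank hC h1 h2 h3 hW
    clear fwd unpack ht cancel togW rank expand tog W rk τ 𝒯
    have gX : ∀ u, u ∈ X → u ∈ B ∧ u ∈ C := fun u hu => Finset.mem_inter.1 (h1.1 hu)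
    have gD : ∀ u, u ∈ D → (u ∈ B ∧ u ∉ X) ∧ u ∈ R := fun u hu => by simpa using h1.2.1 hu
    have gE : ∀ u, u ∈ E → u ∈ R ∧ (u ∈ C ∧ u ∉ X) := fun u hu => by simpa using h1.2.2 hu
    have gW : ∀ u, u ∈ D → u ∉ E := fun u hu hu' => by
      have : u ∈ (X \ R) ∪ (D ∩ E) := by simp [hu, hu']
      simp [hW] at this
    simp only [Prod.mk.injEq]
    refine ⟨?_, ?_, ?_, ?_⟩
    all_goals
      grind
  -- For the surviving terms `R \ E = X ∪ D` and `R \ D = X ∪ E` are the second part of `B` and the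
  -- first part of `C`. Conversely `X`, `R`, `D`, `E` are the intersection, the union and the two
  -- differences of these parts.
  refine Finset.sum_nbij' (fun t => ((((B \ t.1) \ t.2.2.1), t.2.1 \ t.2.2.2),
    (t.2.1 \ t.2.2.1, ((C \ t.1) \ t.2.2.2))))
    (fun p => (p.1.2 ∩ p.2.1, p.1.2 ∪ p.2.1, p.1.2 \ p.2.1, p.2.1 \ p.1.2)) ?_ ?_ ?_ ?_ ?_
  · rintro ⟨X, R, D, E⟩ ht
    exact fwd X R D E ht
  · rintro ⟨⟨By, Bz⟩, ⟨Cy, Cz⟩⟩ hp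
    simp only [Finset.mem_filter, Finset.mem_product, mem_splits] at hp
    obtain ⟨⟨⟨rfl, hB⟩, rfl, hC'⟩, h1⟩ := hp
    have gB : ∀ u, u ∈ By → u ∉ Bz := fun _ h => Finset.disjoint_left.1 hB h
    have gC : ∀ u, u ∈ Cy → u ∉ Cz := fun _ h => Finset.disjoint_left.1 hC' h
    have h2 : Cz.card = r₂ := by
      rw [Finset.card_union_of_disjoint hC'] at hC; omega
    simp only [𝒯, rk, W, Finset.mem_filter, Finset.mem_univ, true_and]
    refine ⟨⟨⟨?_, ?_, ?_⟩, ?_, ?_⟩, ?_⟩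
    · intro u; simp only [Finset.mem_inter, Finset.mem_union]; tauto
    · intro u; simp only [Finset.mem_inter, Finset.mem_union, Finset.mem_sdiff]; tauto
    · intro u; simp only [Finset.mem_inter, Finset.mem_union, Finset.mem_sdiff]; tauto
    · rw [← h1]; congr 1
      ext u; simp only [Finset.mem_union, Finset.mem_sdiff]; tauto
    · rw [← h2]; congr 1
      ext u; have := gC u; simp only [Finset.mem_inter, Finset.mem_union, Finset.mem_sdiff]; tauto
    · ext u; simp only [Finset.mem_inter, Finset.mem_union, Finset.mem_sdiff, Finset.notMem_empty]; tauto
  · rintro ⟨X, R, D, E⟩ ht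
    exact back X R D E ht
  · rintro ⟨⟨By, Bz⟩, ⟨Cy, Cz⟩⟩ hp
    simp only [Finset.mem_filter, Finset.mem_product, mem_splits] at hp
    obtain ⟨⟨⟨rfl, hB⟩, rfl, hC'⟩, h1⟩ := hp
    have gB : ∀ u, u ∈ By → u ∉ Bz := fun _ h => Finset.disjoint_left.1 hB h
    have gC : ∀ u, u ∈ Cy → u ∉ Cz := fun _ h => Finset.disjoint_left.1 hC' h
    simp only [Prod.mk.injEq]
    refine ⟨⟨?_, ?_⟩, ?_, ?_⟩
    all_goals
      ext u; have := gB u; have := gC u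
      simp only [Finset.mem_inter, Finset.mem_union, Finset.mem_sdiff]; tauto
  · rintro ⟨X, R, D, E⟩ ht
    have hm := fwd X R D E ht
    have hb := back X R D E ht
    simp only [Finset.mem_filter, Finset.mem_product, mem_splits] at hm
    obtain ⟨⟨⟨hB, hB'⟩, hC1, hC'⟩, _⟩ := hm
    simp only [Prod.mk.injEq] at hb
    have key := termSign_good hB' hC'
    rw [hB, hC1, hb.1, hb.2.1, hb.2.2.1, hb.2.2.2] at key
    simp only [τ, key]
    ring

end Clifford
end SteinerJoin

/-! ### Binary codes of sets and the transform one bit at a time. -/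

namespace SteinerJoin

/-! Sets coded by numbers -/

theorem mem_decode {tw m : ℕ} {v : Fin tw} : v ∈ decode tw m ↔ m.testBit v = true := by
  simp [decode]

theorem decode_injOn {tw m m' : ℕ} (hm : m < 2 ^ tw) (hm' : m' < 2 ^ tw)
    (h : decode tw m = decode tw m') : m = m' := by
  refine Nat.eq_of_testBit_eq fun i => ?_
  by_cases hi : i < tw
  · have := congrArg (fun s => (⟨i, hi⟩ : Fin tw) ∈ s) h
    simpa [mem_decode] using this
  · rw [Nat.testBit_lt_two_pow (hm.trans_le (Nat.pow_le_pow_right (by norm_num) (by omega))),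
      Nat.testBit_lt_two_pow (hm'.trans_le (Nat.pow_le_pow_right (by norm_num) (by omega)))]

theorem decode_bijective (a : ℕ) : Function.Bijective fun j : Fin (2 ^ a) => decode a j := by
  rw [Fintype.bijective_iff_injective_and_card]
  exact ⟨fun i j h => Fin.ext (decode_injOn i.2 j.2 h), by simp⟩

theorem decode_add_mul (tw m k : ℕ) : decode tw (k * 2 ^ tw + m) = decode tw m := by
  have h : ∀ x, decode tw x = decode tw (x % 2 ^ tw) := fun x => by
    ext v
    simp [mem_decode, Nat.testBit_mod_two_pow]
  rw [h, h m, mul_comm, Nat.mul_add_mod]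

theorem testBit_two_pow_add {v l : ℕ} (hl : l < 2 ^ v) (i : ℕ) :
    (2 ^ v + l).testBit i = (decide (i = v) || l.testBit i) := by
  rcases lt_trichotomy i v with h | rfl | h
  · rw [Nat.testBit_two_pow_add_gt h]; simp [h.ne]
  · rw [Nat.testBit_two_pow_add_eq, Nat.testBit_lt_two_pow hl]; simp
  · have : 2 ^ (v + 1) ≤ 2 ^ i := Nat.pow_le_pow_right (by norm_num) h
    rw [Nat.testBit_lt_two_pow (x := l) (by rw [pow_succ] at this; omega),
      Nat.testBit_lt_two_pow (by rw [pow_succ] at this; omega)]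
    simp [h.ne']

/-- Subtracting a power of two that occurs in the binary expansion causes no borrow. -/
theorem testBit_sub_two_pow {j v : ℕ} (h : j.testBit v = true) (i : ℕ) :
    (j - 2 ^ v).testBit i = (j.testBit i && !decide (i = v)) := by
  have h1 : j / 2 ^ v % 2 = 1 := by simpa [Nat.testBit_eq_decide_div_mod_eq] using h
  obtain ⟨q, l, hl, rfl⟩ : ∃ q l, l < 2 ^ v ∧ j = 2 ^ (v + 1) * q + (2 ^ v + l) := by
    refine ⟨j / 2 ^ v / 2, j % 2 ^ v, Nat.mod_lt _ (by positivity), ?_⟩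
    have e1 := Nat.div_add_mod j (2 ^ v)
    have e2 := Nat.div_add_mod (j / 2 ^ v) 2
    rw [h1] at e2
    conv_lhs => rw [← e1, ← e2]
    ring
  have e : 2 ^ (v + 1) * q + (2 ^ v + l) - 2 ^ v = 2 ^ (v + 1) * q + l := by omega
  have hl' : l < 2 ^ (v + 1) := by rw [pow_succ]; omega
  rw [e, Nat.testBit_two_pow_mul_add _ hl',
    Nat.testBit_two_pow_mul_add _ (by rw [pow_succ]; omega), testBit_two_pow_add hl]
  split_ifs with hi
  · by_cases hv : i = v
    · subst hv; simp [Nat.testBit_lt_two_pow hl]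
    · simp [hv]
  · simp [show i ≠ v by omega]

theorem decode_sub_two_pow {a j v : ℕ} (hv : v < a) (h : j.testBit v = true) :
    decode a (j - 2 ^ v) = decode a j \ {⟨v, hv⟩} := by
  ext u
  rw [mem_decode, Finset.mem_sdiff, mem_decode, testBit_sub_two_pow h]
  simp [Fin.ext_iff]

/-- The number of elements of the set coded by `j`. -/
def pc (tw j : ℕ) : ℕ := (decode tw j).card

theorem pc_zero (tw : ℕ) : pc tw 0 = 0 := by simp [pc, decode]

theorem pc_two_pow_add {tw v l : ℕ} (hv : v < tw) (hl : l < 2 ^ v) :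
    pc tw (l + 2 ^ v) = pc tw l + 1 := by
  have : decode tw (l + 2 ^ v) = insert ⟨v, hv⟩ (decode tw l) := by
    ext u
    rw [mem_decode, Finset.mem_insert, mem_decode, add_comm, testBit_two_pow_add hl]
    simp [Fin.ext_iff]
  rw [pc, this, Finset.card_insert_of_notMem, pc]
  rw [mem_decode]
  simp [Nat.testBit_lt_two_pow hl]

theorem pc_le (tw j : ℕ) : pc tw j ≤ tw := by
  simpa [pc] using Finset.card_le_univ (decode tw j)

theorem card_decode {a tw j : ℕ} (h : a ≤ tw) (hj : j < 2 ^ a) : (decode a j).card = pc tw j := by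
  refine Finset.card_bij (fun u _ => Fin.castLE h u) ?_ ?_ ?_
  · intro u hu
    rw [mem_decode] at hu ⊢
    exact hu
  · intro u _ v _ h
    exact Fin.castLE_injective _ h
  · intro u hu
    rw [mem_decode] at hu
    have hua : (u : ℕ) < a := by
      by_contra hlt
      rw [Nat.testBit_lt_two_pow (hj.trans_le (Nat.pow_le_pow_right (by norm_num) (by omega)))] at hu
      exact Bool.noConfusion hu
    exact ⟨⟨u, hua⟩, by rwa [mem_decode], by ext; rfl⟩

/-- The inversions against `v` are the elements above `v`; shifting the code by `v + 1` bits leaves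
exactly these. So signs can be read off from the table of cardinalities. -/
theorem sign_singleton {a tw j v : ℕ} (h : a ≤ tw) (hj : j < 2 ^ a) (hv : v < a) :
    sign (decode a j) {⟨v, hv⟩} = (-1) ^ pc tw (j / 2 ^ (v + 1)) := by
  rw [sign]
  congr 1
  have hb : ∀ u : ℕ, j.testBit u = true → u < a := by
    intro u hu
    by_contra hlt
    rw [Nat.testBit_lt_two_pow (hj.trans_le (Nat.pow_le_pow_right (by norm_num) (by omega)))] at hu
    exact Bool.noConfusion hu
  symm
  refine Finset.card_bij (fun u hu => ((⟨u + (v + 1), hb _ (by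
    rwa [mem_decode, Nat.testBit_div_two_pow] at hu)⟩ : Fin a), (⟨v, hv⟩ : Fin a))) ?_ ?_ ?_
  · intro u hu
    rw [mem_decode, Nat.testBit_div_two_pow] at hu
    simp only [Finset.mem_filter, Finset.mem_product, mem_decode, Finset.mem_singleton, and_true]
    exact ⟨hu, by rw [gt_iff_lt, Fin.lt_def]; simp only; omega⟩
  · intro u _ w _ h
    have := congrArg (fun p : Fin a × Fin a => (p.1 : ℕ)) h
    exact Fin.ext (by simpa using this)
  · rintro ⟨u, w⟩ h
    simp only [Finset.mem_filter, Finset.mem_product, mem_decode, Finset.mem_singleton] at h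
    obtain ⟨⟨h1, rfl⟩, h2⟩ := h
    rw [gt_iff_lt, Fin.lt_def] at h2
    simp only at h2
    refine ⟨⟨u - (v + 1), by omega⟩, ?_, ?_⟩
    · rw [mem_decode, Nat.testBit_div_two_pow]
      simp only
      rwa [Nat.sub_add_cancel h2]
    · simp only [Prod.mk.injEq, and_true]
      ext
      simp only
      omega

theorem neg_one_pow_eq (x : ℕ) : (-1 : ℤ) ^ x = 1 - 2 * ((x : ℤ) % 2) := by
  rcases Nat.even_or_odd x with h | h
  · rw [h.neg_one_pow]
    have := Nat.even_iff.1 h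
    omega
  · rw [h.neg_one_pow]
    have := Nat.odd_iff.1 h
    omega

/-- The transform `fock` restricted to the elements below `v`. -/
def fockBelow {a : ℕ} (c : ℤ) (F : Finset (Fin a) → Finset (Fin a) → ℤ) (v : ℕ)
    (T S : Finset (Fin a)) : ℤ :=
  ∑ D ∈ ((T ∩ S).filter fun u : Fin a => (u : ℕ) < v).powerset,
    c ^ D.card * (sign T D * sign S D) * F (T \ D) (S \ D)

section
variable {a : ℕ} (c : ℤ) (F : Finset (Fin a) → Finset (Fin a) → ℤ)

theorem fockBelow_zero (T S : Finset (Fin a)) : fockBelow c F 0 T S = F T S := by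
  simp [fockBelow, sign]

theorem fockBelow_self (T S : Finset (Fin a)) : fockBelow c F a T S = fock c F T S := by
  simp [fockBelow, fock]

/-- The sets `D` are sorted by whether they contain the new element `e`. For those that do,
splitting off `e` from `D` and from `T`, `S` leaves the factor `sign {e} D` twice, which is `1`. -/
theorem fockBelow_succ_of_mem {v : ℕ} (hv : v < a) {T S : Finset (Fin a)}
    (hT : ⟨v, hv⟩ ∈ T) (hS : ⟨v, hv⟩ ∈ S) : fockBelow c F (v + 1) T S = fockBelow c F v T S +
      c * (sign T {⟨v, hv⟩} * sign S {⟨v, hv⟩}) *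
        fockBelow c F v (T \ {⟨v, hv⟩}) (S \ {⟨v, hv⟩}) := by
  set e : Fin a := ⟨v, hv⟩ with he
  have h1 : (T ∩ S).filter (fun u : Fin a => (u : ℕ) < v + 1) =
      insert e ((T ∩ S).filter fun u : Fin a => (u : ℕ) < v) := by
    ext u
    simp only [Finset.mem_filter, Finset.mem_inter, Finset.mem_insert]
    constructor
    · rintro ⟨h, h'⟩
      rcases Nat.lt_succ_iff_lt_or_eq.1 h' with h' | h'
      · exact Or.inr ⟨h, h'⟩
      · exact Or.inl (Fin.ext h')
    · rintro (rfl | ⟨h, h'⟩)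
      · exact ⟨⟨hT, hS⟩, Nat.lt_succ_self v⟩
      · exact ⟨h, by omega⟩
  have h2 : ((T \ {e}) ∩ (S \ {e})).filter (fun u : Fin a => (u : ℕ) < v) =
      (T ∩ S).filter fun u : Fin a => (u : ℕ) < v := by
    ext u
    simp only [Finset.mem_filter, Finset.mem_inter, Finset.mem_sdiff, Finset.mem_singleton]
    constructor
    · tauto
    · rintro ⟨h, h'⟩
      have : u ≠ e := by rintro rfl; simp [he] at h'
      tauto
  unfold fockBelow
  rw [h1, Finset.sum_powerset_insert (by simp [he]), h2, Finset.mul_sum]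
  congr 1
  refine Finset.sum_congr rfl fun D hD => ?_
  have heD : e ∉ D := fun h => by
    have := Finset.mem_powerset.1 hD h
    simp [he] at this
  have s1 : ∀ Y : Finset (Fin a), Y \ insert e D = (Y \ {e}) \ D := fun Y => by
    ext u; simp only [Finset.mem_sdiff, Finset.mem_insert, Finset.mem_singleton]; tauto
  have s2 : ∀ Y : Finset (Fin a), sign Y (insert e D) = sign Y {e} * sign Y D := fun Y => by
    rw [Finset.insert_eq, sign_union_right _ (Finset.disjoint_singleton_left.2 heD)]
  have s3 : ∀ Y : Finset (Fin a), e ∈ Y → sign Y D = sign (Y \ {e}) D * sign {e} D := fun Y h => by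
    rw [← sign_union_left Finset.sdiff_disjoint,
      Finset.sdiff_union_of_subset (Finset.singleton_subset_iff.2 h)]
  rw [s1, s1, s2, s2, Finset.card_insert_of_notMem heD, s3 T hT, s3 S hS, pow_succ]
  linear_combination (c ^ D.card * c * sign T {e} * sign S {e} * sign (T \ {e}) D *
    sign (S \ {e}) D * F ((T \ {e}) \ D) ((S \ {e}) \ D)) * sign_mul_self {e} D

theorem fockBelow_succ_of_notMem {v : ℕ} (hv : v < a) {T S : Finset (Fin a)}
    (h : ⟨v, hv⟩ ∉ T ∨ ⟨v, hv⟩ ∉ S) : fockBelow c F (v + 1) T S = fockBelow c F v T S := by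
  unfold fockBelow
  congr 2
  ext u
  simp only [Finset.mem_filter, Finset.mem_inter, and_congr_right_iff]
  rintro ⟨h1, h2⟩
  have : (u : ℕ) ≠ v := by
    rintro rfl
    exact h.elim (fun h => h h1) (fun h => h h2)
  omega

/-- Each processed bit adds at most one further entry of the previous stage and so at most doubles
the bound. -/
theorem abs_fockBelow_le {c : ℤ} (hc : |c| = 1) {F : Finset (Fin a) → Finset (Fin a) → ℤ} {β : ℤ}
    (hF : ∀ T S, |F T S| ≤ β) {v : ℕ} (hv : v ≤ a) (T S : Finset (Fin a)) :
    |fockBelow c F v T S| ≤ 2 ^ v * β := by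
  induction v generalizing T S with
  | zero => simpa [fockBelow_zero] using hF T S
  | succ v ih =>
    have hβ : 0 ≤ 2 ^ v * β := by
      have := (abs_nonneg _).trans (hF T S)
      positivity
    by_cases h : (⟨v, hv⟩ : Fin a) ∈ T ∧ (⟨v, hv⟩ : Fin a) ∈ S
    · rw [fockBelow_succ_of_mem c F hv h.1 h.2]
      refine (abs_add_le _ _).trans ?_
      rw [abs_mul, abs_mul, abs_mul, hc, abs_sign, abs_sign, pow_succ]
      have h1 := ih (by omega) T S
      have h2 := ih (by omega) (T \ {⟨v, hv⟩}) (S \ {⟨v, hv⟩})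
      linarith
    · rw [fockBelow_succ_of_notMem c F hv (by tauto), pow_succ]
      have h1 := ih (by omega) T S
      linarith
end

/-- The rule by which the transform is computed in place, bit by bit. -/
theorem fockBelow_decode_succ {a tw v j l : ℕ} (h : a ≤ tw) (hj : j < 2 ^ a) (hl : l < 2 ^ a)
    (hv : v < a) (c : ℤ) (F : Finset (Fin a) → Finset (Fin a) → ℤ) :
    fockBelow c F (v + 1) (decode a j) (decode a l) = fockBelow c F v (decode a j) (decode a l) +
      if j.testBit v = true ∧ l.testBit v = true then
        c * (-1) ^ (pc tw (j / 2 ^ (v + 1)) + pc tw (l / 2 ^ (v + 1))) *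
          fockBelow c F v (decode a (j - 2 ^ v)) (decode a (l - 2 ^ v)) else 0 := by
  split_ifs with hb
  · rw [fockBelow_succ_of_mem c F hv (mem_decode.2 hb.1) (mem_decode.2 hb.2),
      sign_singleton h hj, sign_singleton h hl, decode_sub_two_pow hv hb.1,
      decode_sub_two_pow hv hb.2, pow_add (-1 : ℤ)]
  · rw [fockBelow_succ_of_notMem c F hv (by simp only [mem_decode]; tauto), add_zero]

end SteinerJoin

/-! ### Renumbering the subsets of `A` and assembling the convolution from products. -/

namespace SteinerJoin

/-- The number of elements below `v` of the set coded by `A`. -/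
def below (A v : ℕ) : ℕ := Nat.count (fun u => A.testBit u = true) v

/-- The code of the subset of the first `v` bits of `A` whose members are numbered by the bits of
`j`. -/
def dep (A : ℕ) : ℕ → ℕ → ℕ
  | 0, _ => 0
  | v + 1, j => dep A v j + if A.testBit v = true ∧ j.testBit (below A v) = true then 2 ^ v else 0

theorem below_zero (A : ℕ) : below A 0 = 0 := Nat.count_zero _

theorem below_succ (A v : ℕ) :
    below A (v + 1) = below A v + if A.testBit v = true then 1 else 0 := Nat.count_succ _ _

theorem below_mono (A : ℕ) {u v : ℕ} (h : u ≤ v) : below A u ≤ below A v := Nat.count_monotone _ h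

theorem below_le (A v : ℕ) : below A v ≤ v := Nat.count_le _

theorem dep_lt (A v j : ℕ) : dep A v j < 2 ^ v := by
  induction v with
  | zero => simp [dep]
  | succ v ih =>
    rw [dep, pow_succ]
    split_ifs <;> omega

theorem testBit_dep (A v j u : ℕ) : (dep A v j).testBit u = true ↔
    u < v ∧ A.testBit u = true ∧ j.testBit (below A u) = true := by
  induction v with
  | zero => simp [dep]
  | succ v ih =>
    rw [dep]
    split_ifs with h
    · rw [add_comm, testBit_two_pow_add (dep_lt A v j), Bool.or_eq_true, ih, decide_eq_true_eq]
      constructor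
      · rintro (rfl | h')
        · exact ⟨by omega, h⟩
        · exact ⟨by omega, h'.2⟩
      · rintro ⟨h1, h2⟩
        rcases Nat.lt_succ_iff_lt_or_eq.1 h1 with h1 | h1
        · exact Or.inr ⟨h1, h2⟩
        · exact Or.inl h1
    · rw [add_zero, ih]
      constructor
      · rintro ⟨h1, h2⟩; exact ⟨by omega, h2⟩
      · rintro ⟨h1, h2⟩
        refine ⟨?_, h2⟩
        rcases Nat.lt_succ_iff_lt_or_eq.1 h1 with h1 | rfl
        · exact h1
        · exact (h h2).elim

theorem dep_succ_of_lt {A v j : ℕ} (hj : j < 2 ^ below A v) : dep A (v + 1) j = dep A v j := by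
  rw [dep, Nat.testBit_lt_two_pow hj]; simp

/-- The bit added to `j` is the one belonging to the new element `v` of `A`; the elements below `v`
are numbered by strictly smaller bits and do not see it. -/
theorem dep_succ_add {A v j : ℕ} (hA : A.testBit v = true) (hj : j < 2 ^ below A v) :
    dep A (v + 1) (j + 2 ^ below A v) = dep A v j + 2 ^ v := by
  rw [dep, add_comm j, testBit_two_pow_add hj]
  simp only [hA, decide_true, Bool.true_or, and_self, if_true]
  congr 1
  refine Nat.eq_of_testBit_eq fun u => ?_
  rw [Bool.eq_iff_iff, testBit_dep, testBit_dep]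
  refine and_congr_right fun hu => and_congr_right fun hAu => ?_
  have : below A u < below A v := by
    have := below_mono A (show u + 1 ≤ v from hu)
    rw [below_succ, if_pos hAu] at this
    omega
  rw [testBit_two_pow_add hj]
  simp [this.ne]

theorem below_eq_card (A tw v : ℕ) (hv : v ≤ tw) :
    below A v = ((decode tw A).filter fun u : Fin tw => (u : ℕ) < v).card := by
  rw [below, Nat.count_eq_card_filter_range]
  symm
  refine Finset.card_bij (fun u _ => (u : ℕ)) ?_ ?_ ?_
  · intro u hu
    simp only [Finset.mem_filter, mem_decode, Finset.mem_range] at hu ⊢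
    tauto
  · intro u _ w _ h; exact Fin.ext h
  · intro u hu
    simp only [Finset.mem_filter, Finset.mem_range] at hu
    exact ⟨⟨u, by omega⟩, by simp [mem_decode, hu.1, hu.2], rfl⟩

theorem below_top (A tw : ℕ) : below A tw = (decode tw A).card := by
  rw [below_eq_card A tw tw le_rfl, Finset.filter_true_of_mem fun u _ => u.2]

section
variable (tw A : ℕ)

/-- The increasing enumeration of the set coded by `A`. -/
def enum : Fin (below A tw) ↪o Fin tw := (decode tw A).orderEmbOfFin (below_top A tw).symm

theorem enum_mem (i : Fin (below A tw)) : enum tw A i ∈ decode tw A :=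
  Finset.orderEmbOfFin_mem _ _ _

theorem exists_enum {u : Fin tw} (hu : u ∈ decode tw A) : ∃ i, enum tw A i = u := by
  have h := Finset.range_orderEmbOfFin (decode tw A) (below_top A tw).symm
  have : u ∈ Set.range (enum tw A) := by rw [enum, h]; exact hu
  exact this

theorem below_enum (i : Fin (below A tw)) : below A (enum tw A i) = i := by
  rw [below_eq_card A tw _ (enum tw A i).2.le]
  have : (decode tw A).filter (fun u : Fin tw => (u : ℕ) < enum tw A i) =
      (Finset.univ.filter fun k : Fin (below A tw) => k < i).map (enum tw A).toEmbedding := by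
    ext u
    simp only [Finset.mem_filter, Finset.mem_map, Finset.mem_univ, true_and,
      RelEmbedding.coe_toEmbedding]
    constructor
    · rintro ⟨h1, h2⟩
      obtain ⟨k, rfl⟩ := exists_enum tw A h1
      exact ⟨k, (enum tw A).lt_iff_lt.1 h2, rfl⟩
    · rintro ⟨k, hk, rfl⟩
      exact ⟨enum_mem tw A k, (enum tw A).lt_iff_lt.2 hk⟩
  rw [this, Finset.card_map, ← Fin.card_Iio i]
  congr 1
  ext k
  simp

/-- A set of indices as a subset of the set coded by `A`. -/
def lift (B : Finset (Fin (below A tw))) : Finset (Fin tw) := B.map (enum tw A).toEmbedding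

/-- `dep` carries out, on codes, the increasing bijection between the indices and the elements of
`A`, since an element of `A` has as its number the count of the members of `A` below it. -/
theorem decode_dep (j : ℕ) : decode tw (dep A tw j) = lift tw A (decode (below A tw) j) := by
  ext u
  rw [mem_decode, testBit_dep, lift, Finset.mem_map]
  simp only [mem_decode, RelEmbedding.coe_toEmbedding]
  constructor
  · rintro ⟨_, h1, h2⟩
    obtain ⟨k, rfl⟩ := exists_enum tw A (mem_decode.2 h1)
    rw [below_enum] at h2
    exact ⟨k, h2, rfl⟩
  · rintro ⟨k, hk, rfl⟩
    exact ⟨(enum tw A k).2, mem_decode.1 (enum_mem tw A k), by rwa [below_enum]⟩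

theorem lift_injective : Function.Injective (lift tw A) := Finset.map_injective _

theorem exists_lift {B : Finset (Fin tw)} (hB : B ⊆ decode tw A) : ∃ B', lift tw A B' = B := by
  have : B ⊆ (Finset.univ : Finset (Fin (below A tw))).map (enum tw A).toEmbedding := by
    intro u hu
    obtain ⟨k, rfl⟩ := exists_enum tw A (hB hu)
    simp
  obtain ⟨B', _, h⟩ := Finset.subset_map_iff.1 this
  exact ⟨B', h.symm⟩

theorem lift_subset (B : Finset (Fin (below A tw))) : lift tw A B ⊆ decode tw A := by
  intro u hu
  obtain ⟨k, _, rfl⟩ := Finset.mem_map.1 hu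
  exact enum_mem tw A k

/-- An order embedding preserves inversions, so the convolution at `A` may be computed in the index
set of `A`. -/
theorem sign_lift (B C : Finset (Fin (below A tw))) : sign (lift tw A B) (lift tw A C) = sign B C := by
  simp only [sign_eq_prod, lift, Finset.prod_map, RelEmbedding.coe_toEmbedding, OrderEmbedding.lt_iff_lt]

theorem sum_splits_lift (B : Finset (Fin (below A tw))) (φ : Finset (Fin tw) → Finset (Fin tw) → ℤ) :
    ∑ p ∈ splits (lift tw A B), φ p.1 p.2 = ∑ p ∈ splits B, φ (lift tw A p.1) (lift tw A p.2) := by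
  symm
  refine Finset.sum_bij (fun p _ => (lift tw A p.1, lift tw A p.2)) ?_ ?_ ?_ ?_
  · intro p hp
    rw [mem_splits] at hp ⊢
    exact ⟨by rw [← hp.1, lift, lift, lift, Finset.map_union],
      (Finset.disjoint_map _).2 hp.2⟩
  · intro p _ q _ h
    exact Prod.ext (lift_injective tw A (congrArg Prod.fst h)) (lift_injective tw A (congrArg Prod.snd h))
  · rintro ⟨X, Y⟩ hp
    rw [mem_splits] at hp
    obtain ⟨X', _, hX⟩ := Finset.subset_map_iff.1 (show X ⊆ lift tw A B from
      hp.1 ▸ Finset.subset_union_left)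
    obtain ⟨Y', _, hY⟩ := Finset.subset_map_iff.1 (show Y ⊆ lift tw A B from
      hp.1 ▸ Finset.subset_union_right)
    have hX : X = lift tw A X' := hX
    have hY : Y = lift tw A Y' := hY
    subst hX hY
    refine ⟨(X', Y'), ?_, rfl⟩
    rw [mem_splits]
    refine ⟨lift_injective tw A ?_, (Finset.disjoint_map _).1 hp.2⟩
    rw [← hp.1, lift, lift, lift, Finset.map_union]
  · intro p _; rfl

end

/-- The part of degree `k` and rank `r` of a table at the set coded by `A`; `c` governs a change of
signs. -/
def part (tw A : ℕ) (f : ℕ → Finset (Fin tw) → Finset (Fin tw) → Finset (Fin tw) → ℤ) (c k r : ℕ)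
    (B C : Finset (Fin (below A tw))) : ℤ :=
  (if C.card = r then 1 else 0) * f k (decode tw A) (lift tw A B) (lift tw A C) *
    (-1) ^ (c * (B.card + r))

/-- The contribution of the parts of degrees `k₁`, `k₂` and ranks `r₁`, `r₂` to the convolution. -/
def contrib (tw A : ℕ) (f g : ℕ → Finset (Fin tw) → Finset (Fin tw) → Finset (Fin tw) → ℤ)
    (k₁ k₂ r₁ r₂ : ℕ) (B C : Finset (Fin (below A tw))) : ℤ :=
  (if C.card = r₁ + r₂ then 1 else 0) *
    fock (-1) (fun T S => ∑ R, fock 1 (part tw A f 0 k₁ r₁) T R * fock 1 (part tw A g r₁ k₂ r₂) R S)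
      B C

section
variable {tw : ℕ} (A : ℕ) (f g : ℕ → Finset (Fin tw) → Finset (Fin tw) → Finset (Fin tw) → ℤ)

/-- `fock_mul_fock` yields `sign q.2 q.1` instead of `sign q.1 q.2`, together with `(-1) ^ (|p.2| *
r₁)`. Exchanging the arguments of the sign costs `(-1) ^ (r₁ * r₂)`, and the sign `(-1) ^ (r₁ *
(|p.2| + r₂))` built into the second `part` cancels both. -/
theorem contrib_eq (k₁ k₂ r₁ r₂ : ℕ) (B C : Finset (Fin (below A tw))) :
    contrib tw A f g k₁ k₂ r₁ r₂ B C = ∑ p ∈ splits B, ∑ q ∈ splits C,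
      if q.1.card = r₁ ∧ q.2.card = r₂ then
        f k₁ (decode tw A) (lift tw A p.1) (lift tw A q.1) *
        g k₂ (decode tw A) (lift tw A p.2) (lift tw A q.2) * sign p.1 p.2 * sign q.1 q.2 else 0 := by
  unfold contrib
  have rank : ∀ (f : ℕ → Finset (Fin tw) → Finset (Fin tw) → Finset (Fin tw) → ℤ) (c k r : ℕ)
      (B C : Finset (Fin (below A tw))), part tw A f c k r B C ≠ 0 → C.card = r := by
    intro f c k r B C h
    by_contra hne
    simp [part, hne] at h
  split_ifs with hC
  · rw [one_mul, fock_mul_fock (rank f 0 k₁ r₁) (rank g r₁ k₂ r₂) hC]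
    refine Finset.sum_congr rfl fun p _ => Finset.sum_congr rfl fun q hq => ?_
    unfold part
    by_cases h1 : q.1.card = r₁
    swap
    · simp [h1]
    by_cases h2 : q.2.card = r₂
    swap
    · simp [h2]
    rw [if_pos h1, if_pos h2, if_pos ⟨h1, h2⟩]
    have hd := (mem_splits.1 hq).2
    have hs := sign_mul_sign_comm q.1 q.2
    rw [Finset.disjoint_iff_inter_eq_empty.1 hd, Finset.card_empty, pow_zero, mul_one, h1, h2] at hs
    have hs' : sign q.2 q.1 = sign q.1 q.2 * (-1) ^ (r₁ * r₂) := by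
      rw [← hs]
      linear_combination (-sign q.2 q.1) * sign_mul_self q.1 q.2
    have e : ((-1 : ℤ)) ^ (r₁ * (p.2.card + r₂)) * (-1) ^ (r₁ * r₂) * (-1) ^ (p.2.card * r₁) = 1 := by
      rw [← pow_add, ← pow_add, show r₁ * (p.2.card + r₂) + r₁ * r₂ + p.2.card * r₁ =
        2 * (r₁ * (p.2.card + r₂)) by ring, pow_mul]
      simp
    rw [hs', h1, Nat.zero_mul, pow_zero]
    linear_combination (f k₁ (decode tw A) (lift tw A p.1) (lift tw A q.1) *
        g k₂ (decode tw A) (lift tw A p.2) (lift tw A q.2) * sign p.1 p.2 * sign q.1 q.2) * e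
  · rw [zero_mul]
    symm
    refine Finset.sum_eq_zero fun p _ => Finset.sum_eq_zero fun q hq => if_neg fun h => hC ?_
    rw [← h.1, ← h.2, ← (mem_splits.1 hq).1, Finset.card_union_of_disjoint (mem_splits.1 hq).2]

/-- Every pair of splittings has exactly one pair of ranks, so summing over the ranks removes the
restriction on them; degrees above `n` contribute nothing by admissibility. -/
theorem sum_contrib {n b : ℕ} (hf : Admissible n b f) (hg : Admissible n b g) (i : ℕ)
    (B C : Finset (Fin (below A tw))) :
    ∑ k₁ ∈ Finset.range (n + 1), ∑ k₂ ∈ Finset.range (n + 1), ∑ r₁ ∈ Finset.range (tw + 1),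
      ∑ r₂ ∈ Finset.range (tw + 1),
        (if k₁ + k₂ = i + below A tw then contrib tw A f g k₁ k₂ r₁ r₂ B C else 0) =
      conv f g i (decode tw A) (lift tw A B) (lift tw A C) := by
  -- the sum over the ranks
  have ranks : ∀ k₁ k₂, ∑ r₁ ∈ Finset.range (tw + 1), ∑ r₂ ∈ Finset.range (tw + 1),
      contrib tw A f g k₁ k₂ r₁ r₂ B C = ∑ p ∈ splits B, ∑ q ∈ splits C,
        f k₁ (decode tw A) (lift tw A p.1) (lift tw A q.1) *
        g k₂ (decode tw A) (lift tw A p.2) (lift tw A q.2) * sign p.1 p.2 * sign q.1 q.2 := by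
    intro k₁ k₂
    simp only [contrib_eq]
    have hle : ∀ q : Finset (Fin (below A tw)), q.card < tw + 1 := fun q =>
      Nat.lt_succ_of_le ((Finset.card_le_univ q).trans (by simpa using below_le A tw))
    rw [Finset.sum_congr rfl fun r₁ _ => Finset.sum_comm, Finset.sum_comm]
    refine Finset.sum_congr rfl fun p _ => ?_
    rw [Finset.sum_congr rfl fun r₁ _ => Finset.sum_comm, Finset.sum_comm]
    refine Finset.sum_congr rfl fun q _ => ?_
    rw [Finset.sum_eq_single q.1.card, Finset.sum_eq_single q.2.card, if_pos ⟨rfl, rfl⟩]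
    · intro r _ hr; exact if_neg fun h => hr h.2.symm
    · intro h; exact (h (Finset.mem_range.2 (hle _))).elim
    · intro r _ hr; exact Finset.sum_eq_zero fun _ _ => if_neg fun h => hr h.1.symm
    · intro h; exact (h (Finset.mem_range.2 (hle _))).elim
  set G : ℕ → ℕ → ℤ := fun k₁ k₂ => ∑ p ∈ splits B, ∑ q ∈ splits C,
        f k₁ (decode tw A) (lift tw A p.1) (lift tw A q.1) *
        g k₂ (decode tw A) (lift tw A p.2) (lift tw A q.2) * sign p.1 p.2 * sign q.1 q.2 with hG
  have G0 : ∀ k₁ k₂, ¬(k₁ < n + 1 ∧ k₂ < n + 1) → G k₁ k₂ = 0 := by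
    intro k₁ k₂ h
    refine Finset.sum_eq_zero fun p _ => Finset.sum_eq_zero fun q _ => ?_
    by_cases h1 : k₁ < n + 1
    · have : g k₂ (decode tw A) (lift tw A p.2) (lift tw A q.2) = 0 := by
        by_contra hne
        have := ((hg k₂ _ _ _).1 hne).1
        omega
      rw [this]; ring
    · have : f k₁ (decode tw A) (lift tw A p.1) (lift tw A q.1) = 0 := by
        by_contra hne
        have := ((hf k₁ _ _ _).1 hne).1
        omega
      rw [this]; ring
  have lhs : ∀ k₁ k₂, ∑ r₁ ∈ Finset.range (tw + 1), ∑ r₂ ∈ Finset.range (tw + 1),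
      (if k₁ + k₂ = i + below A tw then contrib tw A f g k₁ k₂ r₁ r₂ B C else 0) =
      if k₁ + k₂ = i + below A tw then G k₁ k₂ else 0 := by
    intro k₁ k₂
    split_ifs
    · exact ranks k₁ k₂
    · simp
  simp only [lhs]
  have rhs : conv f g i (decode tw A) (lift tw A B) (lift tw A C) =
      ∑ k ∈ Finset.HasAntidiagonal.antidiagonal (i + below A tw), G k.1 k.2 := by
    unfold conv
    rw [below_top]
    refine Finset.sum_congr rfl fun k _ => ?_
    rw [sum_splits_lift tw A B fun X Y => ∑ q ∈ splits (lift tw A C),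
      f k.1 (decode tw A) X q.1 * g k.2 (decode tw A) Y q.2 * sign X Y * sign q.1 q.2]
    refine Finset.sum_congr rfl fun p _ => ?_
    rw [sum_splits_lift tw A C fun X Y => f k.1 (decode tw A) (lift tw A p.1) X *
      g k.2 (decode tw A) (lift tw A p.2) Y * sign (lift tw A p.1) (lift tw A p.2) * sign X Y]
    simp only [sign_lift]
  rw [rhs, ← Finset.sum_product', ← Finset.sum_filter]
  refine Finset.sum_subset_zero_on_sdiff ?_ ?_ fun _ _ => rfl
  · intro k hk
    simp only [Finset.mem_filter] at hk
    exact Finset.HasAntidiagonal.mem_antidiagonal.2 hk.2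
  · intro k hk
    simp only [Finset.mem_sdiff, Finset.HasAntidiagonal.mem_antidiagonal, Finset.mem_filter, Finset.mem_product,
      Finset.mem_range, not_and] at hk
    exact G0 _ _ fun h => hk.2 h hk.1

/-- The program never writes to the cells of triples with `B ⊈ A` or `C ⊈ A`; this shows that their
initial value `0` is correct. -/
theorem conv_eq_zero {n b : ℕ} (hf : Admissible n b f) (hg : Admissible n b g) {i : ℕ}
    {X B C : Finset (Fin tw)} (h : ¬(B ⊆ X ∧ C ⊆ X)) : conv f g i X B C = 0 := by
  refine Finset.sum_eq_zero fun k _ => Finset.sum_eq_zero fun p hp => Finset.sum_eq_zero fun q hq => ?_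
  by_contra hne
  refine h ?_
  have h1 := ((hf _ _ _ _).1 (left_ne_zero_of_mul (left_ne_zero_of_mul (left_ne_zero_of_mul hne)))).2
  have h2 := ((hg _ _ _ _).1 (right_ne_zero_of_mul (left_ne_zero_of_mul (left_ne_zero_of_mul hne)))).2
  rw [Finset.union_subset_iff] at h1 h2
  rw [mem_splits] at hp hq
  rw [← hp.1, ← hq.1]
  exact ⟨Finset.union_subset h1.1 h2.1, Finset.union_subset h1.2 h2.2⟩

end
end SteinerJoin

/-! ### Extracting matrices from the tables and transforming them in place. -/

namespace SteinerJoin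
open RAM

/-- The quotients still contain the higher digits of the address, but `decode tw` only looks at the
lowest `tw` bits. -/
theorem layout_addr {tw : ℕ} (f : ℕ → Finset (Fin tw) → Finset (Fin tw) → Finset (Fin tw) → ℤ)
    (k : ℕ) {A B C : ℕ} (hA : A < 2 ^ tw) (hB : B < 2 ^ tw) (hC : C < 2 ^ tw) :
    layout f ((k * (2 ^ tw * 2 ^ tw * 2 ^ tw) + A * (2 ^ tw * 2 ^ tw) + B * 2 ^ tw + C : ℕ) : ℤ) =
      f k (decode tw A) (decode tw B) (decode tw C) := by
  have h4 : 4 ^ tw = 2 ^ tw * 2 ^ tw := by rw [← mul_pow]; norm_num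
  have h8 : 8 ^ tw = 2 ^ tw * 2 ^ tw * 2 ^ tw := by rw [← mul_pow, ← mul_pow]; norm_num
  rw [layout, if_neg (by omega), Int.toNat_natCast, h4, h8]
  set W := 2 ^ tw with hW
  have hW0 : 0 < W := by positivity
  have e1 : (k * (W * W * W) + A * (W * W) + B * W + C) / W = k * (W * W) + A * W + B := by
    rw [show k * (W * W * W) + A * (W * W) + B * W + C = C + W * (k * (W * W) + A * W + B) by ring,
      Nat.add_mul_div_left _ _ hW0, Nat.div_eq_of_lt hC, zero_add]
  have e2 : (k * (W * W * W) + A * (W * W) + B * W + C) / (W * W) = k * W + A := by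
    rw [← Nat.div_div_eq_div_mul, e1, show k * (W * W) + A * W + B = B + W * (k * W + A) by ring,
      Nat.add_mul_div_left _ _ hW0, Nat.div_eq_of_lt hB, zero_add]
  have e3 : (k * (W * W * W) + A * (W * W) + B * W + C) / (W * W * W) = k := by
    rw [← Nat.div_div_eq_div_mul, e2, show k * W + A = A + W * k by ring,
      Nat.add_mul_div_left _ _ hW0, Nat.div_eq_of_lt hA, zero_add]
  rw [e1, e2, e3, hW, decode_add_mul,
    show k * (2 ^ tw * 2 ^ tw) + A * 2 ^ tw + B = (k * 2 ^ tw + A) * 2 ^ tw + B by ring,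
    decode_add_mul, show k * (2 ^ tw * 2 ^ tw * 2 ^ tw) + A * (2 ^ tw * 2 ^ tw) + B * 2 ^ tw + C =
      (k * (2 ^ tw * 2 ^ tw) + A * 2 ^ tw + B) * 2 ^ tw + C by ring, decode_add_mul]

theorem div_mod_two (j v : ℕ) : (j : ℤ) / (2 ^ v : ℕ) % 2 = if j.testBit v = true then 1 else 0 := by
  rw [Nat.testBit_eq_decide_div_mod_eq]
  have : (j : ℤ) / (2 ^ v : ℕ) % 2 = ((j / 2 ^ v % 2 : ℕ) : ℤ) := by push_cast; rfl
  rw [this]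
  rcases Nat.mod_two_eq_zero_or_one (j / 2 ^ v) with h | h <;> simp [h]

/-- The variables describing the current product: the set `A`, its size, the size of the matrices,
the degrees and ranks, and the tables of codes of subsets of `A` and of their numbers of elements. -/
structure Env (tw A k₁ k₂ r₁ r₂ : ℕ) (s : State) : Prop where
  size : s 7 0 = ((2 ^ below A tw : ℕ) : ℤ)
  set : s 8 0 = (A : ℤ)
  base : s 9 0 = ((2 ^ tw : ℕ) : ℤ)
  deg₁ : s 10 0 = (k₁ : ℤ)
  rank₁ : s 11 0 = (r₁ : ℤ)
  deg₂ : s 12 0 = (k₂ : ℤ)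
  rank₂ : s 13 0 = (r₂ : ℤ)
  code : ∀ j < 2 ^ below A tw, s 14 (j : ℕ) = dep A tw j
  count : ∀ j < 2 ^ below A tw, s 15 (j : ℕ) = pc tw j
  card : s 19 0 = (below A tw : ℤ)

theorem Env.congr {tw A k₁ k₂ r₁ r₂ : ℕ} {s s' : State} (h : Env tw A k₁ k₂ r₁ r₂ s)
    (hs : ∀ b, 7 ≤ b ∧ b ≤ 15 ∨ b = 19 → s' b = s b) : Env tw A k₁ k₂ r₁ r₂ s' := by
  constructor
  · rw [hs 7 (by omega)]; exact h.size
  · rw [hs 8 (by omega)]; exact h.set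
  · rw [hs 9 (by omega)]; exact h.base
  · rw [hs 10 (by omega)]; exact h.deg₁
  · rw [hs 11 (by omega)]; exact h.rank₁
  · rw [hs 12 (by omega)]; exact h.deg₂
  · rw [hs 13 (by omega)]; exact h.rank₂
  · rw [hs 14 (by omega)]; exact h.code
  · rw [hs 15 (by omega)]; exact h.count
  · rw [hs 19 (by omega)]; exact h.card

/-- The row of the entry whose number is the variable `4`. -/
def row : Expr := var 4 / var 7
/-- The column of the entry whose number is the variable `4`. -/
def col : Expr := var 4 % var 7

/-- The address of the value of degree `k` at `A` and the current row and column. -/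
abbrev addr (k : Expr) : Expr :=
  k * (var 9 * var 9 * var 9) + var 8 * (var 9 * var 9) + .read 14 row * var 9 + .read 14 col

/-- The current entry of the matrix of the part of degree `k` and rank `r` of the table `src`. -/
def gatherEntry (src : ℕ) (k r c : Expr) : Expr :=
  .op .eq (.read 15 col) r * .read src (addr k) * (1 - 2 * ((c * (.read 15 row + r)) % 2))

/-- Extract the matrix of the part of degree `k` and rank `r` of the table `src`. -/
def gather (dst src : ℕ) (k r c : Expr) : Prog :=
  forLoop 4 (var 7 * var 7) <| .assign dst (var 4) <| gatherEntry src k r c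

theorem row_lt {a x : ℕ} (hx : x < 2 ^ a * 2 ^ a) : x / 2 ^ a < 2 ^ a :=
  Nat.div_lt_of_lt_mul hx

theorem col_lt {a x : ℕ} : x % 2 ^ a < 2 ^ a := Nat.mod_lt _ (by positivity)

section
variable {tw A k₁ k₂ r₁ r₂ : ℕ} {σ : State}

theorem Env.eval_row (h : Env tw A k₁ k₂ r₁ r₂ σ) {x : ℕ} (hx : σ 4 0 = x) :
    row.eval σ = ((x / 2 ^ below A tw : ℕ) : ℤ) := by
  simp only [row, eval_div, eval_read, eval_zero, hx, h.size]
  push_cast; rfl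

theorem Env.eval_col (h : Env tw A k₁ k₂ r₁ r₂ σ) {x : ℕ} (hx : σ 4 0 = x) :
    col.eval σ = ((x % 2 ^ below A tw : ℕ) : ℤ) := by
  simp only [col, eval_mod, eval_read, eval_zero, hx, h.size]
  push_cast; rfl

/-- The address computed by `addr`. -/
def place (tw A k x : ℕ) : ℕ :=
  k * (2 ^ tw * 2 ^ tw * 2 ^ tw) + A * (2 ^ tw * 2 ^ tw) +
    dep A tw (x / 2 ^ below A tw) * 2 ^ tw + dep A tw (x % 2 ^ below A tw)

theorem Env.eval_addr (h : Env tw A k₁ k₂ r₁ r₂ σ) {x : ℕ} (hx : σ 4 0 = x)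
    (hx' : x < 2 ^ below A tw * 2 ^ below A tw) {e : Expr} {k : ℕ} (he : e.eval σ = k) :
    (addr e).eval σ = (place tw A k x : ℕ) := by
  have d1 : (Expr.read 14 row).eval σ = dep A tw (x / 2 ^ below A tw) := by
    rw [eval_read, h.eval_row hx, h.code _ (row_lt hx')]
  have d2 : (Expr.read 14 col).eval σ = dep A tw (x % 2 ^ below A tw) := by
    rw [eval_read, h.eval_col hx, h.code _ col_lt]
  have v8 : (var 8).eval σ = A := h.set
  have v9 : (var 9).eval σ = (2 ^ tw : ℕ) := h.base
  simp only [addr, eval_add, eval_mul, he, v8, v9, d1, d2, place]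
  push_cast
  ring

theorem Env.layout_place {f : ℕ → Finset (Fin tw) → Finset (Fin tw) → Finset (Fin tw) → ℤ}
    (hA : A < 2 ^ tw) (k x : ℕ) : layout f (place tw A k x : ℕ) =
      f k (decode tw A) (lift tw A (decode (below A tw) (x / 2 ^ below A tw)))
        (lift tw A (decode (below A tw) (x % 2 ^ below A tw))) := by
  rw [place, layout_addr f k hA (dep_lt A tw _) (dep_lt A tw _), decode_dep, decode_dep]

/-- The number `x` as a pair of subsets of the index set. -/
abbrev atEntry {a : ℕ} (F : Finset (Fin a) → Finset (Fin a) → ℤ) (x : ℕ) : ℤ :=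
  F (decode a (x / 2 ^ a)) (decode a (x % 2 ^ a))

theorem bits_lt {x : ℤ} {e L : ℕ} (h : |x| ≤ 2 ^ e) (he : e < L) : bits x ≤ L :=
  bits_le_iff.2 (h.trans_lt (pow_lt_pow_right₀ (by norm_num) he))

theorem bits_natCast_le {x L : ℕ} (h : x < 2 ^ L) : bits (x : ℤ) ≤ L :=
  bits_le_iff.2 (by rw [abs_of_nonneg (by positivity)]; exact_mod_cast h)

theorem abs_part_le {f : ℕ → Finset (Fin tw) → Finset (Fin tw) → Finset (Fin tw) → ℤ} {b : ℕ}
    (hf : ∀ i A B C, bits (f i A B C) ≤ b) (c k r : ℕ) (B C : Finset (Fin (below A tw))) :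
    |part tw A f c k r B C| ≤ 2 ^ b := by
  have := (bits_le_iff.1 (hf k (decode tw A) (lift tw A B) (lift tw A C))).le
  rw [part, abs_mul, abs_pow, abs_neg, abs_one, one_pow, mul_one]
  split_ifs
  · simpa using this
  · simp

theorem runs_gather {f : ℕ → Finset (Fin tw) → Finset (Fin tw) → Finset (Fin tw) → ℤ}
    {b L : ℕ} (hf : ∀ i A B C, bits (f i A B C) ≤ b) (hA : A < 2 ^ tw) (hb : b < L)
    (hL : 2 * tw < L) {dst src : ℕ} {k r c : Expr} {kv rv cv : ℕ} {s : State} (hs : Small L s)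
    (hE : Env tw A k₁ k₂ r₁ r₂ s) (hd : dst = 16 ∨ dst = 17) (hsrc : src = 1 ∨ src = 2)
    (hsrc' : s src = layout f)
    (hdec : 3 + (gatherEntry src k r c).len ≤ 1000 ∧ (gatherEntry src k r c).low = true)
    (hk : ∀ σ, Env tw A k₁ k₂ r₁ r₂ σ → k.eval σ = kv) (hr : ∀ σ, Env tw A k₁ k₂ r₁ r₂ σ → r.eval σ = rv)
    (hc : ∀ σ, Env tw A k₁ k₂ r₁ r₂ σ → c.eval σ = cv) :
    ∃ s', Runs (gather dst src k r c) s s'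
        ((3 * (2 ^ below A tw * 2 ^ below A tw) + 2) * unit L) ∧ Small L s' ∧
      (∀ x < 2 ^ below A tw * 2 ^ below A tw, s' dst (x : ℕ) = atEntry (part tw A f cv kv rv) x) ∧
      ∀ b, b ≠ dst → b ≠ 4 → s' b = s b := by
  have ha := below_le A tw
  obtain ⟨s', h1, h2, h3, h4⟩ := runs_table (L := L) (v := 4) (a := dst) (m := var 7 * var 7)
    (e := gatherEntry src k r c)
    (M := 2 ^ below A tw * 2 ^ below A tw) (atEntry (part tw A f cv kv rv)) (s := s) (by omega)
    ⟨by decide, hdec.1⟩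
    (bits_natCast_le (by
      rw [← pow_add]; exact Nat.pow_lt_pow_right (by norm_num) (by omega)))
    hs (fun _ x _ => bits_lt (abs_part_le hf _ _ _ _ _) hb)
    (fun σ hσ h => by
      have e := hE.congr fun b hb => h b (by omega) (by omega)
      refine ⟨hσ.bdd rfl, ?_⟩
      simp only [eval_mul, eval_read, eval_zero, e.size]
      push_cast; rfl)
    (fun x hx σ hσ hx4 _ h => by
      have e := hE.congr fun b hb => h b (by omega) (by omega)
      refine ⟨hσ.bdd hdec.2, ?_⟩
      have p1 : (Expr.read 15 row).eval σ = pc tw (x / 2 ^ below A tw) := by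
        rw [eval_read, e.eval_row hx4, e.count _ (row_lt hx)]
      have p2 : (Expr.read 15 col).eval σ = pc tw (x % 2 ^ below A tw) := by
        rw [eval_read, e.eval_col hx4, e.count _ col_lt]
      have p3 : (Expr.read src (addr k)).eval σ =
          f kv (decode tw A) (lift tw A (decode (below A tw) (x / 2 ^ below A tw)))
            (lift tw A (decode (below A tw) (x % 2 ^ below A tw))) := by
        rw [eval_read, e.eval_addr hx4 hx (hk σ e), h src (by omega) (by omega), hsrc',
          Env.layout_place hA]
      simp only [gatherEntry, eval_mul, eval_eq, eval_sub, eval_mod, eval_add, eval_one, eval_two,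
        p1, p2, p3, hr σ e, hc σ e]
      rw [atEntry, part, card_decode ha (row_lt hx), card_decode ha col_lt, neg_one_pow_eq]
      push_cast
      simp only [Nat.cast_inj])
  refine ⟨s', h1, h2, fun x hx => ?_, h4⟩
  rw [h3, fillArr_natCast, if_pos hx]

/-- The new value of the current entry of the array `X` when the bit with value `p` (the variable
`6`) is processed. -/
def zetaEntry (X : ℕ) (c : Expr) : Expr :=
  .read X (var 4) + c * (row / var 6 % 2) * (col / var 6 % 2) *
    (1 - 2 * ((.read 15 (row / (var 6 * 2)) + .read 15 (col / (var 6 * 2))) % 2)) *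
    .read X (var 4 - var 6 * (var 7 + 1))

/-- Compute the transform `fock` of the matrix in the array `X` in place. -/
def zeta (X : ℕ) (c : Expr) : Prog :=
  .seq (.assign 6 0 1) <| forLoop 5 (var 19) <|
    .seq (forLoop 4 (var 7 * var 7) (.assign X (var 4) (zetaEntry X c))) (.assign 6 0 (var 6 * 2))

/-- One stage of the transform. A single array suffices: an entry only needs its own old value and
one entry that this stage does not alter. -/
theorem runs_zeta_bit {F : Finset (Fin (below A tw)) → Finset (Fin (below A tw)) → ℤ} {e L v X : ℕ}
    {c : ℤ} {ce : Expr} (hc : |c| = 1) (hF : ∀ T S, |F T S| ≤ 2 ^ e) (heL : e + tw < L)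
    (hL : 2 * tw < L) (hv : v < below A tw) (hX : X = 16 ∨ X = 17 ∨ X = 18) {s : State}
    (hs : Small L s) (hE : Env tw A k₁ k₂ r₁ r₂ s)
    (hdec : 3 + (zetaEntry X ce).len ≤ 1000 ∧ (zetaEntry X ce).low = true)
    (hce : ∀ σ, ce.eval σ = c) (hp : s 6 0 = (2 ^ v : ℕ))
    (hs' : ∀ x < 2 ^ below A tw * 2 ^ below A tw, s X (x : ℕ) = atEntry (fockBelow c F v) x) :
    ∃ s', Runs (forLoop 4 (var 7 * var 7) (.assign X (var 4) (zetaEntry X ce))) s s'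
        ((3 * (2 ^ below A tw * 2 ^ below A tw) + 2) * unit L) ∧ Small L s' ∧
      (∀ x < 2 ^ below A tw * 2 ^ below A tw, s' X (x : ℕ) = atEntry (fockBelow c F (v + 1)) x) ∧
      ∀ b, b ≠ X → b ≠ 4 → s' b = s b := by
  have ha := below_le A tw
  obtain ⟨s', h1, h2, h3, h4⟩ := runs_table (L := L) (v := 4) (a := X) (m := var 7 * var 7)
    (e := zetaEntry X ce) (M := 2 ^ below A tw * 2 ^ below A tw) (atEntry (fockBelow c F (v + 1)))
    (s := s) (by omega) ⟨by decide, hdec.1⟩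
    (bits_natCast_le (by
      rw [← pow_add]; exact Nat.pow_lt_pow_right (by norm_num) (by omega)))
    hs (fun _ x _ => bits_lt (e := e + tw) ((abs_fockBelow_le hc hF hv _ _).trans (by
      rw [← pow_add]; exact pow_le_pow_right₀ (by norm_num) (by omega))) heL)
    (fun σ hσ h => by
      have e := hE.congr fun b hb => h b (by omega) (by omega)
      refine ⟨hσ.bdd rfl, ?_⟩
      simp only [eval_mul, eval_read, eval_zero, e.size]
      push_cast; rfl)
    (fun x hx σ hσ hx4 hσX h => by
      have e := hE.congr fun b hb => h b (by omega) (by omega)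
      refine ⟨hσ.bdd hdec.2, ?_⟩
      have hj := row_lt hx
      have hl : x % 2 ^ below A tw < 2 ^ below A tw := col_lt
      have v6 : (var 6).eval σ = (2 ^ v : ℕ) := by
        rw [← hp, ← h 6 (by omega) (by omega)]; rfl
      have v7 : (var 7).eval σ = (2 ^ below A tw : ℕ) := e.size
      have v4 : (var 4).eval σ = x := hx4
      have p1 : (Expr.read 15 (row / (var 6 * 2))).eval σ =
          pc tw (x / 2 ^ below A tw / 2 ^ (v + 1)) := by
        rw [eval_read, eval_div, eval_mul, e.eval_row hx4, v6, eval_two,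
          ← e.count _ ((Nat.div_le_self _ _).trans_lt hj)]
        congr 1
      have p2 : (Expr.read 15 (col / (var 6 * 2))).eval σ =
          pc tw (x % 2 ^ below A tw / 2 ^ (v + 1)) := by
        rw [eval_read, eval_div, eval_mul, e.eval_col hx4, v6, eval_two,
          ← e.count _ ((Nat.div_le_self _ _).trans_lt hl)]
        congr 1
      have p3 : (Expr.read X (var 4)).eval σ = atEntry (fockBelow c F v) x := by
        rw [eval_read, v4, hσX, fillArr_natCast, if_neg (lt_irrefl x), hs' x hx]
      have p4 : (row / var 6 % 2).eval σ = if (x / 2 ^ below A tw).testBit v = true then 1 else 0 := by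
        rw [eval_mod, eval_div, e.eval_row hx4, v6, eval_two, div_mod_two]
      have p5 : (col / var 6 % 2).eval σ = if (x % 2 ^ below A tw).testBit v = true then 1 else 0 := by
        rw [eval_mod, eval_div, e.eval_col hx4, v6, eval_two, div_mod_two]
      have p6 : (1 - 2 * ((.read 15 (row / (var 6 * 2)) + .read 15 (col / (var 6 * 2))) % 2) :
          Expr).eval σ = (-1) ^ (pc tw (x / 2 ^ below A tw / 2 ^ (v + 1)) +
            pc tw (x % 2 ^ below A tw / 2 ^ (v + 1))) := by
        rw [eval_sub, eval_mul, eval_mod, eval_add, p1, p2, eval_one, eval_two, neg_one_pow_eq]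
        push_cast; rfl
      have p7 : (Expr.read X (var 4 - var 6 * (var 7 + 1))).eval σ =
          σ X ((x : ℤ) - (2 ^ v : ℕ) * ((2 ^ below A tw : ℕ) + 1)) := by
        rw [eval_read, eval_sub, eval_mul, eval_add, v4, v6, v7, eval_one]
      have ev : (zetaEntry X ce).eval σ = (Expr.read X (var 4)).eval σ + ce.eval σ *
          (row / var 6 % 2).eval σ * (col / var 6 % 2).eval σ *
          (1 - 2 * ((.read 15 (row / (var 6 * 2)) + .read 15 (col / (var 6 * 2))) % 2) :
            Expr).eval σ * (Expr.read X (var 4 - var 6 * (var 7 + 1))).eval σ := rfl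
      rw [ev, p3, hce, p4, p5, p6, p7, atEntry, atEntry, fockBelow_decode_succ ha hj hl hv]
      -- If one of the two bits is missing, the second cell read has a meaningless, possibly
      -- negative, address, but its content is multiplied by `0`.
      by_cases b1 : (x / 2 ^ below A tw).testBit v = true
      swap
      · rw [if_neg b1, if_neg (fun h : _ ∧ _ => b1 h.1)]; ring
      by_cases b2 : (x % 2 ^ below A tw).testBit v = true
      swap
      · rw [if_neg b2, if_neg (fun h : _ ∧ _ => b2 h.2)]; ring
      rw [if_pos b1, if_pos b2, if_pos ⟨b1, b2⟩]
      · set j := x / 2 ^ below A tw with hjd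
        set l := x % 2 ^ below A tw with hld
        have hxjl : x = 2 ^ below A tw * j + l := (Nat.div_add_mod x _).symm
        have q1 := Nat.ge_two_pow_of_testBit b1
        have q2 := Nat.ge_two_pow_of_testBit b2
        obtain ⟨j', hj'⟩ := Nat.exists_eq_add_of_le q1
        obtain ⟨l', hl'⟩ := Nat.exists_eq_add_of_le q2
        have hjj : j - 2 ^ v = j' := by omega
        have hll : l - 2 ^ v = l' := by omega
        have hl'N : l' < 2 ^ below A tw := hll ▸ (Nat.sub_le l _).trans_lt hl
        have hj'N : j' < 2 ^ below A tw := hjj ▸ (Nat.sub_le j _).trans_lt hj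
        have hy : (x : ℤ) - (2 ^ v : ℕ) * ((2 ^ below A tw : ℕ) + 1) =
            (2 ^ below A tw * j' + l' : ℕ) := by
          rw [hxjl, hj', hl']; push_cast; ring
        -- The cell needed comes before `x` and has already been replaced. Since bit `v` is absent
        -- from its row `j'`, its value after stage `v` is the same as before.
        have hyx : 2 ^ below A tw * j' + l' < x := by
          have : 0 < 2 ^ v := by positivity
          have : 2 ^ below A tw * j' ≤ 2 ^ below A tw * j := Nat.mul_le_mul_left _ (by omega)
          omega
        have hyd : (2 ^ below A tw * j' + l') / 2 ^ below A tw = j' := by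
          rw [Nat.mul_add_div (by positivity), Nat.div_eq_of_lt hl'N, add_zero]
        have hym : (2 ^ below A tw * j' + l') % 2 ^ below A tw = l' := by
          rw [Nat.mul_add_mod, Nat.mod_eq_of_lt hl'N]
        rw [hy, hσX, fillArr_natCast, if_pos hyx, atEntry, hyd, hym,
          fockBelow_decode_succ ha hj'N hl'N hv, if_neg, hjj, hll]
        · ring
        · rw [← hjj, testBit_sub_two_pow b1]; simp)
  refine ⟨s', h1, h2, fun x hx => ?_, h4⟩
  rw [h3, fillArr_natCast, if_pos hx]

end

end SteinerJoin

/-! ### The complete transform and the accumulation of the result. -/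

namespace SteinerJoin
open RAM

section
variable {tw A k₁ k₂ r₁ r₂ : ℕ}

theorem two_pow_mul_lt {a L : ℕ} (ha : a ≤ tw) (hL : 2 * tw < L) : 2 ^ a * 2 ^ a < 2 ^ L := by
  rw [← pow_add]; exact Nat.pow_lt_pow_right (by norm_num) (by omega)

theorem runs_zeta {F : Finset (Fin (below A tw)) → Finset (Fin (below A tw)) → ℤ} {e L X : ℕ}
    {c : ℤ} {ce : Expr} (hc : |c| = 1) (hF : ∀ T S, |F T S| ≤ 2 ^ e) (heL : e + tw < L)
    (hL : 2 * tw < L) (hX : X = 16 ∨ X = 17 ∨ X = 18) {s : State}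
    (hs : Small L s) (hE : Env tw A k₁ k₂ r₁ r₂ s)
    (hdec : 3 + (zetaEntry X ce).len ≤ 1000 ∧ (zetaEntry X ce).low = true)
    (hce : ∀ σ, ce.eval σ = c)
    (hs' : ∀ x < 2 ^ below A tw * 2 ^ below A tw, s X (x : ℕ) = atEntry F x) :
    ∃ s', Runs (zeta X ce) s s'
        ((tw + 1) * (3 * (2 ^ below A tw * 2 ^ below A tw) + 5) * unit L) ∧ Small L s' ∧
      (∀ x < 2 ^ below A tw * 2 ^ below A tw, s' X (x : ℕ) = atEntry (fock c F) x) ∧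
      ∀ b, b ≠ X → b ≠ 4 → b ≠ 5 → b ≠ 6 → s' b = s b := by
  have ha := below_le A tw
  have hb1 : bits 1 ≤ L := bits_lt (e := 0) (by simp) (by omega)
  have r0 : Runs (.assign 6 0 1) s (s.write 6 0 1) (unit L) :=
    runs_assign (L := L) (s := s) (a := 6) (i := 0) (e := 1) trivial trivial (by decide)
  have hpow : ∀ v ≤ tw, bits ((2 ^ v : ℕ) : ℤ) ≤ L := fun v hv =>
    bits_natCast_le (Nat.pow_lt_pow_right (by norm_num) (by omega))
  have hbv : ∀ v ≤ tw, bits (v : ℤ) ≤ L := fun v hv =>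
    bits_natCast_le (Nat.lt_two_pow_self.trans_le (Nat.pow_le_pow_right (by norm_num) (by omega)))
  obtain ⟨s', hr, h1, h2, h3, h4, h5⟩ := runs_forLoop (L := L) (v := 5) (m := var 19)
    (p := .seq (forLoop 4 (var 7 * var 7) (.assign X (var 4) (zetaEntry X ce))) (.assign 6 0 (var 6 * 2)))
    (M := below A tw)
    (fun v σ => Small L σ ∧ σ 5 0 = v ∧ σ 6 0 = (2 ^ v : ℕ) ∧
      (∀ x < 2 ^ below A tw * 2 ^ below A tw, σ X (x : ℕ) = atEntry (fockBelow c F v) x) ∧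
      ∀ b, b ≠ X → b ≠ 4 → b ≠ 5 → b ≠ 6 → σ b = s b)
    (fun _ => (3 * (2 ^ below A tw * 2 ^ below A tw) + 3) * unit L) (s := s.write 6 0 1)
    (by decide) (hbv _ ha)
    (by
      rintro x hx σ ⟨h1, h2, -, -, h5⟩
      refine ⟨?_, h1.bdd rfl, h2⟩
      rw [eval_read, eval_zero, h5 19 (by omega) (by omega) (by omega) (by omega), hE.card])
    (by
      refine ⟨(hs.write hb1).write (by simp), by simp, ?_, ?_, ?_⟩
      · rw [State.write_ne _ (by omega), State.write_self]; simp
      · intro x hx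
        rw [State.write_ne _ (by omega), State.write_ne _ (by omega), hs' x hx, atEntry, atEntry,
          fockBelow_zero]
      · intro b _ _ h5 h6
        rw [State.write_ne _ h5, State.write_ne _ h6])
    (by
      rintro v hv σ ⟨h1, h2, h3, h4, h5⟩
      have e := hE.congr fun b hb => h5 b (by omega) (by omega) (by omega) (by omega)
      obtain ⟨σ', r, q1, q2, q3⟩ := runs_zeta_bit hc hF heL hL hv hX h1 e hdec hce h3 h4
      have h6' : σ' 6 0 = (2 ^ v : ℕ) := by rw [q3 6 (by omega) (by omega), h3]
      have ev : (var 6 * 2).eval σ' = (2 ^ (v + 1) : ℕ) := by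
        rw [eval_mul, eval_read, eval_zero, h6', eval_two, pow_succ]; push_cast; rfl
      have r' : Runs (.assign 6 0 (var 6 * 2)) σ' (σ'.write 6 0 (2 ^ (v + 1) : ℕ)) (unit L) := by
        have := runs_assign (L := L) (s := σ') (a := 6) (i := 0) (e := var 6 * 2) trivial
          (q1.bdd rfl) (by decide)
        rwa [ev] at this
      refine ⟨_, (r.seq r').mono (le_of_eq (by ring)), ?_, ?_, ?_, ?_, ?_, ?_⟩
      · rw [State.write_ne _ (by omega), q3 5 (by omega) (by omega), h2]
      · exact (q1.write (hpow _ (by omega))).write (by exact_mod_cast hbv (v + 1) (by omega))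
      · simp
      · rw [State.write_ne _ (by omega), State.write_self]
      · intro x hx
        rw [State.write_ne _ (by omega), State.write_ne _ (by omega), q2 x hx]
      · intro b b1 b2 b3 b4
        rw [State.write_ne _ b3, State.write_ne _ b4, q3 b b1 b2, h5 b b1 b2 b3 b4])
  refine ⟨s', (r0.seq hr).mono ?_, h1, ?_, h5⟩
  · rw [Finset.sum_const, Finset.card_range, smul_eq_mul]
    set U := unit L
    set N := 2 ^ below A tw * 2 ^ below A tw
    calc _ = below A tw * ((3 * N + 5) * U) + 3 * U := by ring
      _ ≤ tw * ((3 * N + 5) * U) + (3 * N + 5) * U :=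
        add_le_add (Nat.mul_le_mul_right _ ha) (Nat.mul_le_mul_right _ (by omega))
      _ = _ := by ring
  · intro x hx
    rw [h4 x hx, atEntry, atEntry, fockBelow_self]

/-- Add the current matrix in the array `18` to the result, if the degree is not negative. -/
def scatter : Prog :=
  forLoop 4 (var 7 * var 7 * (1 - .op .lt (var 10 + var 12) (var 19))) <|
    .assign 3 (addr (var 10 + var 12 - var 19)) <|
      .read 3 (addr (var 10 + var 12 - var 19)) +
        .op .eq (.read 15 col) (var 11 + var 13) * .read 18 (var 4)

/-- What `scatter` adds to the result, given the entries of the matrix. -/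
def scattered (tw A k₁ k₂ r₁ r₂ : ℕ) (Z : ℕ → ℤ) (M : ℕ) (z : ℤ) : ℤ :=
  ∑ x ∈ Finset.range M, if (place tw A (k₁ + k₂ - below A tw) x : ℤ) = z then
    (if pc tw (x % 2 ^ below A tw) = r₁ + r₂ then Z x else 0) else 0

/-- If `k₁ + k₂ < |A|`, the comparison in the loop bound makes the loop empty. The bound `hb` is
demanded for all partial sums because these are the contents of the result array during the loop. -/
theorem runs_scatter {L : ℕ} {Z : ℕ → ℤ} {s : State} (hL : 2 * tw < L)
    (hs : Small L s) (hE : Env tw A k₁ k₂ r₁ r₂ s)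
    (hs' : ∀ x < 2 ^ below A tw * 2 ^ below A tw, s 18 (x : ℕ) = Z x)
    (hb : ∀ M ≤ 2 ^ below A tw * 2 ^ below A tw, ∀ z,
      bits (s 3 z + scattered tw A k₁ k₂ r₁ r₂ Z M z) ≤ L) :
    ∃ s', Runs scatter s s' ((3 * (2 ^ below A tw * 2 ^ below A tw) + 2) * unit L) ∧ Small L s' ∧
      (∀ z, s' 3 z = s 3 z + scattered tw A k₁ k₂ r₁ r₂ Z
        (if below A tw ≤ k₁ + k₂ then 2 ^ below A tw * 2 ^ below A tw else 0) z) ∧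
      ∀ b, b ≠ 3 → b ≠ 4 → s' b = s b := by
  have ha := below_le A tw
  set N := 2 ^ below A tw * 2 ^ below A tw with hN
  set M := if below A tw ≤ k₁ + k₂ then N else 0 with hM
  have hMN : M ≤ N := by rw [hM]; split_ifs <;> omega
  have env : ∀ x Y, Env tw A k₁ k₂ r₁ r₂ (Function.update (s.write 4 0 x) 3 Y) := fun x Y =>
    hE.congr fun b hb => by
      rw [Function.update_of_ne (by omega), State.write_ne _ (by omega)]
  have hv4 : ∀ (x : ℤ) Y, (Function.update (s.write 4 0 x) 3 Y) 4 0 = x := fun x Y => by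
    rw [Function.update_of_ne (by omega), State.write_self]
  obtain ⟨h1, h2⟩ := runs_fill_low (L := L) (v := 4) (a := 3)
    (m := var 7 * var 7 * (1 - .op .lt (var 10 + var 12) (var 19)))
    (i := addr (var 10 + var 12 - var 19))
    (e := .read 3 (addr (var 10 + var 12 - var 19)) +
        .op .eq (.read 15 col) (var 11 + var 13) * .read 18 (var 4)) (M := M)
    (fun x z => s 3 z + scattered tw A k₁ k₂ r₁ r₂ Z x z) (s := s) (by decide)
    (by decide) (bits_natCast_le (hMN.trans_lt (two_pow_mul_lt ha hL))) hs
    (by funext z; simp [scattered]) (fun x hx z => hb x (hx.trans hMN) z)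
    (by
      intro x _
      have e := env x fun z => s 3 z + scattered tw A k₁ k₂ r₁ r₂ Z x z
      simp only [eval_mul, eval_sub, eval_add, eval_lt, eval_one, eval_read, eval_zero, e.size,
        e.deg₁, e.deg₂, e.card]
      rw [hM]
      by_cases h : below A tw ≤ k₁ + k₂
      · rw [if_pos h, if_neg (by omega), hN]; push_cast; ring
      · rw [if_neg h, if_pos (by omega)]; push_cast; ring)
    (by
      intro x hx
      have hk : below A tw ≤ k₁ + k₂ := by
        by_contra h
        rw [hM, if_neg h] at hx
        omega
      have e := env x fun z => s 3 z + scattered tw A k₁ k₂ r₁ r₂ Z x z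
      have h4 := hv4 x fun z => s 3 z + scattered tw A k₁ k₂ r₁ r₂ Z x z
      have h18 : (Function.update (s.write 4 0 x) 3 fun z => s 3 z +
          scattered tw A k₁ k₂ r₁ r₂ Z x z) 18 x = Z x := by
        rw [Function.update_of_ne (by omega), State.write_ne _ (by omega), hs' x (hx.trans_le hMN)]
      have h3 : (Function.update (s.write 4 0 x) 3 fun z => s 3 z +
          scattered tw A k₁ k₂ r₁ r₂ Z x z) 3 = fun z => s 3 z +
          scattered tw A k₁ k₂ r₁ r₂ Z x z := Function.update_self _ _ _
      generalize (Function.update (s.write 4 0 (x : ℤ)) 3 fun z => s 3 z +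
          scattered tw A k₁ k₂ r₁ r₂ Z x z) = σ at e h4 h18 h3 ⊢
      have ei : (addr (var 10 + var 12 - var 19)).eval σ = (place tw A (k₁ + k₂ - below A tw) x : ℕ) :=
        e.eval_addr h4 (hx.trans_le hMN) (by
          simp only [eval_sub, eval_add, eval_read, eval_zero, e.deg₁, e.deg₂, e.card]
          omega)
      have e15 : (Expr.read 15 col).eval σ = pc tw (x % 2 ^ below A tw) := by
        rw [eval_read, e.eval_col h4, e.count _ col_lt]
      have e18 : (Expr.read 18 (var 4)).eval σ = Z x := by
        rw [eval_read, eval_read, eval_zero, h4, h18]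
      have e11 : (var 11 + var 13).eval σ = (r₁ + r₂ : ℕ) := by
        rw [eval_add, eval_read, eval_read, eval_zero, e.rank₁, e.rank₂]; push_cast; rfl
      have ee : (Expr.read 3 (addr (var 10 + var 12 - var 19)) +
          .op .eq (.read 15 col) (var 11 + var 13) * .read 18 (var 4)).eval σ =
          σ 3 ((addr (var 10 + var 12 - var 19)).eval σ) +
          (if (Expr.read 15 col).eval σ = (var 11 + var 13).eval σ then 1 else 0) *
            (Expr.read 18 (var 4)).eval σ := rfl
      rw [ee, e15, e18, e11, ei, h3]
      funext z
      simp only [scattered, Finset.sum_range_succ, Function.update_apply]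
      by_cases hz : z = place tw A (k₁ + k₂ - below A tw) x
      · rw [if_pos hz, if_pos hz.symm, hz]
        simp only [Nat.cast_inj]
        split_ifs <;> ring
      · rw [if_neg hz, if_neg (Ne.symm hz)]; ring)
  refine ⟨_, h1.mono (Nat.mul_le_mul_right _ (by omega)), h2, fun z => ?_, fun b hb3 hb4 => ?_⟩
  · rw [Function.update_self]
  · rw [Function.update_of_ne hb3, State.write_ne _ hb4]

end

end SteinerJoin

/-! ### Tables of the subsets of `A`. -/

namespace SteinerJoin
open RAM

/-- One formula for both cases: if `v` is not in `A`, the range of `x` does not grow and the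
quotient is `0`. -/
theorem dep_succ_eq {A v x : ℕ} (hx : x < 2 ^ below A (v + 1)) :
    dep A (v + 1) x = dep A v (x % 2 ^ below A v) + x / 2 ^ below A v * 2 ^ v := by
  by_cases h : x < 2 ^ below A v
  · rw [Nat.mod_eq_of_lt h, Nat.div_eq_of_lt h, zero_mul, add_zero, dep_succ_of_lt h]
  · rw [below_succ] at hx
    by_cases hA : A.testBit v = true
    · rw [if_pos hA, pow_succ] at hx
      obtain ⟨y, rfl⟩ := Nat.exists_eq_add_of_le' (not_lt.1 h)
      have hy : y < 2 ^ below A v := by omega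
      rw [dep_succ_add hA hy, Nat.add_mod_right, Nat.mod_eq_of_lt hy,
        Nat.add_div_right _ (by positivity), Nat.div_eq_of_lt hy, zero_add,
        one_mul]
    · rw [if_neg hA] at hx
      exact absurd hx h

theorem pc_eq {tw a x : ℕ} (ha : a < tw) (hx : x < 2 ^ (a + 1)) :
    pc tw x = pc tw (x % 2 ^ a) + x / 2 ^ a := by
  by_cases h : x < 2 ^ a
  · rw [Nat.mod_eq_of_lt h, Nat.div_eq_of_lt h, add_zero]
  · obtain ⟨y, rfl⟩ := Nat.exists_eq_add_of_le' (not_lt.1 h)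
    have hy : y < 2 ^ a := by rw [pow_succ] at hx; omega
    rw [pc_two_pow_add ha hy, Nat.add_mod_right, Nat.mod_eq_of_lt hy,
      Nat.add_div_right _ (by positivity), Nat.div_eq_of_lt hy]

/-- The element whose value is the variable `6`: is it a member of the current set? -/
def member : Expr := var 8 / var 6 % 2

/-- The number of subsets of the current set that are tabulated after the element is processed. -/
def doubled : Expr := var 7 * (1 + member)

/-- Extend the tables of codes and of numbers of elements by one element of the ground set. -/
def tablesStep : Prog :=
  .seq (forLoop 4 doubled (.assign 14 (var 4) (.read 14 (var 4 % var 7) + var 4 / var 7 * var 6))) <|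
  .seq (forLoop 4 doubled (.assign 15 (var 4) (.read 15 (var 4 % var 7) + var 4 / var 7))) <|
  .seq (.assign 19 0 (var 19 + member)) <|
  .seq (.assign 7 0 doubled) (.assign 6 0 (var 6 * 2))

/-- Compute the tables of codes and of numbers of elements of the subsets of the current set. -/
def tables : Prog :=
  .seq (.assign 6 0 1) <| .seq (.assign 7 0 1) <| .seq (.assign 19 0 0) <|
  .seq (.assign 14 0 0) <| .seq (.assign 15 0 0) <| forLoop 5 (var 0) tablesStep

/-- The tables after `v` elements of the ground set. -/
structure Tables (tw A v : ℕ) (s : State) : Prop where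
  value : s 6 0 = ((2 ^ v : ℕ) : ℤ)
  size : s 7 0 = ((2 ^ below A v : ℕ) : ℤ)
  card : s 19 0 = (below A v : ℤ)
  code : ∀ j < 2 ^ below A v, s 14 (j : ℕ) = dep A v j
  count : ∀ j < 2 ^ below A v, s 15 (j : ℕ) = pc tw j

/-- While a table is extended in place, its old cells are overwritten by the values they already
have, so it does not matter whether a cell has been rewritten when it is read. -/
theorem fillArr_tabulate {f : ℤ → ℤ} {G F : ℕ → ℤ} {N x y : ℕ} (hf : ∀ j < N, f (j : ℕ) = F j)
    (hG : ∀ j < N, G j = F j) (hy : y < N) : fillArr f G x (y : ℕ) = F y := by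
  rw [fillArr_natCast]
  split_ifs
  exacts [hG y hy, hf y hy]

theorem runs_tablesStep {tw A v L : ℕ} {s : State} (hL : 2 * tw < L) (hv : v < tw) (hs : Small L s)
    (hA : s 8 0 = A) (h : Tables tw A v s) :
    ∃ s', Runs tablesStep s s' ((6 * (2 ^ below A tw * 2 ^ below A tw) + 7) * unit L) ∧
      Small L s' ∧ Tables tw A (v + 1) s' ∧
      ∀ b, b ≠ 4 → b ≠ 6 → b ≠ 7 → b ≠ 14 → b ≠ 15 → b ≠ 19 → s' b = s b := by
  have hv' := below_le A v
  have hM : 2 ^ below A (v + 1) ≤ 2 ^ below A tw * 2 ^ below A tw :=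
    (Nat.pow_le_pow_right (by norm_num) (below_mono A hv)).trans
      (Nat.le_mul_of_pos_left _ (by positivity))
  have hpow : ∀ u ≤ tw, bits ((2 ^ u : ℕ) : ℤ) ≤ L := fun u hu =>
    bits_natCast_le (Nat.pow_lt_pow_right (by norm_num) (by omega))
  have hsmall : ∀ u : ℕ, u ≤ 2 ^ tw → bits (u : ℤ) ≤ L := fun u hu =>
    bits_natCast_le (hu.trans_lt (Nat.pow_lt_pow_right (by norm_num) (by omega)))
  have hML := hpow (below A (v + 1)) ((below_le A _).trans hv)
  have hmem : ∀ σ : State, σ 6 0 = s 6 0 → σ 8 0 = s 8 0 →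
      member.eval σ = if A.testBit v = true then 1 else 0 := fun σ h6 h8 => by
    simp only [member, eval_mod, eval_div, eval_read, eval_zero, eval_two, h6, h8, hA, h.value,
      div_mod_two]
  have hdbl : ∀ σ : State, σ 6 0 = s 6 0 → σ 8 0 = s 8 0 → σ 7 0 = s 7 0 →
      doubled.eval σ = (2 ^ below A (v + 1) : ℕ) := fun σ h6 h8 h7 => by
    rw [doubled, eval_mul, eval_add, hmem σ h6 h8, eval_one, eval_read, eval_zero, h7, h.size,
      below_succ, pow_add]
    split_ifs <;> push_cast <;> ring
  have hdiv : ∀ x : ℕ, x < 2 ^ below A (v + 1) → ∀ σ : State, σ 4 0 = x → σ 7 0 = s 7 0 →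
      (var 4 / var 7).eval σ = (x / 2 ^ below A v : ℕ) ∧
      (var 4 % var 7).eval σ = (x % 2 ^ below A v : ℕ) := fun x _ σ h4 h7 => by
    rw [eval_div, eval_mod, eval_read, eval_read, eval_zero, h4, h7, h.size]
    push_cast; exact ⟨rfl, rfl⟩
  have hmod : ∀ x, x % 2 ^ below A v < 2 ^ below A v := fun x => Nat.mod_lt _ (by positivity)
  obtain ⟨s₁, r1, q1, f1, e1⟩ := runs_table (L := L) (v := 4) (a := 14) (m := doubled)
    (e := .read 14 (var 4 % var 7) + var 4 / var 7 * var 6) (M := 2 ^ below A (v + 1))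
    (fun x => (dep A (v + 1) x : ℤ)) (s := s) (by decide) (by decide) hML hs
    (fun _ x _ => hsmall _ ((dep_lt A (v + 1) x).le.trans (Nat.pow_le_pow_right (by norm_num) hv)))
    (fun σ hσ e => ⟨hσ.bdd rfl, hdbl σ (by rw [e 6 (by omega) (by omega)])
      (by rw [e 8 (by omega) (by omega)]) (by rw [e 7 (by omega) (by omega)])⟩)
    (fun x hx σ hσ h4 h14 e => by
      refine ⟨hσ.bdd rfl, ?_⟩
      obtain ⟨d1, d2⟩ := hdiv x hx σ h4 (by rw [e 7 (by omega) (by omega)])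
      rw [eval_add, eval_mul, d1, eval_read, d2, h14, eval_read, eval_zero,
        e 6 (by omega) (by omega), h.value, dep_succ_eq hx,
        fillArr_tabulate (F := fun j => dep A v j) h.code
          (fun j hj => by rw [dep_succ_of_lt hj]) (hmod x)]
      push_cast; rfl)
  obtain ⟨s₂, r2, q2, f2, e2⟩ := runs_table (L := L) (v := 4) (a := 15) (m := doubled)
    (e := .read 15 (var 4 % var 7) + var 4 / var 7) (M := 2 ^ below A (v + 1))
    (fun x => (pc tw x : ℤ)) (s := s₁) (by decide) (by decide) hML q1
    (fun _ x _ => hsmall _ ((pc_le tw x).trans Nat.lt_two_pow_self.le))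
    (fun σ hσ e => ⟨hσ.bdd rfl, hdbl σ
      (by rw [e 6 (by omega) (by omega), e1 6 (by omega) (by omega)])
      (by rw [e 8 (by omega) (by omega), e1 8 (by omega) (by omega)])
      (by rw [e 7 (by omega) (by omega), e1 7 (by omega) (by omega)])⟩)
    (fun x hx σ hσ h4 h15 e => by
      refine ⟨hσ.bdd rfl, ?_⟩
      obtain ⟨d1, d2⟩ := hdiv x hx σ h4
        (by rw [e 7 (by omega) (by omega), e1 7 (by omega) (by omega)])
      rw [eval_add, d1, eval_read, d2, h15, e1 15 (by omega) (by omega),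
        fillArr_tabulate (F := fun j => pc tw j) h.count (fun j hj => rfl) (hmod x)]
      rw [pc_eq (hv'.trans_lt hv) (x := x) (hx.trans_le (Nat.pow_le_pow_right (by norm_num)
        (by rw [below_succ]; split_ifs <;> omega)))]
      push_cast; rfl)
  have e12 : ∀ b, b ≠ 4 → b ≠ 14 → b ≠ 15 → s₂ b = s b := fun b h4 h14 h15 => by
    rw [e2 b h15 h4, e1 b h14 h4]
  have r3 := runs_assign (L := L) (s := s₂) (a := 19) (i := 0) (e := var 19 + member) trivial
    (q2.bdd rfl) (by decide)
  have v3 : (var 19 + member).eval s₂ = (below A (v + 1) : ℕ) := by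
    rw [eval_add, hmem s₂ (by rw [e12 6 (by omega) (by omega) (by omega)])
      (by rw [e12 8 (by omega) (by omega) (by omega)]), eval_read, eval_zero,
      e12 19 (by omega) (by omega) (by omega), h.card, below_succ]
    split_ifs <;> simp
  rw [v3, eval_zero] at r3
  have q3 := q2.write (a := 19) (z := 0)
    (hsmall (below A (v + 1)) (((below_le A _).trans hv).trans Nat.lt_two_pow_self.le))
  have e3 : ∀ b, b ≠ 19 → s₂.write 19 0 (below A (v + 1) : ℕ) b = s₂ b := fun b hb =>
    State.write_ne _ hb _ _
  have h319 : s₂.write 19 0 (below A (v + 1) : ℕ) 19 0 = below A (v + 1) := State.write_self _ _ _ _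
  generalize s₂.write 19 0 (below A (v + 1) : ℕ) = s₃ at r3 q3 e3 h319
  have r4 := runs_assign (L := L) (s := s₃) (a := 7) (i := 0) (e := doubled) trivial
    (q3.bdd rfl) (by decide)
  rw [hdbl s₃ (by rw [e3 6 (by omega), e12 6 (by omega) (by omega) (by omega)])
    (by rw [e3 8 (by omega), e12 8 (by omega) (by omega) (by omega)])
    (by rw [e3 7 (by omega), e12 7 (by omega) (by omega) (by omega)]), eval_zero] at r4
  have q4 := q3.write (a := 7) (z := 0) hML
  have r5 := runs_assign (L := L) (s := s₃.write 7 0 (2 ^ below A (v + 1) : ℕ)) (a := 6) (i := 0)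
    (e := var 6 * 2) trivial (q4.bdd rfl) (by decide)
  have v5 : (var 6 * 2).eval (s₃.write 7 0 (2 ^ below A (v + 1) : ℕ)) = (2 ^ (v + 1) : ℕ) := by
    rw [eval_mul, eval_read, eval_zero, State.write_ne _ (by omega), e3 6 (by omega),
      e12 6 (by omega) (by omega) (by omega), h.value, eval_two, pow_succ]
    push_cast; rfl
  rw [v5, eval_zero] at r5
  refine ⟨_, (r1.seq (r2.seq (r3.seq (r4.seq r5)))).mono ?_, q4.write (hpow _ hv), ?_, ?_⟩
  · calc _ = (6 * 2 ^ below A (v + 1) + 7) * unit L := by ring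
      _ ≤ _ := Nat.mul_le_mul_right _ (by omega)
  · constructor
    · rw [State.write_self]
    · rw [State.write_ne _ (by omega), State.write_self]
    · rw [State.write_ne _ (by omega), State.write_ne _ (by omega), h319]
    · intro j hj
      rw [State.write_ne _ (by omega), State.write_ne _ (by omega), e3 14 (by omega),
        e2 14 (by omega) (by omega), f1, fillArr_natCast, if_pos hj]
    · intro j hj
      rw [State.write_ne _ (by omega), State.write_ne _ (by omega), e3 15 (by omega), f2,
        fillArr_natCast, if_pos hj]
  · intro b h4 h6 h7 h14 h15 h19
    rw [State.write_ne _ h6, State.write_ne _ h7, e3 b h19, e12 b h4 h14 h15]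

theorem runs_tables {tw A L : ℕ} {s : State} (hL : 2 * tw < L) (hs : Small L s) (h0 : s 0 0 = tw)
    (hA : s 8 0 = A) : ∃ s', Runs tables s s'
        ((tw + 1) * (6 * (2 ^ below A tw * 2 ^ below A tw) + 9) * unit L) ∧
      Small L s' ∧ Tables tw A tw s' ∧
      ∀ b, b ≠ 4 → b ≠ 5 → b ≠ 6 → b ≠ 7 → b ≠ 14 → b ≠ 15 → b ≠ 19 → s' b = s b := by
  have hb0 : bits 0 ≤ L := by simp
  have hb1 : bits 1 ≤ L := bits_lt (e := 0) (by simp) (by omega)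
  have hbv : ∀ v ≤ tw, bits (v : ℤ) ≤ L := fun v hv =>
    bits_natCast_le (Nat.lt_two_pow_self.trans_le (Nat.pow_le_pow_right (by norm_num) (by omega)))
  have r1 : Runs (.assign 6 0 1) s (s.write 6 0 1) (unit L) :=
    runs_assign (L := L) (i := 0) (e := 1) trivial trivial (by decide)
  have r2 : Runs (.assign 7 0 1) (s.write 6 0 1) ((s.write 6 0 1).write 7 0 1) (unit L) :=
    runs_assign (L := L) (i := 0) (e := 1) trivial trivial (by decide)
  have q2 : Small L ((s.write 6 0 1).write 7 0 1) := (hs.write hb1).write hb1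
  set s₂ := (s.write 6 0 1).write 7 0 1 with hs₂
  have r3 : Runs (.assign 19 0 0) s₂ (s₂.write 19 0 0) (unit L) :=
    runs_assign (L := L) (i := 0) (e := 0) trivial trivial (by decide)
  have r4 : Runs (.assign 14 0 0) (s₂.write 19 0 0) ((s₂.write 19 0 0).write 14 0 0) (unit L) :=
    runs_assign (L := L) (i := 0) (e := 0) trivial trivial (by decide)
  have r5 : Runs (.assign 15 0 0) ((s₂.write 19 0 0).write 14 0 0)
      (((s₂.write 19 0 0).write 14 0 0).write 15 0 0) (unit L) :=
    runs_assign (L := L) (i := 0) (e := 0) trivial trivial (by decide)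
  have q5 : Small L (((s₂.write 19 0 0).write 14 0 0).write 15 0 0) :=
    ((q2.write hb0).write hb0).write hb0
  set s₅ := ((s₂.write 19 0 0).write 14 0 0).write 15 0 0 with hs₅
  have e5 : ∀ b, b ≠ 6 → b ≠ 7 → b ≠ 14 → b ≠ 15 → b ≠ 19 → s₅ b = s b := by
    intro b h6 h7 h14 h15 h19
    rw [hs₅, State.write_ne _ h15, State.write_ne _ h14, State.write_ne _ h19, hs₂,
      State.write_ne _ h7, State.write_ne _ h6]
  have T0 : Tables tw A 0 s₅ := by
    constructor
    · simp [hs₅, hs₂, State.write]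
    · simp [hs₅, hs₂, State.write, below_zero]
    · simp [hs₅, State.write, below_zero]
    · intro j hj
      obtain rfl : j = 0 := by simpa [below_zero] using hj
      simp [hs₅, State.write, dep]
    · intro j hj
      obtain rfl : j = 0 := by simpa [below_zero] using hj
      simp [hs₅, pc_zero]
  obtain ⟨s', r6, h1, h2, h3, h4⟩ := runs_forLoop (L := L) (v := 5) (m := var 0)
    (p := tablesStep) (M := tw)
    (fun v σ => Small L σ ∧ σ 5 0 = v ∧ Tables tw A v σ ∧
      ∀ b, b ≠ 4 → b ≠ 5 → b ≠ 6 → b ≠ 7 → b ≠ 14 → b ≠ 15 → b ≠ 19 → σ b = s b)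
    (fun _ => (6 * (2 ^ below A tw * 2 ^ below A tw) + 7) * unit L) (s := s₅)
    (by decide) (hbv _ le_rfl)
    (by
      rintro x hx σ ⟨h1, h2, -, h4⟩
      refine ⟨?_, h1.bdd rfl, h2⟩
      rw [eval_read, eval_zero, h4 0 (by omega) (by omega) (by omega) (by omega) (by omega)
        (by omega) (by omega), h0])
    (by
      refine ⟨q5.write hb0, by simp, ?_, ?_⟩
      · constructor
        all_goals rw [State.write_ne _ (by omega)]
        exacts [T0.value, T0.size, T0.card, T0.code, T0.count]
      · intro b h4 h5 h6 h7 h14 h15 h19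
        rw [State.write_ne _ h5, e5 b h6 h7 h14 h15 h19])
    (by
      rintro v hv σ ⟨h1, h2, h3, h4⟩
      obtain ⟨σ', r, k1, k2, k3⟩ := runs_tablesStep hL hv h1
        (by rw [h4 8 (by omega) (by omega) (by omega) (by omega) (by omega) (by omega) (by omega),
          hA]) h3
      refine ⟨σ', r, ?_, k1.write (by exact_mod_cast hbv (v + 1) hv), by simp, ?_, ?_⟩
      · rw [k3 5 (by omega) (by omega) (by omega) (by omega) (by omega) (by omega), h2]
      · constructor
        all_goals rw [State.write_ne _ (by omega)]
        exacts [k2.value, k2.size, k2.card, k2.code, k2.count]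
      · intro b b4 b5 b6 b7 b14 b15 b19
        rw [State.write_ne _ b5, k3 b b4 b6 b7 b14 b15 b19, h4 b b4 b5 b6 b7 b14 b15 b19])
  refine ⟨s', (r1.seq (r2.seq (r3.seq (r4.seq (r5.seq r6))))).mono ?_, h1, h3, h4⟩
  rw [Finset.sum_const, Finset.card_range, smul_eq_mul]
  set N := 2 ^ below A tw * 2 ^ below A tw
  have hN : 0 < N := by positivity
  calc _ = (tw * (6 * N + 9) + 7) * unit L := by ring
    _ ≤ _ := Nat.mul_le_mul_right _ (by rw [add_mul]; omega)

end SteinerJoin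

/-! ### One round of the main loop: a set, two degrees and two ranks. -/

namespace SteinerJoin
open RAM

/-- Read off the current set, degrees and ranks from their common number, the variable `20`. -/
def select : Prog :=
  .seq (.assign 8 0 (var 20 % var 9)) <|
  .seq (.assign 10 0 (var 20 / var 9 % (.read 0 1 + 1))) <|
  .seq (.assign 12 0 (var 20 / var 9 / (.read 0 1 + 1) % (.read 0 1 + 1))) <|
  .seq (.assign 11 0 (var 20 / var 9 / (.read 0 1 + 1) / (.read 0 1 + 1) % (var 0 + 1)))
    (.assign 13 0 (var 20 / var 9 / (.read 0 1 + 1) / (.read 0 1 + 1) / (var 0 + 1)))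

/-- Compute the products for one set, one pair of degrees and one pair of ranks. -/
def body (P : Prog) : Prog :=
  .seq select <| .seq tables <|
  .seq (gather 16 1 (var 10) (var 11) 0) <| .seq (zeta 16 1) <|
  .seq (gather 17 2 (var 12) (var 13) (var 11)) <| .seq (zeta 17 1) <|
  .seq (callMatMul P) <| .seq (zeta 18 (.const (-1))) scatter

/-- The matrix of a function of two sets. -/
def mat {a : ℕ} (F : Finset (Fin a) → Finset (Fin a) → ℤ) : Matrix (Fin (2 ^ a)) (Fin (2 ^ a)) ℤ :=
  fun i j => F (decode a i) (decode a j)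

section
variable {a : ℕ} (F G : Finset (Fin a) → Finset (Fin a) → ℤ)

theorem layout_mat {x : ℕ} (hx : x < 2 ^ a * 2 ^ a) : MatMul.layout (mat F) x = atEntry F x := by
  have h : (x : ℤ) = ((2 ^ a : ℕ) : ℤ) * (⟨x / 2 ^ a, row_lt hx⟩ : Fin (2 ^ a)) +
      (⟨x % 2 ^ a, col_lt⟩ : Fin (2 ^ a)) := by exact_mod_cast (Nat.div_add_mod x (2 ^ a)).symm
  rw [h, layout_apply, mat, atEntry]

/-- The codes `0, …, 2 ^ a - 1` enumerate all subsets, so the sum over the middle index is a sum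
over sets. -/
theorem mat_mul : mat F * mat G = mat fun T S => ∑ R, F T R * G R S := by
  ext i j
  rw [Matrix.mul_apply, mat, ← (decode_bijective a).sum_comp]
  rfl

theorem abs_fock_le {c : ℤ} (hc : |c| = 1) {e tw : ℕ} (ha : a ≤ tw) (hF : ∀ T S, |F T S| ≤ 2 ^ e)
    (T S : Finset (Fin a)) : |fock c F T S| ≤ 2 ^ (e + tw) := by
  rw [← fockBelow_self]
  refine (abs_fockBelow_le hc hF le_rfl T S).trans ?_
  rw [← pow_add]
  exact pow_le_pow_right₀ (by norm_num) (by omega)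

theorem abs_sum_mul_le {e tw : ℕ} (ha : a ≤ tw) (hF : ∀ T S, |F T S| ≤ 2 ^ e)
    (hG : ∀ T S, |G T S| ≤ 2 ^ e) (T S : Finset (Fin a)) :
    |∑ R, F T R * G R S| ≤ 2 ^ (2 * e + tw) := by
  calc _ ≤ ∑ R : Finset (Fin a), (2 : ℤ) ^ (2 * e) := by
        refine (Finset.abs_sum_le_sum_abs _ _).trans (Finset.sum_le_sum fun R _ => ?_)
        rw [abs_mul, two_mul, pow_add]
        exact mul_le_mul (hF _ _) (hG _ _) (abs_nonneg _) (by positivity)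
    _ = 2 ^ (2 * e + a) := by simp [pow_add]; ring
    _ ≤ _ := pow_le_pow_right₀ (by norm_num) (by omega)

end

theorem runs_select {tw n q L : ℕ} {s : State} (hL : q < 2 ^ L) (hs : Small L s) (h0 : s 0 0 = tw)
    (h1 : s 0 1 = n) (h9 : s 9 0 = (2 ^ tw : ℕ)) (h20 : s 20 0 = q) :
    ∃ s', Runs select s s' (5 * unit L) ∧ Small L s' ∧ s' 8 0 = (q % 2 ^ tw : ℕ) ∧
      s' 10 0 = (q / 2 ^ tw % (n + 1) : ℕ) ∧ s' 12 0 = (q / 2 ^ tw / (n + 1) % (n + 1) : ℕ) ∧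
      s' 11 0 = (q / 2 ^ tw / (n + 1) / (n + 1) % (tw + 1) : ℕ) ∧
      s' 13 0 = (q / 2 ^ tw / (n + 1) / (n + 1) / (tw + 1) : ℕ) ∧
      ∀ b, b ≠ 8 → b ≠ 10 → b ≠ 11 → b ≠ 12 → b ≠ 13 → s' b = s b := by
  have hq : ∀ x ≤ q, bits (x : ℤ) ≤ L := fun x hx => bits_natCast_le (hx.trans_lt hL)
  have step : ∀ (σ : State) (a : ℕ) (e : Expr) (x : ℕ), 2 + e.len ≤ 1000 ∧ e.low = true →
      e.eval σ = x → x ≤ q → Small L σ →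
      Runs (.assign a 0 e) σ (σ.write a 0 x) (unit L) ∧ Small L (σ.write a 0 x) := by
    intro σ a e x he hx hxq hσ
    have := runs_assign (L := L) (s := σ) (a := a) (i := 0) (e := e) trivial (hσ.bdd he.2)
      (by have := he.1; change 1 + 1 + e.len ≤ 1000; omega)
    rw [hx, eval_zero] at this
    exact ⟨this, hσ.write (hq x hxq)⟩
  have d1 : q / 2 ^ tw ≤ q := Nat.div_le_self _ _
  have d2 : q / 2 ^ tw / (n + 1) ≤ q := (Nat.div_le_self _ _).trans d1
  have d3 : q / 2 ^ tw / (n + 1) / (n + 1) ≤ q := (Nat.div_le_self _ _).trans d2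
  obtain ⟨r1, q1⟩ := step s 8 (var 20 % var 9) (q % 2 ^ tw) (by decide)
    (by simp only [eval_mod, eval_read, eval_zero, h20, h9]; push_cast; rfl) (Nat.mod_le _ _) hs
  obtain ⟨r2, q2⟩ := step _ 10 (var 20 / var 9 % (.read 0 1 + 1)) (q / 2 ^ tw % (n + 1)) (by decide)
    (by
      simp only [eval_mod, eval_div, eval_add, eval_read, eval_zero, eval_one]
      iterate 3 rw [State.write_ne _ (by omega)]
      rw [h20, h9, h1]; push_cast; rfl) ((Nat.mod_le _ _).trans d1) q1
  obtain ⟨r3, q3⟩ := step _ 12 (var 20 / var 9 / (.read 0 1 + 1) % (.read 0 1 + 1))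
    (q / 2 ^ tw / (n + 1) % (n + 1)) (by decide)
    (by
      simp only [eval_mod, eval_div, eval_add, eval_read, eval_zero, eval_one]
      iterate 6 rw [State.write_ne _ (by omega)]
      rw [h20, h9, h1]; push_cast; rfl) ((Nat.mod_le _ _).trans d2) q2
  obtain ⟨r4, q4⟩ := step _ 11 (var 20 / var 9 / (.read 0 1 + 1) / (.read 0 1 + 1) % (var 0 + 1))
    (q / 2 ^ tw / (n + 1) / (n + 1) % (tw + 1)) (by decide)
    (by
      simp only [eval_mod, eval_div, eval_add, eval_read, eval_zero, eval_one]
      iterate 9 rw [State.write_ne _ (by omega)]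
      rw [h20, h9, h1, h0]; push_cast; rfl) ((Nat.mod_le _ _).trans d3) q3
  obtain ⟨r5, q5⟩ := step _ 13 (var 20 / var 9 / (.read 0 1 + 1) / (.read 0 1 + 1) / (var 0 + 1))
    (q / 2 ^ tw / (n + 1) / (n + 1) / (tw + 1)) (by decide)
    (by
      simp only [eval_div, eval_add, eval_read, eval_zero, eval_one]
      iterate 12 rw [State.write_ne _ (by omega)]
      rw [h20, h9, h1, h0]; push_cast; rfl) ((Nat.div_le_self _ _).trans d3) q4
  refine ⟨_, (r1.seq (r2.seq (r3.seq (r4.seq r5)))).mono (by omega), q5, ?_, ?_, ?_, ?_, ?_, ?_⟩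
  · iterate 4 rw [State.write_ne _ (by omega)]
    rw [State.write_self]
  · iterate 3 rw [State.write_ne _ (by omega)]
    rw [State.write_self]
  · iterate 2 rw [State.write_ne _ (by omega)]
    rw [State.write_self]
  · rw [State.write_ne _ (by omega), State.write_self]
  · rw [State.write_self]
  · intro b h8 h10 h11 h12 h13
    rw [State.write_ne _ h13, State.write_ne _ h11, State.write_ne _ h12, State.write_ne _ h10,
      State.write_ne _ h8]

/-- The program `P` multiplies matrices with entries of at most `b` bits in time `T`. -/
def Multiplies (P : Prog) (N b T : ℕ) : Prop :=
  ∀ M M' : Matrix (Fin N) (Fin N) ℤ, (∀ i j, bits (M i j) ≤ b) → (∀ i j, bits (M' i j) ≤ b) →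
    ∃ σ t, Exec P (MatMul.input M M') σ t ∧
      (∀ i j : Fin N, σ 3 ((N : ℤ) * i + j) = (M * M') i j) ∧ t ≤ T

/-- The function of two sets whose matrix is the transformed product. -/
def product (tw A : ℕ) (f g : ℕ → Finset (Fin tw) → Finset (Fin tw) → Finset (Fin tw) → ℤ)
    (k₁ k₂ r₁ r₂ : ℕ) : Finset (Fin (below A tw)) → Finset (Fin (below A tw)) → ℤ :=
  fock (-1) fun T S => ∑ R, fock 1 (part tw A f 0 k₁ r₁) T R * fock 1 (part tw A g r₁ k₂ r₂) R S

section
variable {tw n b q L T : ℕ}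
  {f g : ℕ → Finset (Fin tw) → Finset (Fin tw) → Finset (Fin tw) → ℤ}
  {k₁ k₂ r₁ r₂ A : ℕ}

/-- In the exponent, `b + tw` is for a transformed factor, one `tw` for the sum over the middle
index, and the last `tw` for the inverse transform. -/
theorem abs_product_le (hf : ∀ i A B C, bits (f i A B C) ≤ b) (hg : ∀ i A B C, bits (g i A B C) ≤ b)
    (B C : Finset (Fin (below A tw))) :
    |product tw A f g k₁ k₂ r₁ r₂ B C| ≤ 2 ^ (2 * (b + tw) + tw + tw) :=
  abs_fock_le _ (by norm_num) (below_le A tw) (abs_sum_mul_le _ _ (below_le A tw)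
    (abs_fock_le _ (by norm_num) (below_le A tw) (abs_part_le hf _ _ _))
    (abs_fock_le _ (by norm_num) (below_le A tw) (abs_part_le hg _ _ _))) B C

/-- The transformed factors are bounded by `2 ^ (b + tw)`, hence have at most `b + tw + 1` bits, the
length for which `P` is invoked. Arrays `0, 1, 2, 9` and all from `20` on are left as they were, so
that the rounds do not interfere. -/
theorem runs_body {P : Prog} (hf : ∀ i A B C, bits (f i A B C) ≤ b)
    (hg : ∀ i A B C, bits (g i A B C) ≤ b) {s : State} (hq : q < 2 ^ L)
    (hbL : 2 * b + 4 * tw < L) (hA : A = q % 2 ^ tw) (hk₁ : k₁ = q / 2 ^ tw % (n + 1))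
    (hk₂ : k₂ = q / 2 ^ tw / (n + 1) % (n + 1))
    (hr₁ : r₁ = q / 2 ^ tw / (n + 1) / (n + 1) % (tw + 1))
    (hr₂ : r₂ = q / 2 ^ tw / (n + 1) / (n + 1) / (tw + 1))
    (hP : Multiplies P (2 ^ below A tw) (b + tw + 1) T)
    (hT : 2 ^ below A tw * 2 ^ below A tw + T < 2 ^ L)
    (hs : Small L s) (h00 : s 0 0 = tw) (h01 : s 0 1 = n) (h1 : s 1 = layout f) (h2 : s 2 = layout g)
    (h9 : s 9 0 = (2 ^ tw : ℕ)) (h20 : s 20 0 = q) (hz : ∀ a ≥ 30, s a = fun _ => 0)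
    (hH : ∀ M ≤ 2 ^ below A tw * 2 ^ below A tw, ∀ z, bits (s 3 z +
      scattered tw A k₁ k₂ r₁ r₂ (atEntry (product tw A f g k₁ k₂ r₁ r₂)) M z) ≤ L) :
    ∃ s', Runs (body P) s s'
        (200 * (P.top + 5) * (tw + 1) * (2 ^ below A tw * 2 ^ below A tw + T) * unit L) ∧
      Small L s' ∧
      (∀ z, s' 3 z = s 3 z +
        scattered tw A k₁ k₂ r₁ r₂ (atEntry (product tw A f g k₁ k₂ r₁ r₂))
          (if below A tw ≤ k₁ + k₂ then 2 ^ below A tw * 2 ^ below A tw else 0) z) ∧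
      ∀ b, b ≤ 2 ∨ b = 9 ∨ 20 ≤ b → s' b = s b := by
  have ha := below_le A tw
  have hL : 2 * tw < L := by omega
  have hAlt : A < 2 ^ tw := hA ▸ Nat.mod_lt _ (by positivity)
  set N := 2 ^ below A tw * 2 ^ below A tw with hN
  have hN0 : 0 < N := by positivity
  obtain ⟨s₁, t1, q1, p8, p10, p12, p11, p13, e1⟩ := runs_select hq hs h00 h01 h9 h20
  rw [← hA] at p8
  rw [← hk₁] at p10
  rw [← hk₂] at p12
  rw [← hr₁] at p11
  rw [← hr₂] at p13
  obtain ⟨s₂, t2, q2, T2, e2⟩ := runs_tables hL q1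
    (by rw [e1 0 (by omega) (by omega) (by omega) (by omega) (by omega), h00]) p8
  have e2' : ∀ b, b ≤ 2 ∨ b = 3 ∨ b = 9 ∨ 20 ≤ b → s₂ b = s b := fun b hb => by
    rw [e2 b (by omega) (by omega) (by omega) (by omega) (by omega) (by omega) (by omega),
      e1 b (by omega) (by omega) (by omega) (by omega) (by omega)]
  have E2 : Env tw A k₁ k₂ r₁ r₂ s₂ := by
    have h : ∀ b, 8 ≤ b → b ≤ 13 → s₂ b = s₁ b := fun b hb hb' =>
      e2 b (by omega) (by omega) (by omega) (by omega) (by omega) (by omega) (by omega)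
    refine ⟨T2.size, ?_, ?_, ?_, ?_, ?_, ?_, T2.code, T2.count, T2.card⟩
    · rw [h 8 (by omega) (by omega), p8]
    · rw [e2' 9 (by omega), h9]
    · rw [h 10 (by omega) (by omega), p10]
    · rw [h 11 (by omega) (by omega), p11]
    · rw [h 12 (by omega) (by omega), p12]
    · rw [h 13 (by omega) (by omega), p13]
  obtain ⟨s₃, t3, q3, f3, e3⟩ := runs_gather (dst := 16) (src := 1) (k := var 10) (r := var 11)
    (c := 0) (kv := k₁) (rv := r₁) (cv := 0) hf hAlt (by omega : b < L) hL q2 E2 (by omega) (by omega)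
    (by rw [e2' 1 (by omega), h1]) (by decide) (fun σ h => h.deg₁) (fun σ h => h.rank₁)
    (fun σ h => rfl)
  have E3 := E2.congr fun b hb => e3 b (by omega) (by omega)
  obtain ⟨s₄, t4, q4, f4, e4⟩ := runs_zeta (X := 16) (c := 1) (ce := 1) (by norm_num)
    (abs_part_le hf 0 k₁ r₁) (by omega) hL (by omega) q3 E3 (by decide) (fun _ => rfl) f3
  have E4 := E3.congr fun b hb => e4 b (by omega) (by omega) (by omega) (by omega)
  -- Only the second factor receives the correction of signs, governed by the first rank `r₁`.
  obtain ⟨s₅, t5, q5, f5, e5⟩ := runs_gather (dst := 17) (src := 2) (k := var 12) (r := var 13)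
    (c := var 11) (kv := k₂) (rv := r₂) (cv := r₁) hg hAlt (by omega : b < L) hL q4 E4
    (by omega) (by omega)
    (by rw [e4 2 (by omega) (by omega) (by omega) (by omega), e3 2 (by omega) (by omega),
      e2' 2 (by omega), h2]) (by decide) (fun σ h => h.deg₂) (fun σ h => h.rank₂)
    (fun σ h => h.rank₁)
  have E5 := E4.congr fun b hb => e5 b (by omega) (by omega)
  obtain ⟨s₆, t6, q6, f6, e6⟩ := runs_zeta (X := 17) (c := 1) (ce := 1) (by norm_num)
    (abs_part_le hg r₁ k₂ r₂) (by omega) hL (by omega) q5 E5 (by decide) (fun _ => rfl) f5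
  have E6 := E5.congr fun b hb => e6 b (by omega) (by omega) (by omega) (by omega)
  have bf := abs_fock_le (part tw A f 0 k₁ r₁) (c := 1) (by norm_num) ha (abs_part_le hf 0 k₁ r₁)
  have bg := abs_fock_le (part tw A g r₁ k₂ r₂) (c := 1) (by norm_num) ha (abs_part_le hg r₁ k₂ r₂)
  have bp := abs_sum_mul_le _ _ ha bf bg
  obtain ⟨σ, t, hx, hσ, ht⟩ := hP (mat (fock 1 (part tw A f 0 k₁ r₁)))
    (mat (fock 1 (part tw A g r₁ k₂ r₂))) (fun i j => bits_lt (bf _ _) (by omega))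
    (fun i j => bits_lt (bg _ _) (by omega))
  have e26 : ∀ b, b ≤ 3 ∨ b = 9 ∨ 20 ≤ b → s₆ b = s b := fun b hb => by
    rw [e6 b (by omega) (by omega) (by omega) (by omega), e5 b (by omega) (by omega),
      e4 b (by omega) (by omega) (by omega) (by omega), e3 b (by omega) (by omega),
      e2' b (by omega)]
  obtain ⟨s₇, t7, q7, f7, e7⟩ := runs_callMatMul (P := P) (L := L) q6 E6.size (by positivity)
    (fun a ha => by rw [e26 a (by omega), hz a ha])
    (fun x hx => by
      rw [layout_mat _ hx, e6 16 (by omega) (by omega) (by omega) (by omega),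
        e5 16 (by omega) (by omega), f4 x hx])
    (fun x hx => by rw [layout_mat _ hx, f6 x hx]) hx hσ
    (fun i j => by rw [mat_mul]; exact bits_lt (bp _ _) (by omega)) (by omega)
  have E7 := E6.congr fun b hb => e7 b (by omega) (by omega)
  obtain ⟨s₈, t8, q8, f8, e8⟩ := runs_zeta (X := 18) (c := -1) (ce := .const (-1)) (by norm_num)
    bp (by omega) hL (by omega) q7 E7 (by decide) (fun _ => rfl)
    (fun x hx => by rw [f7, fillArr_natCast, if_pos hx, mat_mul, layout_mat _ hx])
  have E8 := E7.congr fun b hb => e8 b (by omega) (by omega) (by omega) (by omega)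
  have e38 : ∀ b, b ≤ 3 ∨ b = 9 ∨ 20 ≤ b → s₈ b = s b := fun b hb => by
    rw [e8 b (by omega) (by omega) (by omega) (by omega), e7 b (by omega) (by omega),
      e26 b (by omega)]
  obtain ⟨s₉, t9, q9, f9, e9⟩ := runs_scatter hL q8 E8 f8 (by rw [e38 3 (by omega)]; exact hH)
  refine ⟨s₉, (t1.seq (t2.seq (t3.seq (t4.seq (t5.seq (t6.seq (t7.seq (t8.seq t9)))))))).mono ?_,
    q9, fun z => ?_, fun b hb => ?_⟩
  · rw [← hN]
    have h1 : 100 * (P.top + 5) * (N + t) ≤ 100 * (P.top + 5) * (tw + 1) * (N + T) := by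
      rw [mul_assoc _ (tw + 1)]
      exact Nat.mul_le_mul_left _ ((Nat.add_le_add_left ht N).trans
        (Nat.le_mul_of_pos_left _ (by omega)))
    have h2 : 5 + ((tw + 1) * (6 * N + 9) + 3 * (3 * N + 2) + 3 * ((tw + 1) * (3 * N + 5))) ≤
        100 * (P.top + 5) * (tw + 1) * (N + T) := by
      calc _ ≤ (tw + 1) * 100 * N := by nlinarith [Nat.zero_le (tw * N)]
        _ = 100 * 1 * (tw + 1) * N := by ring
        _ ≤ _ := by gcongr <;> omega
    calc _ = (100 * (P.top + 5) * (N + t) + (5 + ((tw + 1) * (6 * N + 9) + 3 * (3 * N + 2) +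
          3 * ((tw + 1) * (3 * N + 5))))) * unit L := by ring
      _ ≤ (100 * (P.top + 5) * (tw + 1) * (N + T) + 100 * (P.top + 5) * (tw + 1) * (N + T)) *
          unit L := Nat.mul_le_mul_right _ (add_le_add h1 h2)
      _ = _ := by ring
  · rw [f9 z, e38 3 (by omega)]; rfl
  · rw [e9 b (by omega) (by omega), e38 b (by omega)]

end

end SteinerJoin

/-! ### The whole program: correctness and running time. -/

namespace SteinerJoin
open RAM

/-- The whole program, given a program for matrix multiplication. -/
def program (P : Prog) : Prog :=
  .seq (.assign 9 0 1) <| .seq (forLoop 5 (var 0) (.assign 9 0 (var 9 * 2))) <|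
  forLoop 20 (var 9 * ((.read 0 1 + 1) * ((.read 0 1 + 1) * ((var 0 + 1) * (var 0 + 1))))) (body P)

theorem sum_range_mul {α : Type*} [AddCommMonoid α] {m : ℕ} (hm : 0 < m) (n : ℕ) (φ : ℕ → ℕ → α) :
    ∑ q ∈ Finset.range (m * n), φ (q % m) (q / m) =
      ∑ x ∈ Finset.range m, ∑ y ∈ Finset.range n, φ x y := by
  rw [← Finset.sum_product']
  refine Finset.sum_bij' (fun q _ => (q % m, q / m)) (fun p _ => m * p.2 + p.1) ?_ ?_ ?_ ?_ ?_
  · intro q hq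
    simp only [Finset.mem_product, Finset.mem_range] at hq ⊢
    exact ⟨Nat.mod_lt _ hm, Nat.div_lt_of_lt_mul hq⟩
  · rintro ⟨x, y⟩ h
    simp only [Finset.mem_product, Finset.mem_range] at h ⊢
    calc m * y + x < m * y + m := by omega
      _ = m * (y + 1) := by ring
      _ ≤ m * n := Nat.mul_le_mul_left _ h.2
  · intro q _
    exact Nat.div_add_mod q m
  · rintro ⟨x, y⟩ h
    simp only [Finset.mem_product, Finset.mem_range] at h
    simp [Nat.mod_eq_of_lt h.1, Nat.mul_add_div hm, Nat.div_eq_of_lt h.1]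
  · intro q _
    rfl

/-- The loop number is a mixed radix number with digits `A, k₁, k₂, r₁, r₂`, so one flat loop visits
all combinations once. This serves both for the value of the result and for the total time. -/
theorem sum_select {α : Type*} [AddCommMonoid α] (tw n : ℕ) (φ : ℕ → ℕ → ℕ → ℕ → ℕ → α) :
    ∑ q ∈ Finset.range (2 ^ tw * ((n + 1) * ((n + 1) * ((tw + 1) * (tw + 1))))),
      φ (q % 2 ^ tw) (q / 2 ^ tw % (n + 1)) (q / 2 ^ tw / (n + 1) % (n + 1))
        (q / 2 ^ tw / (n + 1) / (n + 1) % (tw + 1)) (q / 2 ^ tw / (n + 1) / (n + 1) / (tw + 1)) =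
      ∑ A ∈ Finset.range (2 ^ tw), ∑ k₁ ∈ Finset.range (n + 1), ∑ k₂ ∈ Finset.range (n + 1),
        ∑ r₁ ∈ Finset.range (tw + 1), ∑ r₂ ∈ Finset.range (tw + 1), φ A k₁ k₂ r₁ r₂ := by
  rw [sum_range_mul (by positivity) _ fun A y => φ A (y % (n + 1)) (y / (n + 1) % (n + 1))
    (y / (n + 1) / (n + 1) % (tw + 1)) (y / (n + 1) / (n + 1) / (tw + 1))]
  refine Finset.sum_congr rfl fun A _ => ?_
  rw [sum_range_mul (by positivity) _ fun k₁ y => φ A k₁ (y % (n + 1))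
    (y / (n + 1) % (tw + 1)) (y / (n + 1) / (tw + 1))]
  refine Finset.sum_congr rfl fun k₁ _ => ?_
  rw [sum_range_mul (by positivity) _ fun k₂ y => φ A k₁ k₂ (y % (tw + 1)) (y / (tw + 1))]
  refine Finset.sum_congr rfl fun k₂ _ => ?_
  rw [sum_range_mul (by positivity)]

section
variable {tw n b : ℕ}
  {f g : ℕ → Finset (Fin tw) → Finset (Fin tw) → Finset (Fin tw) → ℤ}

theorem dep_injOn {A j l : ℕ} (hj : j < 2 ^ below A tw) (hl : l < 2 ^ below A tw)
    (h : dep A tw j = dep A tw l) : j = l := by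
  refine decode_injOn hj hl (lift_injective tw A ?_)
  rw [← decode_dep, ← decode_dep, h]

theorem exists_dep {A B : ℕ} (hB : B < 2 ^ tw) (h : decode tw B ⊆ decode tw A) :
    ∃ j < 2 ^ below A tw, dep A tw j = B := by
  obtain ⟨B', hB'⟩ := exists_lift tw A h
  obtain ⟨j, rfl⟩ := (decode_bijective (below A tw)).2 B'
  refine ⟨j, j.2, decode_injOn (dep_lt A tw _) hB ?_⟩
  rw [decode_dep, hB']

/-- What the body of the main loop adds to the result. -/
def increment (tw : ℕ) (f g : ℕ → Finset (Fin tw) → Finset (Fin tw) → Finset (Fin tw) → ℤ)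
    (z : ℤ) (A k₁ k₂ r₁ r₂ : ℕ) : ℤ :=
  scattered tw A k₁ k₂ r₁ r₂ (atEntry (product tw A f g k₁ k₂ r₁ r₂))
    (if below A tw ≤ k₁ + k₂ then 2 ^ below A tw * 2 ^ below A tw else 0) z

/-- Uniqueness of the digits of an address in base `2 ^ tw`; the leading digit, the degree, is
unrestricted. -/
theorem place_eq_iff {A k x i A₀ B₀ C₀ : ℕ} (hA : A < 2 ^ tw) (hA₀ : A₀ < 2 ^ tw)
    (hB₀ : B₀ < 2 ^ tw) (hC₀ : C₀ < 2 ^ tw) :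
    place tw A k x = i * (2 ^ tw * 2 ^ tw * 2 ^ tw) + A₀ * (2 ^ tw * 2 ^ tw) + B₀ * 2 ^ tw + C₀ ↔
      k = i ∧ A = A₀ ∧ dep A tw (x / 2 ^ below A tw) = B₀ ∧ dep A tw (x % 2 ^ below A tw) = C₀ := by
  have key : ∀ {W x y c d : ℕ}, c < W → d < W → x * W + c = y * W + d → x = y ∧ c = d := by
    intro W x y c d hc hd h
    have hW : 0 < W := by omega
    have h1 := congrArg (· / W) h
    have h2 := congrArg (· % W) h
    simp only [mul_comm _ W, Nat.mul_add_div hW, Nat.mul_add_mod, Nat.div_eq_of_lt, hc, hd,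
      Nat.mod_eq_of_lt, add_zero] at h1 h2
    exact ⟨h1, h2⟩
  have hB := dep_lt A tw (x / 2 ^ below A tw)
  have hC := dep_lt A tw (x % 2 ^ below A tw)
  rw [place]
  generalize dep A tw (x / 2 ^ below A tw) = B at hB ⊢
  generalize dep A tw (x % 2 ^ below A tw) = C at hC ⊢
  generalize 2 ^ tw = W at hA hA₀ hB₀ hC₀ hB hC ⊢
  constructor
  · intro h
    obtain ⟨h1, h2⟩ := key (x := (k * W + A) * W + B) (y := (i * W + A₀) * W + B₀) hC hC₀ (by linarith)
    obtain ⟨h3, h4⟩ := key hB hB₀ h1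
    obtain ⟨h5, h6⟩ := key hA hA₀ h3
    exact ⟨h5, h6, h4, h2⟩
  · rintro ⟨rfl, rfl, rfl, rfl⟩
    rfl

theorem increment_of_ne {A k₁ k₂ r₁ r₂ : ℕ} {z : ℤ} (h : ∀ k x, (place tw A k x : ℤ) ≠ z) :
    increment tw f g z A k₁ k₂ r₁ r₂ = 0 := by
  unfold increment scattered
  exact Finset.sum_eq_zero fun x _ => if_neg (h _ x)

/-- Since `dep` is injective on the codes of index sets, exactly one matrix entry is added to the
given cell, provided that the degrees match. -/
theorem increment_eq {A k₁ k₂ r₁ r₂ i j l : ℕ} (hA : A < 2 ^ tw) (hj : j < 2 ^ below A tw)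
    (hl : l < 2 ^ below A tw) :
    increment tw f g ((i * (2 ^ tw * 2 ^ tw * 2 ^ tw) + A * (2 ^ tw * 2 ^ tw) +
      dep A tw j * 2 ^ tw + dep A tw l : ℕ) : ℤ) A k₁ k₂ r₁ r₂ =
      if k₁ + k₂ = i + below A tw then
        contrib tw A f g k₁ k₂ r₁ r₂ (decode (below A tw) j) (decode (below A tw) l) else 0 := by
  unfold increment scattered
  simp only [Nat.cast_inj, place_eq_iff hA hA (dep_lt A tw j) (dep_lt A tw l)]
  by_cases hk : k₁ + k₂ = i + below A tw
  · rw [if_pos hk, if_pos (by omega)]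
    have hx : j * 2 ^ below A tw + l < 2 ^ below A tw * 2 ^ below A tw := by
      calc j * 2 ^ below A tw + l < j * 2 ^ below A tw + 2 ^ below A tw := by omega
        _ = (j + 1) * 2 ^ below A tw := by ring
        _ ≤ _ := Nat.mul_le_mul_right _ hj
    have hd : (j * 2 ^ below A tw + l) / 2 ^ below A tw = j := by
      rw [mul_comm, Nat.mul_add_div (by positivity), Nat.div_eq_of_lt hl, add_zero]
    have hm : (j * 2 ^ below A tw + l) % 2 ^ below A tw = l := by
      rw [mul_comm, Nat.mul_add_mod, Nat.mod_eq_of_lt hl]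
    rw [Finset.sum_eq_single (j * 2 ^ below A tw + l)]
    · rw [hd, hm, if_pos ⟨by omega, trivial, rfl, rfl⟩, contrib, atEntry, hd, hm,
        card_decode (below_le A tw) hl, ite_mul, one_mul, zero_mul]
      rfl
    · intro x hx' hne
      rw [if_neg]
      rintro ⟨-, -, h1, h2⟩
      have e1 := dep_injOn (row_lt (Finset.mem_range.1 hx')) hj h1
      have e2 := dep_injOn col_lt hl h2
      exact hne (by rw [← e1, ← e2]; exact (Nat.div_add_mod' x _).symm)
    · intro h
      exact absurd (Finset.mem_range.2 hx) h
  · rw [if_neg hk]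
    split_ifs with h
    · exact Finset.sum_eq_zero fun x _ => if_neg fun h' => hk (by omega)
    · rfl

theorem exists_digits (tw z : ℕ) : ∃ i A B C, A < 2 ^ tw ∧ B < 2 ^ tw ∧ C < 2 ^ tw ∧
    z = i * (2 ^ tw * 2 ^ tw * 2 ^ tw) + A * (2 ^ tw * 2 ^ tw) + B * 2 ^ tw + C := by
  have hW : 0 < 2 ^ tw := by positivity
  generalize 2 ^ tw = W at hW
  refine ⟨z / W / W / W, z / W / W % W, z / W % W, z % W, Nat.mod_lt _ hW, Nat.mod_lt _ hW,
    Nat.mod_lt _ hW, ?_⟩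
  have h1 := Nat.div_add_mod z W
  have h2 := Nat.div_add_mod (z / W) W
  have h3 := Nat.div_add_mod (z / W / W) W
  calc z = W * (z / W) + z % W := h1.symm
    _ = W * (W * (W * (z / W / W / W) + z / W / W % W) + z / W % W) + z % W := by rw [h3, h2]
    _ = _ := by ring

/-- Only rounds with the set `A` encoded in the address `z` touch the cell `z`; for these the claim
is `sum_contrib`. Cells that no round touches have negative addresses or belong to triples where the
convolution vanishes. -/
theorem sum_increment (hf : Admissible n b f) (hg : Admissible n b g) (z : ℤ) :
    ∑ A ∈ Finset.range (2 ^ tw), ∑ k₁ ∈ Finset.range (n + 1), ∑ k₂ ∈ Finset.range (n + 1),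
      ∑ r₁ ∈ Finset.range (tw + 1), ∑ r₂ ∈ Finset.range (tw + 1),
        increment tw f g z A k₁ k₂ r₁ r₂ = layout (conv f g) z := by
  have zero : ∀ A, (∀ k x, (place tw A k x : ℤ) ≠ z) →
      ∑ k₁ ∈ Finset.range (n + 1), ∑ k₂ ∈ Finset.range (n + 1), ∑ r₁ ∈ Finset.range (tw + 1),
        ∑ r₂ ∈ Finset.range (tw + 1), increment tw f g z A k₁ k₂ r₁ r₂ = 0 := fun A h =>
    Finset.sum_eq_zero fun _ _ => Finset.sum_eq_zero fun _ _ => Finset.sum_eq_zero fun _ _ =>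
      Finset.sum_eq_zero fun _ _ => increment_of_ne h
  rcases lt_or_ge z 0 with hz | hz
  · rw [layout, if_pos hz]
    exact Finset.sum_eq_zero fun A _ => zero A fun k x => by omega
  lift z to ℕ using hz
  obtain ⟨i, A, B, C, hA, hB, hC, rfl⟩ := exists_digits tw z
  rw [layout_addr _ _ hA hB hC, Finset.sum_eq_single A]
  rotate_left
  · intro A' hA' hne
    refine zero A' fun k x h => hne ?_
    exact ((place_eq_iff (Finset.mem_range.1 hA') hA hB hC).1 (Nat.cast_inj.1 h)).2.1
  · intro h
    exact absurd (Finset.mem_range.2 hA) h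
  by_cases h : decode tw B ⊆ decode tw A ∧ decode tw C ⊆ decode tw A
  · obtain ⟨j, hj, rfl⟩ := exists_dep hB h.1
    obtain ⟨l, hl, rfl⟩ := exists_dep hC h.2
    simp only [increment_eq hA hj hl]
    rw [sum_contrib A f g hf hg, decode_dep, decode_dep]
  · rw [conv_eq_zero f g hf hg h]
    refine zero A fun k x hx => h ?_
    obtain ⟨-, -, rfl, rfl⟩ := (place_eq_iff hA hA hB hC).1 (Nat.cast_inj.1 hx)
    rw [decode_dep, decode_dep]
    exact ⟨lift_subset tw A _, lift_subset tw A _⟩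

/-- There are at most `4 ^ tw` summands, each bounded as in `abs_product_le`. -/
theorem abs_scattered_le {A k₁ k₂ r₁ r₂ : ℕ} (hf : ∀ i A B C, bits (f i A B C) ≤ b)
    (hg : ∀ i A B C, bits (g i A B C) ≤ b) {M : ℕ} (hM : M ≤ 2 ^ below A tw * 2 ^ below A tw) (z : ℤ) :
    |scattered tw A k₁ k₂ r₁ r₂ (atEntry (product tw A f g k₁ k₂ r₁ r₂)) M z| ≤
      2 ^ (2 * b + 6 * tw) := by
  have ha := below_le A tw
  calc _ ≤ ∑ x ∈ Finset.range M, (2 : ℤ) ^ (2 * (b + tw) + tw + tw) := by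
        refine (Finset.abs_sum_le_sum_abs _ _).trans (Finset.sum_le_sum fun x _ => ?_)
        split_ifs
        · exact abs_product_le hf hg _ _
        all_goals simp
    _ = (M : ℤ) * 2 ^ (2 * (b + tw) + tw + tw) := by simp
    _ ≤ (2 ^ tw * 2 ^ tw) * 2 ^ (2 * (b + tw) + tw + tw) := by
        refine mul_le_mul_of_nonneg_right ?_ (by positivity)
        exact_mod_cast hM.trans (Nat.mul_le_mul (Nat.pow_le_pow_right (by norm_num) ha)
          (Nat.pow_le_pow_right (by norm_num) ha))
    _ = _ := by ring

theorem bits_layout_le (hf : ∀ i A B C, bits (f i A B C) ≤ b) (z : ℤ) : bits (layout f z) ≤ b := by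
  unfold layout
  split_ifs
  · simp
  · exact hf _ _ _ _

/-- The bound on `L` has room for the final sums: at most `2 ^ (3 * tw + 2 * n)` rounds, each adding
at most `2 ^ (2 * b + 6 * tw)` to a cell. -/
theorem runs_program {P : Prog} {L : ℕ} {T : ℕ → ℕ} (hf : Admissible n b f) (hg : Admissible n b g)
    (hL : 2 * b + 9 * tw + 2 * n + 1 < L) (hP : ∀ a ≤ tw, Multiplies P (2 ^ a) (b + tw + 1) (T a))
    (hT : ∀ a ≤ tw, 2 ^ a * 2 ^ a + T a < 2 ^ L) :
    ∃ s', Runs (program P) (input n f g) s'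
      ((n + 1) * ((n + 1) * ((tw + 1) * ((tw + 1) * ∑ A ∈ Finset.range (2 ^ tw),
        (200 * (P.top + 5) * (tw + 1) * (2 ^ below A tw * 2 ^ below A tw + T (below A tw)) * unit L +
          2 * unit L)))) + (3 * tw + 5) * unit L) ∧ s' 3 = layout (conv f g) := by
  set Q := 2 ^ tw * ((n + 1) * ((n + 1) * ((tw + 1) * (tw + 1)))) with hQ
  have hf' := fun i A B C => (hf i A B C).2
  have hg' := fun i A B C => (hg i A B C).2
  have hQL : Q ≤ 2 ^ (3 * tw + 2 * n) := by
    have h1 : n + 1 ≤ 2 ^ n := Nat.lt_two_pow_self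
    have h2 : tw + 1 ≤ 2 ^ tw := Nat.lt_two_pow_self
    calc Q ≤ 2 ^ tw * (2 ^ n * (2 ^ n * (2 ^ tw * 2 ^ tw))) := by rw [hQ]; gcongr
      _ = _ := by ring
  have hsm : ∀ {x e : ℕ}, x ≤ 2 ^ e → e < L → bits (x : ℤ) ≤ L := fun hx he =>
    bits_natCast_le (hx.trans_lt (Nat.pow_lt_pow_right (by norm_num) he))
  have hbtw : bits (tw : ℤ) ≤ L := hsm Nat.lt_two_pow_self.le (by omega)
  have hbn : bits (n : ℤ) ≤ L := hsm (e := n) Nat.lt_two_pow_self.le (by omega)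
  have hin : Small L (input n f g) := by
    intro a _ z
    match a with
    | 0 =>
      simp only [input]
      split_ifs
      exacts [hbtw, hbn, by simp]
    | 1 => exact (bits_layout_le hf' z).trans (by omega)
    | 2 => exact (bits_layout_le hg' z).trans (by omega)
    | a + 3 => simp [input]
  have r1 : Runs (.assign 9 0 1) (input n f g) ((input n f g).write 9 0 1) (unit L) :=
    runs_assign (L := L) (i := 0) (e := 1) trivial trivial (by decide)
  have q1 : Small L ((input n f g).write 9 0 1) := hin.write (hsm (x := 1) (e := 0) (by simp) (by omega))
  obtain ⟨s₂, r2, q2, -, h29, h2⟩ := runs_forLoop (L := L) (v := 5) (m := var 0)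
    (p := .assign 9 0 (var 9 * 2)) (M := tw)
    (fun v σ => Small L σ ∧ σ 5 0 = v ∧ σ 9 0 = (2 ^ v : ℕ) ∧
      ∀ b, b ≠ 5 → b ≠ 9 → σ b = input n f g b)
    (fun _ => unit L) (s := (input n f g).write 9 0 1) (by decide) hbtw
    (by
      rintro x hx σ ⟨h1, h2, -, h4⟩
      refine ⟨?_, h1.bdd rfl, h2⟩
      rw [eval_read, eval_zero, h4 0 (by omega) (by omega)]; simp [input])
    (by
      refine ⟨q1.write (by simp), by simp, ?_, fun b h5 h9 => ?_⟩
      · rw [State.write_ne _ (by omega), State.write_self]; simp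
      · rw [State.write_ne _ h5, State.write_ne _ h9])
    (by
      rintro v hv σ ⟨h1, h2, h3, h4⟩
      have r := runs_assign (L := L) (s := σ) (a := 9) (i := 0) (e := var 9 * 2) trivial
        (h1.bdd rfl) (by decide)
      have ev : (var 9 * 2).eval σ = (2 ^ (v + 1) : ℕ) := by
        rw [eval_mul, eval_read, eval_zero, h3, eval_two, pow_succ]; push_cast; rfl
      rw [ev, eval_zero] at r
      refine ⟨_, r, ?_, ?_, by simp, ?_, fun b h5 h9 => ?_⟩
      · rw [State.write_ne _ (by omega), h2]
      · refine (h1.write (hsm le_rfl (by omega))).write ?_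
        exact_mod_cast hsm (x := v + 1) (e := tw) (hv.trans Nat.lt_two_pow_self) (by omega)
      · rw [State.write_ne _ (by omega), State.write_self]
      · rw [State.write_ne _ h5, State.write_ne _ h9, h4 b h5 h9])
  set κ : ℕ → ℕ := fun A => 200 * (P.top + 5) * (tw + 1) *
    (2 ^ below A tw * 2 ^ below A tw + T (below A tw)) * unit L with hκ
  set inc : ℕ → ℤ → ℤ := fun q z => increment tw f g z (q % 2 ^ tw) (q / 2 ^ tw % (n + 1))
    (q / 2 ^ tw / (n + 1) % (n + 1)) (q / 2 ^ tw / (n + 1) / (n + 1) % (tw + 1))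
    (q / 2 ^ tw / (n + 1) / (n + 1) / (tw + 1)) with hinc
  have hincle : ∀ q z, |inc q z| ≤ 2 ^ (2 * b + 6 * tw) := fun q z =>
    abs_scattered_le hf' hg' (by split_ifs <;> simp) z
  have hsumle : ∀ q z, |∑ q' ∈ Finset.range q, inc q' z| ≤ q * 2 ^ (2 * b + 6 * tw) := by
    intro q z
    refine (Finset.abs_sum_le_sum_abs _ _).trans ((Finset.sum_le_sum fun q' _ => hincle q' z).trans ?_)
    simp
  obtain ⟨s', r3, -, -, h3, -⟩ := runs_forLoop (L := L) (v := 20)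
    (m := var 9 * ((.read 0 1 + 1) * ((.read 0 1 + 1) * ((var 0 + 1) * (var 0 + 1)))))
    (p := body P) (M := Q)
    (fun q σ => Small L σ ∧ σ 20 0 = q ∧ (∀ z, σ 3 z = ∑ q' ∈ Finset.range q, inc q' z) ∧
      ∀ b, b ≤ 2 ∨ b = 9 ∨ 21 ≤ b → σ b = s₂ b)
    (fun q => κ (q % 2 ^ tw)) (s := s₂) (by decide) (hsm hQL (by omega))
    (by
      rintro q hq σ ⟨h1, h3, -, h4⟩
      refine ⟨?_, h1.bdd rfl, h3⟩
      simp only [eval_mul, eval_add, eval_read, eval_zero, eval_one, h4 9 (by omega),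
        h4 0 (by omega), h29, h2 0 (by omega) (by omega)]
      simp [input, hQ])
    (by
      refine ⟨q2.write (by simp), by simp, fun z => ?_, fun b hb => State.write_ne _ (by omega) _ _⟩
      rw [State.write_ne _ (by omega), h2 3 (by omega) (by omega)]
      simp [input])
    (by
      rintro q hq σ ⟨h1, h3, h4, h5⟩
      have hσ : ∀ b, b ≤ 2 ∨ 21 ≤ b → σ b = input n f g b := fun b hb => by
        rw [h5 b (by omega), h2 b (by omega) (by omega)]
      obtain ⟨σ', r, k1, k2, k3⟩ := runs_body (q := q) (n := n) (T := T (below (q % 2 ^ tw) tw)) hf' hg'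
        (hq.trans_le (hQL.trans (Nat.pow_le_pow_right (by norm_num) (by omega))))
        (by omega) rfl rfl rfl rfl rfl (hP _ (below_le _ tw)) (hT _ (below_le _ tw)) h1
        (by rw [hσ 0 (by omega)]; simp [input]) (by rw [hσ 0 (by omega)]; simp [input])
        (by rw [hσ 1 (by omega)]; rfl) (by rw [hσ 2 (by omega)]; rfl)
        (by rw [h5 9 (by omega), h29]) h3
        (by
          intro a ha
          rw [hσ a (by omega)]
          obtain ⟨a, rfl⟩ : ∃ a', a = a' + 3 := ⟨a - 3, by omega⟩
          rfl)
        (by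
          intro M hM z
          -- The `q` finished rounds and the part of the current one together count as at most `q +
          -- 1 ≤ Q` increments.
          refine bits_lt (e := (3 * tw + 2 * n) + (2 * b + 6 * tw)) ?_ (by omega)
          rw [h4 z]
          refine (abs_add_le _ _).trans ((add_le_add (hsumle q z)
            (abs_scattered_le hf' hg' hM z)).trans ?_)
          calc _ = ((q + 1 : ℕ) : ℤ) * 2 ^ (2 * b + 6 * tw) := by push_cast; ring
            _ ≤ 2 ^ (3 * tw + 2 * n) * 2 ^ (2 * b + 6 * tw) :=
              mul_le_mul_of_nonneg_right (by exact_mod_cast (Nat.succ_le_of_lt hq).trans hQL)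
                (by positivity)
            _ = _ := (pow_add _ _ _).symm)
      refine ⟨σ', r, by rw [k3 20 (by omega), h3], ?_, by simp, fun z => ?_, fun b hb => ?_⟩
      · exact k1.write (by exact_mod_cast hsm (x := q + 1) ((Nat.succ_le_of_lt hq).trans hQL) (by omega))
      · rw [State.write_ne _ (by omega), k2 z, h4 z, Finset.sum_range_succ]
        rfl
      · rw [State.write_ne _ (by omega), k3 b (by omega), h5 b (by omega)])
  refine ⟨s', (r1.seq (r2.seq r3)).mono (le_of_eq ?_), ?_⟩
  · rw [sum_select tw n fun A _ _ _ _ => κ A + 2 * unit L]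
    simp only [Finset.sum_const, Finset.card_range, smul_eq_mul, ← Finset.mul_sum]
    ring
  · funext z
    rw [h3 z, ← sum_increment hf hg z, ← sum_select]

end

end SteinerJoin

/-! ### Achievable exponents: none is below `2`, and `3` is one. -/

namespace RAM

/-- An execution changes at most as many cells of an array as it takes time. -/
theorem Exec.exists_changed {p : Prog} {s s' : State} {t : ℕ} (h : Exec p s s' t) (a : ℕ) :
    ∃ F : Finset ℤ, F.card ≤ t ∧ ∀ z ∉ F, s' a z = s a z := by
  have union : ∀ {s₁ s₂ s₃ : State} {t₁ t₂ : ℕ},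
      (∃ F : Finset ℤ, F.card ≤ t₁ ∧ ∀ z ∉ F, s₂ a z = s₁ a z) →
      (∃ F : Finset ℤ, F.card ≤ t₂ ∧ ∀ z ∉ F, s₃ a z = s₂ a z) →
      ∃ F : Finset ℤ, F.card ≤ t₁ + t₂ ∧ ∀ z ∉ F, s₃ a z = s₁ a z := by
    rintro s₁ s₂ s₃ t₁ t₂ ⟨F₁, h₁, e₁⟩ ⟨F₂, h₂, e₂⟩
    refine ⟨F₁ ∪ F₂, (Finset.card_union_le _ _).trans (add_le_add h₁ h₂), fun z hz => ?_⟩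
    rw [Finset.mem_union, not_or] at hz
    rw [e₂ z hz.2, e₁ z hz.1]
  induction h with
  | assign b i e s =>
    refine ⟨{i.eval s}, by rw [Finset.card_singleton]; omega, fun z hz => ?_⟩
    rw [Finset.mem_singleton] at hz
    simp [State.write, hz]
  | seq _ _ ih₁ ih₂ => exact union ih₁ ih₂
  | branch_true _ _ ih =>
    obtain ⟨F, h, e⟩ := ih
    exact ⟨F, by omega, e⟩
  | branch_false _ _ ih =>
    obtain ⟨F, h, e⟩ := ih
    exact ⟨F, by omega, e⟩
  | loop_true _ _ _ ih₁ ih₂ =>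
    obtain ⟨F, h, e⟩ := union ih₁ ih₂
    exact ⟨F, by omega, e⟩
  | loop_false _ => exact ⟨∅, by simp, fun _ _ => rfl⟩

end RAM

namespace MatMul
open RAM

/-- Writing down the product takes quadratic time. -/
theorem InTime.two_le {w : ℝ} (h : InTime w) : 2 ≤ w := by
  obtain ⟨P, K, d, hP⟩ := h
  have key : ∀ N : ℕ, 0 < N → ((N * N : ℕ) : ℝ) ≤ K * ((N.size + 1 : ℕ) : ℝ) ^ d * (N : ℝ) ^ w := by
    intro N hN
    -- For all-ones matrices every entry of the product is `N ≠ 0`, while array `3` is zero at the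
    -- beginning; so `N * N` cells have to be changed.
    obtain ⟨s, t, hx, hs, ht⟩ := hP N 1 (.of fun _ _ => 1) (.of fun _ _ => 1) hN
      (fun _ _ => by rw [Matrix.of_apply]; decide) (fun _ _ => by rw [Matrix.of_apply]; decide)
    obtain ⟨F, hF, e⟩ := hx.exists_changed 3
    refine le_trans ?_ ht
    have hsub : (Finset.range (N * N)).image (fun x : ℕ => (x : ℤ)) ⊆ F := by
      intro z hz
      obtain ⟨x, hx, rfl⟩ := Finset.mem_image.1 hz
      by_contra hzF
      obtain ⟨i, j, hij⟩ := exists_index (Finset.mem_range.1 hx)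
      have h1 := e _ hzF
      rw [hij, hs, Matrix.mul_apply] at h1
      simp [input] at h1
      omega
    have := (Finset.card_le_card hsub).trans hF
    rw [Finset.card_image_of_injective _ Nat.cast_injective, Finset.card_range] at this
    exact_mod_cast this
  by_contra hw
  -- If `w < 2`, then for `N = 2 ^ m` the inequality `key` bounds the exponential `(2 ^ (2 - w)) ^
  -- m` by a constant times `m ^ d`, which fails for large `m`.
  have hr : 1 < (2 : ℝ) ^ (2 - w) := Real.one_lt_rpow (by norm_num) (by linarith)
  have lim := (tendsto_pow_const_div_const_pow_of_one_lt d hr).const_mul (K * 3 ^ d : ℝ)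
  rw [mul_zero] at lim
  obtain ⟨m, hm1, hm⟩ := ((lim.eventually_lt_const zero_lt_one).and
    (Filter.eventually_ge_atTop 1)).exists
  have h1 := key (2 ^ m) (by positivity)
  rw [Nat.size_pow] at h1
  push_cast at h1
  have e1 : (2 : ℝ) ^ m * 2 ^ m = ((2 : ℝ) ^ (2 - w)) ^ m * (2 ^ m) ^ w := by
    rw [← Real.rpow_natCast 2 m, ← Real.rpow_natCast _ m, ← Real.rpow_mul (by norm_num),
      ← Real.rpow_mul (by norm_num), ← Real.rpow_add (by norm_num), ← Real.rpow_add (by norm_num)]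
    congr 1; ring
  rw [e1] at h1
  have h2 := le_of_mul_le_mul_right h1 (by positivity)
  have h3 : ((m : ℝ) + 1 + 1) ^ d ≤ 3 ^ d * (m : ℝ) ^ d := by
    rw [← mul_pow]
    have : (1 : ℝ) ≤ m := by exact_mod_cast hm
    gcongr; linarith
  have h4 : ((2 : ℝ) ^ (2 - w)) ^ m ≤ K * 3 ^ d * (m : ℝ) ^ d := by
    refine h2.trans ?_
    rw [mul_assoc]
    gcongr
  rw [← mul_div_assoc, div_lt_one (by positivity)] at hm1
  linarith

/-- The school method. -/
def school : Prog :=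
  forLoop 4 (var 0 * (var 0 * var 0)) <| .assign 3 (var 4 / var 0) <|
    .read 3 (var 4 / var 0) + .read 1 (var 0 * (var 4 / var 0 / var 0) + var 4 % var 0) *
      .read 2 (var 0 * (var 4 % var 0) + var 4 / var 0 % var 0)

section
variable {N : ℕ} (M M' : Matrix (Fin N) (Fin N) ℤ)

/-- The summand of the entry number `x / N` treated in round `x` of the school method. -/
def schoolTerm (x : ℕ) : ℤ :=
  layout M (N * (x / N / N : ℕ) + (x % N : ℕ)) * layout M' (N * (x % N : ℕ) + (x / N % N : ℕ))

/-- The result of the school method after `x` rounds. -/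
def schoolSum (x : ℕ) (z : ℤ) : ℤ :=
  ∑ y ∈ Finset.range x, if ((y / N : ℕ) : ℤ) = z then schoolTerm M M' y else 0

/-- Round `y` treats the entry number `y / N` and the summation index `y % N`, so the rounds with a
fixed quotient add up one entry. -/
theorem schoolSum_eq (i j : Fin N) :
    schoolSum M M' (N * (N * N)) ((N : ℤ) * i + j) = (M * M') i j := by
  have hN : 0 < N := i.pos
  have hx : N * (i : ℕ) + j < N * N := by
    calc N * (i : ℕ) + j < N * i + N := by have := j.2; omega
      _ = N * (i + 1) := by ring
      _ ≤ N * N := Nat.mul_le_mul_left _ i.2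
  have hd : (N * (i : ℕ) + j) / N = i := by
    rw [Nat.mul_add_div hN, Nat.div_eq_of_lt j.2, add_zero]
  have hm : (N * (i : ℕ) + j) % N = j := by rw [Nat.mul_add_mod, Nat.mod_eq_of_lt j.2]
  unfold schoolSum schoolTerm
  rw [SteinerJoin.sum_range_mul hN _ fun k x => if (x : ℤ) = (N : ℤ) * i + j then
      layout M (N * (x / N : ℕ) + (k : ℕ)) * layout M' (N * (k : ℕ) + (x % N : ℕ)) else 0,
    Matrix.mul_apply, Finset.sum_range]
  refine Finset.sum_congr rfl fun k _ => ?_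
  rw [Finset.sum_eq_single (N * (i : ℕ) + j), if_pos (by push_cast; rfl), hd, hm, layout_apply,
    layout_apply]
  · intro x _ hne
    exact if_neg fun h => hne (by exact_mod_cast h)
  · intro h
    exact absurd (Finset.mem_range.2 hx) h

theorem bits_layout_le {b : ℕ} (h : ∀ i j, bits (M i j) ≤ b) (z : ℤ) : bits (layout M z) ≤ b := by
  unfold layout
  split_ifs
  · exact h _ _
  · simp

theorem abs_schoolSum_le {b : ℕ} (h : ∀ i j, bits (M i j) ≤ b) (h' : ∀ i j, bits (M' i j) ≤ b)
    (x : ℕ) (z : ℤ) : |schoolSum M M' x z| ≤ x * 2 ^ (2 * b) := by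
  calc _ ≤ ∑ y ∈ Finset.range x, (2 : ℤ) ^ (2 * b) := by
        refine (Finset.abs_sum_le_sum_abs _ _).trans (Finset.sum_le_sum fun y _ => ?_)
        split_ifs
        · rw [schoolTerm, abs_mul, two_mul, pow_add]
          exact mul_le_mul (bits_le_iff.1 (bits_layout_le M h _)).le
            (bits_le_iff.1 (bits_layout_le M' h' _)).le (abs_nonneg _) (by positivity)
        · simp
    _ = _ := by simp

theorem runs_school {b L : ℕ} (h : ∀ i j, bits (M i j) ≤ b) (h' : ∀ i j, bits (M' i j) ≤ b)
    (hL : 3 * N.size + 2 * b < L) : ∃ s', Runs school (input M M') s'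
      ((3 * (N * (N * N)) + 2) * unit L) ∧ s' 3 = schoolSum M M' (N * (N * N)) := by
  have hN : N < 2 ^ N.size := Nat.lt_size_self N
  have hN3 : N * (N * N) ≤ 2 ^ (3 * N.size) := by
    calc _ ≤ 2 ^ N.size * (2 ^ N.size * 2 ^ N.size) := by gcongr
      _ = _ := by ring
  have e : ∀ (x : ℤ) (Y : ℤ → ℤ), ∀ b, b ≠ 3 → b ≠ 4 →
      Function.update ((input M M').write 4 0 x) 3 Y b = input M M' b := fun x Y b h3 h4 => by
    rw [Function.update_of_ne h3, State.write_ne _ h4]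
  have hin : Small L (input M M') := by
    intro a _ z
    match a with
    | 0 =>
      simp only [input]
      split_ifs
      · exact SteinerJoin.bits_natCast_le (hN.trans_le (Nat.pow_le_pow_right (by norm_num) (by omega)))
      · simp
    | 1 => exact (bits_layout_le M h z).trans (by omega)
    | 2 => exact (bits_layout_le M' h' z).trans (by omega)
    | a + 3 => simp [input]
  obtain ⟨h1, -⟩ := runs_fill_low (L := L) (v := 4) (a := 3) (m := var 0 * (var 0 * var 0))
    (i := var 4 / var 0)
    (e := .read 3 (var 4 / var 0) + .read 1 (var 0 * (var 4 / var 0 / var 0) + var 4 % var 0) *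
      .read 2 (var 0 * (var 4 % var 0) + var 4 / var 0 % var 0)) (M := N * (N * N))
    (schoolSum M M') (s := input M M') (by decide) (by decide)
    (SteinerJoin.bits_natCast_le (hN3.trans_lt (Nat.pow_lt_pow_right (by norm_num) (by omega))))
    hin (by funext z; simp [schoolSum, input])
    (fun x hx z => SteinerJoin.bits_lt (e := 3 * N.size + 2 * b)
      ((abs_schoolSum_le M M' h h' x z).trans (by
        rw [pow_add]
        exact mul_le_mul_of_nonneg_right (by exact_mod_cast hx.trans hN3) (by positivity))) hL)
    (fun x _ => by
      simp only [eval_mul, eval_read, eval_zero, e _ _ 0 (by omega) (by omega)]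
      simp [input])
    (by
      intro x hx
      have e0 := e x (schoolSum M M' x) 0 (by omega) (by omega)
      have e1 := e x (schoolSum M M' x) 1 (by omega) (by omega)
      have e2 := e x (schoolSum M M' x) 2 (by omega) (by omega)
      have e3 : Function.update ((input M M').write 4 0 x) 3 (schoolSum M M' x) 3 =
        schoolSum M M' x := Function.update_self _ _ _
      have e4 : Function.update ((input M M').write 4 0 x) 3 (schoolSum M M' x) 4 0 = x := by
        rw [Function.update_of_ne (by omega), State.write_self]
      generalize Function.update ((input M M').write 4 0 x) 3 (schoolSum M M' x) = σ at e0 e1 e2 e3 e4 ⊢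
      have v0 : σ 0 0 = N := by rw [e0]; simp [input]
      simp only [eval_add, eval_mul, eval_div, eval_mod, eval_read, eval_zero, v0, e1, e2, e3, e4]
      funext z
      simp only [schoolSum, Finset.sum_range_succ, Function.update_apply]
      have hq : (x : ℤ) / N = (x / N : ℕ) := by push_cast; rfl
      by_cases hz : z = (x / N : ℕ)
      · rw [hq, if_pos hz, if_pos hz.symm, hz, schoolTerm]
        push_cast
        rfl
      · rw [hq, if_neg hz, if_neg (Ne.symm hz), add_zero])
  exact ⟨_, h1, Function.update_self _ _ _⟩

end

/-- Needed only to know that the set of achievable exponents is nonempty, so that its infimum is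
approached by achievable exponents. -/
theorem inTime_three : InTime 3 := by
  refine ⟨school, 5 * 10 ^ 9 * 25, 2, fun N b M M' hN hM hM' => ?_⟩
  obtain ⟨s', ⟨t, ht, hx⟩, h3⟩ := runs_school M M' hM hM' (Nat.lt_succ_self _)
  refine ⟨s', t, hx, fun i j => by rw [h3, schoolSum_eq], ?_⟩
  have hs : 1 ≤ N.size := Nat.size_pos.2 hN
  have h1N : 1 ≤ N ^ 3 := Nat.one_le_pow _ _ hN
  have hfin : t ≤ 5 * 10 ^ 9 * 25 * (N.size + b) ^ 2 * N ^ 3 := by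
    calc t ≤ _ := ht
      _ ≤ (5 * N ^ 3) * (10 ^ 9 * (5 * (N.size + b)) ^ 2) := by
        refine Nat.mul_le_mul ?_ ?_
        · rw [show N * (N * N) = N ^ 3 by ring]; omega
        · exact Nat.mul_le_mul_left _ (Nat.pow_le_pow_left (by omega) 2)
      _ = _ := by ring
  rw [show (3 : ℝ) = ((3 : ℕ) : ℝ) by norm_num, Real.rpow_natCast]
  exact_mod_cast hfin

end MatMul

/-! ### From the exponent of matrix multiplication to the running time. -/

namespace SteinerJoin
open RAM

/-- The binomial theorem, with the subsets `A` grouped by their size. -/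
theorem sum_pow_below (tw : ℕ) (X : ℝ) :
    ∑ A ∈ Finset.range (2 ^ tw), X ^ below A tw = (X + 1) ^ tw := by
  simp only [below_top]
  rw [Finset.sum_range, (decode_bijective tw).sum_comp fun S : Finset (Fin tw) => X ^ S.card]
  have := Fintype.sum_pow_mul_eq_add_pow (Fin tw) X 1
  simpa using this

theorem InTime.mono {c c' : ℝ} (h0 : 0 ≤ c) (hc : c ≤ c') (h : InTime c) : InTime c' := by
  obtain ⟨P, K, d, hP⟩ := h
  refine ⟨P, K, d, fun tw n b f g hf hg => ?_⟩
  obtain ⟨s, t, hx, hs, ht⟩ := hP tw n b f g hf hg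
  exact ⟨s, t, hx, hs, ht.trans (by gcongr)⟩

/-- The round for a set with `a` elements costs, up to polynomial factors, `4 ^ a` for the
transforms and `(2 ^ w) ^ a` for the product. As `w ≥ 2`, the second dominates, and `sum_pow_below`
adds up the rounds. -/
theorem inTime_of_matMul {w : ℝ} (h : MatMul.InTime w) : InTime ((2 : ℝ) ^ w + 1) := by
  have hw := h.two_le
  obtain ⟨P, K, d, hP⟩ := h
  set W := ⌈w⌉₊ with hW
  -- The word length will be `L = c * u` with `u = tw + n + b + 1`. The summands of `c` provide for
  -- the constant, the polynomial and the exponential factor of the time bound of `P`; the rest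
  -- covers the numbers of the surrounding program.
  set c := K + 3 * d + W + 20 with hc
  set X : ℝ := (2 : ℝ) ^ w with hX
  have hX4 : (4 : ℝ) ≤ X := by
    calc (4 : ℝ) = (2 : ℝ) ^ (2 : ℝ) := by norm_num
      _ ≤ X := Real.rpow_le_rpow_of_exponent_le (by norm_num) hw
  have hXa : ∀ a : ℕ, (((2 ^ a : ℕ) : ℝ)) ^ w = X ^ a := fun a => by
    rw [hX, ← Real.rpow_natCast _ a, ← Real.rpow_mul (by norm_num), mul_comm w,
      Real.rpow_mul (by norm_num), Real.rpow_natCast]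
    push_cast; rfl
  have hXW : X ≤ 2 ^ W := by
    rw [hX, ← Real.rpow_natCast]
    exact Real.rpow_le_rpow_of_exponent_le (by norm_num) (Nat.le_ceil w)
  -- `207 = 200 + 2 + 5`: the body of the main loop, the overhead of that loop, and the
  -- initialization. The exponent `d + 7` consists of `4` for the degrees and ranks, `1` for the
  -- factor `tw + 1` in the body, `d` for `P`, and `2` for `unit`.
  refine ⟨program P, 207 * (P.top + 5) * (1 + K) * 3 ^ d * (10 ^ 9 * (c + 1) ^ 2), d + 7,
    fun tw n b f g hf hg => ?_⟩
  set u := tw + n + b + 1 with hu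
  have hu1 : 1 ≤ u := by omega
  -- Execution times are natural numbers, so the real bound may be rounded down.
  set T : ℕ → ℕ := fun a =>
    ⌊(K : ℝ) * (((2 ^ a).size + (b + tw + 1) : ℕ) : ℝ) ^ d * ((2 ^ a : ℕ) : ℝ) ^ w⌋₊ with hT
  have hTle : ∀ a ≤ tw, (T a : ℝ) ≤ K * (3 * u : ℕ) ^ d * X ^ a := by
    intro a ha
    refine (Nat.floor_le (by positivity)).trans ?_
    rw [hXa, Nat.size_pow]
    have : ((a + 1 + (b + tw + 1) : ℕ) : ℝ) ≤ (3 * u : ℕ) := by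
      exact_mod_cast (by omega : a + 1 + (b + tw + 1) ≤ 3 * u)
    gcongr
  have hTnat : ∀ a ≤ tw, T a ≤ 2 ^ (K + 3 * u * d + W * u) := by
    intro a ha
    have h1 : (T a : ℝ) ≤ ((K * (3 * u) ^ d * (2 ^ W) ^ a : ℕ) : ℝ) := by
      refine (hTle a ha).trans ?_
      push_cast
      gcongr
    have h2 : T a ≤ K * (3 * u) ^ d * (2 ^ W) ^ a := by exact_mod_cast h1
    refine h2.trans ?_
    rw [pow_add, pow_add, pow_mul _ _ d, ← pow_mul _ W]
    have h3 : K ≤ 2 ^ K := Nat.lt_two_pow_self.le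
    have h4 : 3 * u ≤ 2 ^ (3 * u) := Nat.lt_two_pow_self.le
    have h5 : W * a ≤ W * u := Nat.mul_le_mul_left _ (by omega)
    gcongr
    norm_num
  have hTL : ∀ a ≤ tw, 2 ^ a * 2 ^ a + T a < 2 ^ (c * u) := by
    intro a ha
    have h1 : 2 ^ a * 2 ^ a ≤ 2 ^ (2 * u) := by
      rw [← pow_add]; exact Nat.pow_le_pow_right (by norm_num) (by omega)
    have hKu : K ≤ K * u := Nat.le_mul_of_pos_right _ hu1
    have hcu : c * u = K * u + 3 * u * d + W * u + 20 * u := by rw [hc]; ring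
    -- Both summands stay below `2 ^ (c * u - 1)`, so their sum stays below `2 ^ (c * u)`.
    have h2 : 2 * u < c * u - 1 := by omega
    have h3 : K + 3 * u * d + W * u < c * u - 1 := by omega
    have h4 := Nat.pow_lt_pow_right (a := 2) (by norm_num) h2
    have h5 := Nat.pow_lt_pow_right (a := 2) (by norm_num) h3
    have h6 : 2 ^ (c * u) = 2 ^ (c * u - 1) + 2 ^ (c * u - 1) := by
      rw [← two_mul, ← pow_succ', Nat.sub_add_cancel (by omega)]
    have := hTnat a ha
    omega
  obtain ⟨s', ⟨t, ht, hx⟩, h3⟩ := runs_program (P := P) (L := c * u) (T := T) hf hg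
    (by
      have : 20 * u ≤ c * u := Nat.mul_le_mul_right _ (by omega)
      omega)
    (fun a _ M M' hM hM' => by
      obtain ⟨σ, t, h1, h2, h3⟩ := hP (2 ^ a) (b + tw + 1) M M' (by positivity) hM hM'
      exact ⟨σ, t, h1, h2, Nat.le_floor h3⟩) hTL
  refine ⟨s', t, hx, h3, ?_⟩
  set U := unit (c * u) with hU
  have hUle : U ≤ 10 ^ 9 * (c + 1) ^ 2 * u ^ 2 := by
    rw [hU, unit, mul_assoc, ← mul_pow]
    gcongr
    calc c * u + 1 ≤ c * u + u := by omega
      _ = (c + 1) * u := by ring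
  clear_value U c
  -- `D` collects all factors of the cost of a round that do not depend on `A`.
  set D : ℝ := 202 * (P.top + 5) * u * ((1 + K) * (3 * u) ^ d) * U with hD
  have h3u : (1 : ℝ) ≤ (3 * u : ℝ) ^ d := by
    refine one_le_pow₀ ?_
    exact_mod_cast (by omega : 1 ≤ 3 * u)
  have hstep : ∀ A, ((200 * (P.top + 5) * (tw + 1) *
      (2 ^ below A tw * 2 ^ below A tw + T (below A tw)) * U + 2 * U : ℕ) : ℝ) ≤
      D * X ^ below A tw := by
    intro A
    have hX1 : (1 : ℝ) ≤ X ^ below A tw := one_le_pow₀ (by linarith)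
    have h1 : (2 : ℝ) ^ below A tw * 2 ^ below A tw + T (below A tw) ≤
        (1 + K) * (3 * u) ^ d * X ^ below A tw := by
      have e1 : (2 : ℝ) ^ below A tw * 2 ^ below A tw ≤ (3 * u) ^ d * X ^ below A tw := by
        calc (2 : ℝ) ^ below A tw * 2 ^ below A tw = 4 ^ below A tw := by rw [← mul_pow]; norm_num
          _ ≤ X ^ below A tw := by gcongr
          _ ≤ _ := le_mul_of_one_le_left (by positivity) h3u
      have e2 := hTle _ (below_le A tw)
      push_cast at e2
      linarith
    have h2 : (1 : ℝ) ≤ (P.top + 5) * u * ((1 + K) * (3 * u) ^ d * X ^ below A tw) := by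
      have e1 : (1 : ℝ) ≤ P.top + 5 := by have := Nat.cast_nonneg (α := ℝ) P.top; linarith
      have e2 : (1 : ℝ) ≤ u := by exact_mod_cast hu1
      have e3 : (1 : ℝ) ≤ 1 + K := by have := Nat.cast_nonneg (α := ℝ) K; linarith
      exact one_le_mul_of_one_le_of_one_le (one_le_mul_of_one_le_of_one_le e1 e2)
        (one_le_mul_of_one_le_of_one_le (one_le_mul_of_one_le_of_one_le e3 h3u) hX1)
    have h3 : ((tw + 1 : ℕ) : ℝ) ≤ u := by exact_mod_cast (by omega : tw + 1 ≤ u)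
    push_cast at h3 ⊢
    calc _ ≤ 200 * ((P.top : ℝ) + 5) * u * ((1 + K) * (3 * u) ^ d * X ^ below A tw) * U +
          2 * ((P.top + 5) * u * ((1 + K) * (3 * u) ^ d * X ^ below A tw)) * U := by
          gcongr
          linarith
      _ = _ := by rw [hD]; ring
  have hY : (1 : ℝ) ≤ (X + 1) ^ tw := one_le_pow₀ (by linarith)
  have hn : ((n + 1 : ℕ) : ℝ) ≤ u := by exact_mod_cast (by omega : n + 1 ≤ u)
  have htw : ((tw + 1 : ℕ) : ℝ) ≤ u := by exact_mod_cast (by omega : tw + 1 ≤ u)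
  have h5 : ((3 * tw + 5 : ℕ) : ℝ) ≤ 5 * u := by exact_mod_cast (by omega : 3 * tw + 5 ≤ 5 * u)
  have hu1' : (1 : ℝ) ≤ u := by exact_mod_cast hu1
  have hD0 : 0 ≤ D := by positivity
  have hUr : (U : ℝ) ≤ 10 ^ 9 * (c + 1) ^ 2 * u ^ 2 := by exact_mod_cast hUle
  calc (t : ℝ) ≤ _ := Nat.cast_le.2 ht
    _ = ((n + 1 : ℕ) : ℝ) * ((n + 1 : ℕ) * ((tw + 1 : ℕ) * ((tw + 1 : ℕ) *
        ∑ A ∈ Finset.range (2 ^ tw), ((200 * (P.top + 5) * (tw + 1) *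
      (2 ^ below A tw * 2 ^ below A tw + T (below A tw)) * U + 2 * U : ℕ) : ℝ)))) +
        (3 * tw + 5 : ℕ) * U := by push_cast; rfl
    _ ≤ (u : ℝ) * (u * (u * (u * ∑ A ∈ Finset.range (2 ^ tw), D * X ^ below A tw))) +
        5 * u * U := by
      have hS := Finset.sum_le_sum fun A (_ : A ∈ Finset.range (2 ^ tw)) => hstep A
      have hS0 : (0 : ℝ) ≤ ∑ A ∈ Finset.range (2 ^ tw), ((200 * (P.top + 5) * (tw + 1) *
        (2 ^ below A tw * 2 ^ below A tw + T (below A tw)) * U + 2 * U : ℕ) : ℝ) :=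
        Finset.sum_nonneg fun _ _ => Nat.cast_nonneg _
      generalize (∑ A ∈ Finset.range (2 ^ tw), ((200 * (P.top + 5) * (tw + 1) *
        (2 ^ below A tw * 2 ^ below A tw + T (below A tw)) * U + 2 * U : ℕ) : ℝ)) = S at hS hS0 ⊢
      gcongr
    _ = u ^ 4 * D * (X + 1) ^ tw + 5 * u * U * 1 := by
      rw [← Finset.mul_sum, sum_pow_below]; ring
    _ ≤ u ^ 4 * D * (X + 1) ^ tw + 5 * u * U * (X + 1) ^ tw := by gcongr
    _ = (202 * (P.top + 5) * (1 + K) * 3 ^ d * u ^ (d + 5) + 5 * u) * U * (X + 1) ^ tw := by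
      rw [hD, mul_pow]; ring
    _ ≤ (202 * (P.top + 5) * (1 + K) * 3 ^ d * u ^ (d + 5) +
        5 * ((P.top + 5) * (1 + K) * 3 ^ d * u ^ (d + 5))) * U * (X + 1) ^ tw := by
      have e1 : (u : ℝ) ≤ u ^ (d + 5) := le_self_pow₀ hu1' (by omega)
      have e2 : (1 : ℝ) ≤ (P.top + 5) * (1 + K) * 3 ^ d := by
        exact_mod_cast Nat.one_le_iff_ne_zero.2 (by positivity)
      have e3 : (u : ℝ) ≤ (P.top + 5) * (1 + K) * 3 ^ d * u ^ (d + 5) :=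
        e1.trans (le_mul_of_one_le_left (by positivity) e2)
      gcongr
    _ ≤ (202 * (P.top + 5) * (1 + K) * 3 ^ d * u ^ (d + 5) +
        5 * ((P.top + 5) * (1 + K) * 3 ^ d * u ^ (d + 5))) * (10 ^ 9 * (c + 1) ^ 2 * u ^ 2) *
        (X + 1) ^ tw := by gcongr
    _ = _ := by push_cast; ring

end SteinerJoin

theorem mainTheorem8 :
    (∀ w : ℝ, MatMul.InTime w → SteinerJoin.InTime ((2 : ℝ) ^ w + 1)) ∧
    (∀ ε : ℝ, 0 < ε → SteinerJoin.InTime ((2 : ℝ) ^ (MatMul.omega + ε) + 1)) := by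
  refine ⟨fun w hw => SteinerJoin.inTime_of_matMul hw, fun ε hε => ?_⟩
  -- Achievability of the infimum itself is not known, so an achievable `w` below `omega + ε` is
  -- taken and the bound is weakened by monotonicity.
  obtain ⟨w, hw, hlt⟩ := exists_lt_of_csInf_lt (s := {w : ℝ | MatMul.InTime w})
    ⟨3, MatMul.inTime_three⟩ (show sInf _ < MatMul.omega + ε from lt_add_of_pos_right _ hε)
  refine (SteinerJoin.inTime_of_matMul hw).mono (by positivity) ?_
  gcongr
  norm_num
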